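/- Let $X$ be a compact connected Riemann surface and $L$ a holomorphic line bundle on $X$. An $L$-twisted $\mathrm{U}(p,q)$-Higgs bundle on $X$ is a quadruple $E=(V,W,\beta,\gamma)$, where $V$ and $W$ are holomorphic vector bundles on $X$ of ranks $p\geq 1$ and $q\geq 1$, and $\beta\colon W\to V\otimes L$ and $\gamma\colon V\to W\otimes L$ are holomorphic bundle maps. A subobject of $E$ is a pair $(V',W')$ of holomorphic subbundles $V'\subseteq V$, $W'\subseteq W$ with $\beta(W')\subseteq V'\otimes L$ and $\gamma(V')\subseteq W'\otimes L$; it is non-trivial if it is neither $(0,0)$ nor $(V,W)$. For $\alpha\in\mathbb{R}$, the $\alpha$-slope of a non-zero pair $(V',W')$ is $$\mu_\alpha(V',W')=\frac{\deg V'+\deg W'}{\operatorname{rk}V'+\operatorname{rk}W'}+\alpha\,\frac{\operatorname{rk}V'}{\operatorname{rk}V'+\operatorname{rk}W'},$$ and $E$ is $\alpha$-semistable if $\mu_\alpha(V',W')\leq\mu_\alpha(V,W)$ for every non-trivial subobject $(V',W')$ of $E$. Write $\mu(V)=\deg(V)/p$ and $\mu(W)=\deg(W)/q$. **Proposition.**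 Assume that $p\neq q$, let $\alpha\in\mathbb{R}$, and let $E=(V,W,\beta,\gamma)$ be an $\alpha$-semistable $L$-twisted $\mathrm{U}(p,q)$-Higgs bundle on $X$. Then $\alpha_m\leq\alpha\leq\alpha_M$, where $$\alpha_m=\begin{cases}-\dfrac{2\max\{p,q\}}{|q-p|}\bigl(\mu(V)-\mu(W)\bigr)-\dfrac{p+q}{|q-p|}\deg(L)&\text{if }\mu(V)-\mu(W)>-\deg(L),\\[2mm]-\bigl(\mu(V)-\mu(W)\bigr)&\text{if }\mu(V)-\mu(W)\leq-\deg(L),\end{cases}$$ and $$\alpha_M=\begin{cases}-\dfrac{2\max\{p,q\}}{|q-p|}\bigl(\mu(V)-\mu(W)\bigr)+\dfrac{p+q}{|q-p|}\deg(L)&\text{if }\mu(V)-\mu(W)<\deg(L),\\[2mm]-\bigl(\mu(V)-\mu(W)\bigr)&\text{if }\mu(V)-\mu(W)\geq\deg(L).\end{cases}$$ -/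

import Mathlib

open Set MeasureTheory Bundle Module
open scoped Manifold ContDiff Bundle TensorProduct Topology

noncomputable section

namespace TwistedHiggs

/-! ### Holomorphic vector bundles on a Riemann surface

A Riemann surface is a connected complex manifold `X` modelled on `ℂ`, and a holomorphic vector
bundle on it is a Mathlib vector bundle `V` with model fibre `F` and holomorphic transition
functions (`ContMDiffVectorBundle ω F V 𝓘(ℂ)`). -/

section Bundles

variable {X : Type*} [TopologicalSpace X] [ChartedSpace ℂ X]
variable (F : Type*) [NormedAddCommGroup F] [NormedSpace ℂ F]
variable {V : X → Type*} [∀ x, AddCommGroup (V x)] [∀ x, Module ℂ (V x)]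
  [∀ x, TopologicalSpace (V x)] [TopologicalSpace (TotalSpace F V)] [FiberBundle F V]

/-- The section `s` of `V` is holomorphic on the set `U` (used for open `U` only). -/
def IsHolomorphicOn (U : Set X) (s : ∀ x, V x) : Prop :=
  ContMDiffOn 𝓘(ℂ) (𝓘(ℂ).prod 𝓘(ℂ, F)) ω (fun x => TotalSpace.mk' F x (s x)) U

/-- The sections `s 0, …, s (k - 1)` of `V` form, over the open set `U`, a holomorphic frame of the
family `S` of linear subspaces of the fibres of `V`. -/
structure IsHolomorphicFrameOn {k : ℕ} (S : ∀ x, Submodule ℂ (V x)) (U : Set X)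
    (s : Fin k → ∀ x, V x) : Prop where
  isOpen : IsOpen U
  holomorphic : ∀ i, IsHolomorphicOn F U (s i)
  linearIndependent : ∀ x ∈ U, LinearIndependent ℂ (fun i => s i x)
  span_eq : ∀ x ∈ U, Submodule.span ℂ (Set.range fun i => s i x) = S x

/-- The family `S` of linear subspaces of the fibres of `V` is a holomorphic subbundle of rank `k`:
it has a holomorphic frame of `k` sections in a neighbourhood of every point. -/
def IsHolomorphicSubbundle (S : ∀ x, Submodule ℂ (V x)) (k : ℕ) : Prop :=
  ∀ x : X, ∃ (U : Set X) (s : Fin k → ∀ x, V x), x ∈ U ∧ IsHolomorphicFrameOn F S U s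

variable (V) in
/-- A smooth Hermitian metric on the holomorphic vector bundle `V` (conjugate-linear in the first
variable). Smoothness is tested on pairs of local holomorphic sections; as `V` has local
holomorphic frames, this is smoothness of the metric coefficients. -/
structure HermitianMetric where
  form : ∀ x, V x →ₗ⋆[ℂ] V x →ₗ[ℂ] ℂ
  conj_symm : ∀ x v w, starRingEnd ℂ (form x v w) = form x w v
  pos_def : ∀ x v, v ≠ 0 → 0 < (form x v v).re
  smooth : ∀ (U : Set X) (s t : ∀ x, V x), IsOpen U →
    IsHolomorphicOn F U s → IsHolomorphicOn F U t →
    ContMDiffOn 𝓘(ℝ, ℂ) 𝓘(ℝ, ℂ) ∞ (fun x => form x (s x) (t x)) U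

variable {F}

/-- The logarithm `log det (h(sᵢ, sⱼ))` of the Gram determinant of `s 0, …, s (k - 1)`. -/
def HermitianMetric.logGram (h : HermitianMetric F V) {k : ℕ} (s : Fin k → ∀ x, V x) (x : X) : ℝ :=
  Real.log (Matrix.det (Matrix.of fun i j : Fin k => h.form x (s i x) (s j x))).re

variable (F)

/-- `IsDegree F S k d`: the real number `d` is the degree `∫_X c₁(S, h)` of the holomorphic
subbundle `S ⊆ V` of rank `k`, computed by Chern–Weil theory from some Hermitian metric `h` on `V`,
restricted to `S`.

In a coordinate `z = x + iy` and a holomorphic frame `s` of `S`, the first Chern form is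
`(i / 2π) ∂̄∂ log det h(sᵢ, sⱼ) = -(1 / 4π) Δ (log det h(sᵢ, sⱼ)) dx ∧ dy`, where `Δ` is the
Euclidean Laplacian. This form is integrated over `X` by means of a smooth partition of unity `ρ`
which is subordinate to a finite cover by open sets `U a`, each of which lies in the domain of a
chart and carries a holomorphic frame of `S`. As is well known, the value depends neither on `h`
nor on the partition of unity, the charts and the frames. -/
def IsDegree (S : ∀ x, Submodule ℂ (V x)) (k : ℕ) (d : ℝ) : Prop :=
  ∃ (h : HermitianMetric F V) (N : ℕ) (ρ : SmoothPartitionOfUnity (Fin N) 𝓘(ℝ, ℂ) X)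
    (U : Fin N → Set X) (c : Fin N → X) (s : Fin N → Fin k → ∀ x, V x),
    ρ.IsSubordinate U ∧
    (∀ a, U a ⊆ (chartAt ℂ (c a)).source) ∧
    (∀ a, IsHolomorphicFrameOn F S (U a) (s a)) ∧
    d = ∑ a, ∫ z in (chartAt ℂ (c a)).target,
      ρ a ((chartAt ℂ (c a)).symm z) *
        (-(1 / (4 * Real.pi)) *
          Laplacian.laplacian (fun w : ℂ => h.logGram (s a) ((chartAt ℂ (c a)).symm w)) z)

open Classical in
/-- The degree of the rank `k` holomorphic subbundle `S` of `V` (on a compact Riemann surface). -/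
def degree (S : ∀ x, Submodule ℂ (V x)) (k : ℕ) : ℝ :=
  if h : ∃ d, IsDegree F S k d then h.choose else 0

variable (V) in
/-- The degree of the whole vector bundle `V`, of rank `dim F`. -/
def bundleDegree : ℝ := degree F (fun x => (⊤ : Submodule ℂ (V x))) (finrank ℂ F)

end Bundles

/-! ### Twisted `U(p,q)`-Higgs bundles -/

section Higgs

variable {X : Type*} [TopologicalSpace X] [ChartedSpace ℂ X]
variable (F₁ : Type*) [NormedAddCommGroup F₁] [NormedSpace ℂ F₁]
  (V : X → Type*) [∀ x, AddCommGroup (V x)] [∀ x, Module ℂ (V x)]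
  [∀ x, TopologicalSpace (V x)] [TopologicalSpace (TotalSpace F₁ V)] [FiberBundle F₁ V]
variable (F₂ : Type*) [NormedAddCommGroup F₂] [NormedSpace ℂ F₂]
  (W : X → Type*) [∀ x, AddCommGroup (W x)] [∀ x, Module ℂ (W x)]
  [∀ x, TopologicalSpace (W x)] [TopologicalSpace (TotalSpace F₂ W)] [FiberBundle F₂ W]
variable (F₃ : Type*) [NormedAddCommGroup F₃] [NormedSpace ℂ F₃]
  (L : X → Type*) [∀ x, AddCommGroup (L x)] [∀ x, Module ℂ (L x)]
  [∀ x, TopologicalSpace (L x)] [TopologicalSpace (TotalSpace F₃ L)] [FiberBundle F₃ L]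

variable {V W L} in
/-- For a line bundle `L`, the fibrewise linear map `φ : V → W ⊗ L` is holomorphic: if `s` is a
local holomorphic section of `V` and `l` a local holomorphic frame of `L`, then `φ(s) = t ⊗ l` for a
holomorphic section `t` of `W`. -/
def IsHolomorphicTwistedMap (φ : ∀ x, V x →ₗ[ℂ] W x ⊗[ℂ] L x) : Prop :=
  ∀ (U : Set X) (s : ∀ x, V x) (l : ∀ x, L x), IsOpen U →
    IsHolomorphicOn F₁ U s → IsHolomorphicOn F₃ U l → (∀ x ∈ U, l x ≠ 0) →
    ∃ t : ∀ x, W x, IsHolomorphicOn F₂ U t ∧ ∀ x ∈ U, φ x (s x) = t x ⊗ₜ[ℂ] l x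

/-- The `L`-twisted Higgs bundle `(V, W, β, γ)`: holomorphic bundle maps `β : W → V ⊗ L` and
`γ : V → W ⊗ L`, for given holomorphic vector bundles `V`, `W` and a given line bundle `L`. Its
`(p, q)` are the ranks of `V` and `W`, that is, the dimensions of their model fibres. -/
structure TwistedHiggsBundle where
  β : ∀ x, W x →ₗ[ℂ] V x ⊗[ℂ] L x
  γ : ∀ x, V x →ₗ[ℂ] W x ⊗[ℂ] L x
  holomorphic_β : IsHolomorphicTwistedMap F₂ F₁ F₃ β
  holomorphic_γ : IsHolomorphicTwistedMap F₁ F₂ F₃ γ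

/-- The `α`-slope of a (sub-)object with ranks `p, q` and degrees `a, b`. -/
def alphaSlope (α : ℝ) (p q : ℕ) (a b : ℝ) : ℝ := (a + b) / (p + q) + α * (p / (p + q))

namespace TwistedHiggsBundle

variable {F₁ V F₂ W F₃ L}
variable (E : TwistedHiggsBundle F₁ V F₂ W F₃ L)

/-- The holomorphic subbundles `V' ⊆ V` of rank `p'` and `W' ⊆ W` of rank `q'` form a subobject of
`E`, i.e. `β(W') ⊆ V' ⊗ L` and `γ(V') ⊆ W' ⊗ L`. -/
structure IsSubobject (V' : ∀ x, Submodule ℂ (V x)) (p' : ℕ)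
    (W' : ∀ x, Submodule ℂ (W x)) (q' : ℕ) : Prop where
  left : IsHolomorphicSubbundle F₁ V' p'
  right : IsHolomorphicSubbundle F₂ W' q'
  map_β : ∀ x, ∀ w ∈ W' x, E.β x w ∈ LinearMap.range ((V' x).subtype.rTensor (L x))
  map_γ : ∀ x, ∀ v ∈ V' x, E.γ x v ∈ LinearMap.range ((W' x).subtype.rTensor (L x))

/-- The Higgs bundle `E` is `α`-semistable: every subobject other than `(0, 0)` and `E` itself has
`α`-slope at most that of `E`. -/
def IsSemistable (α : ℝ) : Prop :=
  ∀ (V' : ∀ x, Submodule ℂ (V x)) (p' : ℕ) (W' : ∀ x, Submodule ℂ (W x)) (q' : ℕ),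
    E.IsSubobject V' p' W' q' →
    ¬ (∀ x, V' x = ⊥ ∧ W' x = ⊥) → ¬ (∀ x, V' x = ⊤ ∧ W' x = ⊤) →
    alphaSlope α p' q' (degree F₁ V' p') (degree F₂ W' q') ≤
      alphaSlope α (finrank ℂ F₁) (finrank ℂ F₂) (bundleDegree F₁ V) (bundleDegree F₂ W)

end TwistedHiggsBundle

/-- The lower bound `α_m`, as a function of `p`, `q`, `δ = μ(V) - μ(W)` and `d = deg L`. -/
def alphaMin (p q : ℕ) (δ d : ℝ) : ℝ :=
  if -d < δ then -(2 * max (p : ℝ) q / |(q : ℝ) - p|) * δ - (p + q) / |(q : ℝ) - p| * d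
  else -δ

/-- The upper bound `α_M`, as a function of `p`, `q`, `δ = μ(V) - μ(W)` and `d = deg L`. -/
def alphaMax (p q : ℕ) (δ d : ℝ) : ℝ :=
  if δ < d then -(2 * max (p : ℝ) q / |(q : ℝ) - p|) * δ + (p + q) / |(q : ℝ) - p| * d
  else -δ

end Higgs

end TwistedHiggs

end

open Set MeasureTheory Bundle Module
open scoped Manifold ContDiff Bundle TensorProduct Topology

noncomputable section

set_option linter.unusedSectionVars false

namespace TwistedHiggs

/-! ### The Laplacian on the complex plane -/

open Laplacian InnerProductSpace

/-! Let `N ⊆ V` and `I ⊗ L ⊆ W ⊗ L` be the saturations of the kernel and the image of `γ`, of ranks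
`k` and `r` with `k + r = p`. Both `(N, 0)` and `(V, I)` are subobjects. Adding the two
semistability inequalities, each multiplied by its rank, bounds `deg N + deg I` from above.

In the other direction, `γ` induces a map `V / N → I ⊗ L` which is an isomorphism off isolated
points. Its determinant is a non-zero section of a line bundle, whence `deg V ≤ deg N + deg I + r
deg L` (`degree_le_of_isSmithFrame`). With `δ = μ(V) - μ(W)` and `d = deg L` the result is `2pq(α +
δ) ≤ r(α + d)(p + q)`. As `r ≤ min(p, q) < max(p, q)`, this gives `α ≤ α_M`
(`le_alphaMax_of_mul_le`). The lower bound is the upper bound for `(W, V, γ, β)` and `-α`.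

Degrees are Chern–Weil integrals, so the degree inequality is proved by analysis. Let `Φ` be the
squared norm of the determinant. Off its zeros, `log Φ` has Laplacian `κ`, the corresponding
combination of curvatures. The function `log (Φ + ε)` is smooth on all of `X`, so its Laplacian
integrates to `0`, while off the zeros this Laplacian is at least `Φ / (Φ + ε) * κ`. Letting `ε → 0`
yields `∫ κ ≤ 0` (`ChartPartition.integral_nonpos`). Stokes' theorem in the form
`ChartPartition.integral_chartLaplacian` also makes the degree independent of the metric
(`degree_eq_integral`).

The bundles `N` and `I` come from algebra: germs of holomorphic functions form a discrete valuation
ring, so `γ` has a Smith normal form near each point (`exists_isSmithFrame`). The spans of these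
local frames agree on overlaps (`exists_saturated_ker_image`). -/

theorem laplacian_eq_fderiv_fderiv (f : ℂ → ℝ) (z : ℂ) :
    Laplacian.laplacian f z = fderiv ℝ (fderiv ℝ f) z 1 1
      + fderiv ℝ (fderiv ℝ f) z Complex.I Complex.I := by
  rw [laplacian_eq_iteratedFDeriv_complexPlane]
  simp [iteratedFDeriv_two_apply]

/-- Multiplication by `a` is a rotation scaled by `‖a‖`, and the trace of a symmetric form is the
same in every orthonormal basis. -/
theorem bilinear_conformal (B : ℂ →L[ℝ] ℂ →L[ℝ] ℝ) (hB : ∀ v w, B v w = B w v) (a : ℂ) :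
    B a a + B (a * Complex.I) (a * Complex.I) =
      ‖a‖ ^ 2 * (B 1 1 + B Complex.I Complex.I) := by
  have key : ∀ x y : ℝ, ∀ v w : ℂ, B (x • 1 + y • Complex.I) (x • 1 + y • Complex.I)
      = x ^ 2 * B 1 1 + 2 * (x * y) * B 1 Complex.I + y ^ 2 * B Complex.I Complex.I := by
    intro x y v w
    simp only [map_add, map_smul, add_apply, smul_apply,
      smul_eq_mul, hB Complex.I 1]
    ring
  have h1 : a = a.re • (1 : ℂ) + a.im • Complex.I := by
    apply Complex.ext <;> simp
  have h2 : a * Complex.I = (-a.im) • (1 : ℂ) + a.re • Complex.I := by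
    apply Complex.ext <;> simp
  rw [h2, key _ _ 0 0, Complex.sq_norm, Complex.normSq_apply]
  nth_rw 1 2 [h1]
  rw [key _ _ 0 0]
  ring

/-- Written with `mul`, the real derivative is a continuous linear function of the complex one, so
it can be differentiated a second time by the chain rule. -/
theorem hasFDerivAt_real_mul {τ : ℂ → ℂ} {z t : ℂ} (h : HasDerivAt τ t z) :
    HasFDerivAt τ ((ContinuousLinearMap.mul ℝ ℂ) t) z :=
  (h.hasFDerivAt.restrictScalars ℝ).congr_fderiv (by ext; simp [mul_comm])

/-- The second derivative of `f ∘ τ` in direction `v` is `D²f(τ'v, τ'v) + Df(τ''v²)`. Summed over `v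
= 1` and `v = i`, the last terms cancel because `i² = -1`, and `bilinear_conformal` evaluates the
others. -/
theorem laplacian_comp_analytic {f : ℂ → ℝ} {τ : ℂ → ℂ} {z : ℂ} (hτ : AnalyticAt ℂ τ z)
    (hf : ContDiffAt ℝ 2 f (τ z)) :
    Laplacian.laplacian (f ∘ τ) z = ‖deriv τ z‖ ^ 2 * Laplacian.laplacian f (τ z) := by
  have hfd : ∀ᶠ w in 𝓝 (τ z), DifferentiableAt ℝ f w := by
    filter_upwards [hf.eventually (by simp)] with w hw using hw.differentiableAt (by simp)
  have h1 : fderiv ℝ (f ∘ τ) =ᶠ[𝓝 z] fun w =>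
      (fderiv ℝ f (τ w)).comp ((ContinuousLinearMap.mul ℝ ℂ) (deriv τ w)) := by
    filter_upwards [hτ.continuousAt.eventually hfd, hτ.eventually_analyticAt] with w hw hw'
    have h2 : HasFDerivAt τ ((ContinuousLinearMap.mul ℝ ℂ) (deriv τ w)) w := hasFDerivAt_real_mul hw'.differentiableAt.hasDerivAt
    exact (hw.hasFDerivAt.comp w h2).fderiv
  have h4 : HasFDerivAt (fderiv ℝ f) (fderiv ℝ (fderiv ℝ f) (τ z)) (τ z) := by
    have : ContDiffAt ℝ 1 (fderiv ℝ f) (τ z) := hf.fderiv_right (by norm_num)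
    exact (this.differentiableAt (by simp)).hasFDerivAt
  have h5 : HasFDerivAt τ ((ContinuousLinearMap.mul ℝ ℂ) (deriv τ z)) z := hasFDerivAt_real_mul hτ.differentiableAt.hasDerivAt
  have h6 : HasFDerivAt (deriv τ) ((ContinuousLinearMap.mul ℝ ℂ) (deriv (deriv τ) z)) z := hasFDerivAt_real_mul hτ.deriv.differentiableAt.hasDerivAt
  have h7 := (h4.comp z h5).clm_comp (((ContinuousLinearMap.mul ℝ ℂ).hasFDerivAt).comp z h6)
  have h8 := h7.fderiv
  have hsym : ∀ v w, fderiv ℝ (fderiv ℝ f) (τ z) v w = fderiv ℝ (fderiv ℝ f) (τ z) w v := by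
    intro v w
    exact (hf.isSymmSndFDerivAt (by simp)).eq v w
  rw [laplacian_eq_fderiv_fderiv, laplacian_eq_fderiv_fderiv, h1.fderiv_eq]
  rw [← bilinear_conformal _ hsym]
  have h9 : fderiv ℝ (fun w => (fderiv ℝ f (τ w)).comp ((ContinuousLinearMap.mul ℝ ℂ) (deriv τ w))) z
    = _ := h8
  rw [h9]
  simp
  have h10 : deriv (deriv τ) z * Complex.I * Complex.I = - deriv (deriv τ) z := by
    rw [mul_assoc, Complex.I_mul_I]; ring
  rw [h10]
  simp
  ring

/-- This is integration by parts against the constant function `1`. -/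
theorem integral_fderiv_apply_eq_zero {g : ℂ → ℝ} (hg : ContDiff ℝ 1 g) (hc : HasCompactSupport g)
    (v : ℂ) : ∫ z, fderiv ℝ g z v = 0 := by
  have hd : Differentiable ℝ g := hg.differentiable (by simp)
  have hcont : Continuous fun z => fderiv ℝ g z v :=
    (hg.continuous_fderiv (by simp)).clm_apply continuous_const
  have hcs : HasCompactSupport fun z => fderiv ℝ g z v := by
    exact (hc.fderiv (𝕜 := ℝ)).comp_left (g := fun l : ℂ →L[ℝ] ℝ => l v) (by simp)
  have := integral_bilinear_hasLineDerivAt_right_eq_neg_left_of_integrable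
    (μ := (volume : Measure ℂ)) (f := fun _ : ℂ => (1 : ℝ)) (f' := fun _ => 0) (g := g)
    (g' := fun z => fderiv ℝ g z v) (v := v) (B := ContinuousLinearMap.mul ℝ ℝ)
    (by simp) (by simpa using hcont.integrable_of_hasCompactSupport hcs)
    (by simpa using hg.continuous.integrable_of_hasCompactSupport hc)
    (fun x _ => by
      have := (hasFDerivAt_const (𝕜 := ℝ) (1 : ℝ) x).hasLineDerivAt v
      simpa using this)
    (fun x _ => (hd x).hasFDerivAt.hasLineDerivAt v)
  simpa using this

theorem integral_laplacian_eq_zero {f : ℂ → ℝ} (hf : ContDiff ℝ 2 f) (hc : HasCompactSupport f) :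
    ∫ z, Laplacian.laplacian f z = 0 := by
  have hd : ContDiff ℝ 1 (fderiv ℝ f) := hf.fderiv_right (by norm_num)
  have key : ∀ v : ℂ, (∫ z, fderiv ℝ (fderiv ℝ f) z v v = 0) ∧
      Integrable (fun z => fderiv ℝ (fderiv ℝ f) z v v) := by
    intro v
    have h1 : ContDiff ℝ 1 fun z => fderiv ℝ f z v := hd.clm_apply contDiff_const
    have h2 : HasCompactSupport fun z => fderiv ℝ f z v :=
      (hc.fderiv (𝕜 := ℝ)).comp_left (g := fun l : ℂ →L[ℝ] ℝ => l v) (by simp)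
    have h3 : ∀ z, fderiv ℝ (fderiv ℝ f) z v v = fderiv ℝ (fun z => fderiv ℝ f z v) z v := by
      intro z
      have h4 := ((hd.differentiable (by simp) z).hasFDerivAt).clm_apply (hasFDerivAt_const v z)
      rw [h4.fderiv]
      simp
    simp_rw [h3]
    refine ⟨integral_fderiv_apply_eq_zero h1 h2 v, ?_⟩
    exact ((h1.continuous_fderiv (by simp)).clm_apply continuous_const).integrable_of_hasCompactSupport
      ((h2.fderiv (𝕜 := ℝ)).comp_left (g := fun l : ℂ →L[ℝ] ℝ => l v) (by simp))
  simp_rw [laplacian_eq_fderiv_fderiv]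
  rw [integral_add (key 1).2 (key Complex.I).2, (key 1).1, (key _).1, add_zero]

theorem contDiffAt_log_normSq {a : ℂ → ℂ} {z : ℂ} (ha : AnalyticAt ℂ a z) (h0 : a z ≠ 0) :
    ContDiffAt ℝ 2 (fun w => Real.log (‖a w‖ ^ 2)) z ∧
      Laplacian.laplacian (fun w => Real.log (‖a w‖ ^ 2)) z = 0 := by
  have h := (ha.harmonicAt_log_norm h0).const_smul (c := (2 : ℝ))
  have h2 : ((2 : ℝ) • fun w => Real.log ‖a w‖) = fun w => Real.log (‖a w‖ ^ 2) := by
    ext w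
    simp [Real.log_pow]
  rw [h2] at h
  exact ⟨h.1, h.2.self_of_nhds⟩

/-- For `g(t) = log(eᵗ + ε)` one has `Δ(g ∘ u) = g'(u) Δu + g''(u) |∇u|²`. Here `g' = eᵗ / (eᵗ +
ε)`, and `g'' ≥ 0` lets the gradient term be dropped. -/
theorem le_laplacian_log_exp_add {u : ℂ → ℝ} {z : ℂ} (hu : ContDiffAt ℝ 2 u z) {ε : ℝ}
    (hε : 0 < ε) :
    Real.exp (u z) / (Real.exp (u z) + ε) * Laplacian.laplacian u z ≤
      Laplacian.laplacian (fun w => Real.log (Real.exp (u w) + ε)) z := by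
  have hpos : ∀ t : ℝ, 0 < Real.exp t + ε := fun t => by positivity
  have hd : ∀ᶠ w in 𝓝 z, DifferentiableAt ℝ u w := by
    filter_upwards [hu.eventually (by simp)] with w hw using hw.differentiableAt (by simp)
  have h1 : fderiv ℝ (fun w => Real.log (Real.exp (u w) + ε)) =ᶠ[𝓝 z] fun w =>
      (Real.exp (u w) / (Real.exp (u w) + ε)) • fderiv ℝ u w := by
    filter_upwards [hd] with w hw
    have := ((hw.hasFDerivAt.exp).add_const ε).log (hpos _).ne'
    rw [this.fderiv, smul_smul]
    congr 1
    field_simp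
  have h2 : HasFDerivAt (fderiv ℝ u) (fderiv ℝ (fderiv ℝ u) z) z := by
    have : ContDiffAt ℝ 1 (fderiv ℝ u) z := hu.fderiv_right (by norm_num)
    exact (this.differentiableAt (by simp)).hasFDerivAt
  have h3 : HasDerivAt (fun t : ℝ => Real.exp t / (Real.exp t + ε))
      (ε * Real.exp (u z) / (Real.exp (u z) + ε) ^ 2) (u z) := by
    have := (Real.hasDerivAt_exp (u z)).div ((Real.hasDerivAt_exp (u z)).add_const ε) (hpos _).ne'
    refine this.congr_deriv ?_
    congr 1
    ring
  have h4 := h3.comp_hasFDerivAt z hd.self_of_nhds.hasFDerivAt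
  have h5 := (h4.smul h2).fderiv
  have h6 : fderiv ℝ (fun w => (Real.exp (u w) / (Real.exp (u w) + ε)) • fderiv ℝ u w) z = _ := h5
  rw [laplacian_eq_fderiv_fderiv, laplacian_eq_fderiv_fderiv, h1.fderiv_eq, h6]
  have hnn : 0 ≤ ε * Real.exp (u z) / (Real.exp (u z) + ε) ^ 2 := by positivity
  simp only [add_apply, smul_apply,
    ContinuousLinearMap.smulRight_apply, smul_eq_mul, Function.comp_apply]
  nlinarith [mul_nonneg hnn (mul_self_nonneg (fderiv ℝ u z 1)),
    mul_nonneg hnn (mul_self_nonneg (fderiv ℝ u z Complex.I))]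

/-! ### Functions and densities on a Riemann surface -/

section Charts

variable {X : Type*} [TopologicalSpace X] [ChartedSpace ℂ X]

/-- The Laplacian of `f` at `x`, computed in the preferred chart at `c`. -/
def chartLaplacian (f : X → ℝ) (c x : X) : ℝ :=
  Laplacian.laplacian (fun w : ℂ => f ((chartAt ℂ c).symm w)) (chartAt ℂ c x)

/-- The squared modulus at `x` of the derivative of the coordinate change from the chart at `c` to
the chart at `c'`. -/
def transitionFactor (c c' x : X) : ℝ :=
  ‖deriv (fun w : ℂ => chartAt ℂ c' ((chartAt ℂ c).symm w)) (chartAt ℂ c x)‖ ^ 2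

theorem eventually_chart_symm {c x : X} (hx : x ∈ (chartAt ℂ c).source) {p : X → Prop}
    (h : ∀ᶠ y in 𝓝 x, p y) : ∀ᶠ w in 𝓝 (chartAt ℂ c x), p ((chartAt ℂ c).symm w) := by
  have h1 := (chartAt ℂ c).continuousAt_symm ((chartAt ℂ c).map_source hx)
  rw [ContinuousAt, (chartAt ℂ c).left_inv hx] at h1
  exact h1.eventually h

theorem chartLaplacian_congr {f g : X → ℝ} {c x : X} (hx : x ∈ (chartAt ℂ c).source)
    (h : f =ᶠ[𝓝 x] g) : chartLaplacian f c x = chartLaplacian g c x := by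
  have h1 : (fun w : ℂ => f ((chartAt ℂ c).symm w)) =ᶠ[𝓝 (chartAt ℂ c x)]
      fun w : ℂ => g ((chartAt ℂ c).symm w) := eventually_chart_symm hx h
  exact (InnerProductSpace.laplacian_congr_nhds h1).self_of_nhds

theorem isManifold_real [IsManifold 𝓘(ℂ) ω X] : IsManifold 𝓘(ℝ, ℂ) ∞ X := by
  apply isManifold_of_contDiffOn
  intro e e' he he'
  have h := contMDiffOn_of_mem_contDiffGroupoid ((contDiffGroupoid ω 𝓘(ℂ)).compatible he he')
  simpa using (contMDiffOn_iff_contDiffOn.1 h).restrict_scalars ℝ |>.of_le le_top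

theorem contMDiffAt_restrict_real {F : Type*} [NormedAddCommGroup F] [NormedSpace ℂ F]
    {f : X → F} {x : X} (h : ContMDiffAt 𝓘(ℂ) 𝓘(ℂ, F) ω f x) :
    ContMDiffAt 𝓘(ℝ, ℂ) 𝓘(ℝ, F) ∞ f x := by
  rw [← contMDiffWithinAt_univ, contMDiffWithinAt_iff] at h ⊢
  exact ⟨h.1, (h.2.restrict_scalars ℝ).of_le le_top⟩

theorem contDiffAt_omega_iff_analyticAt {F : Type*} [NormedAddCommGroup F] [NormedSpace ℂ F]
    [CompleteSpace F] {f : ℂ → F} {z : ℂ} : ContDiffAt ℂ ω f z ↔ AnalyticAt ℂ f z := by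
  rw [← contDiffWithinAt_univ, contDiffWithinAt_omega_iff_analyticWithinAt, analyticWithinAt_univ]

variable [IsManifold 𝓘(ℂ) ω X]

theorem contDiffAt_comp_chart_symm {F : Type*} [NormedAddCommGroup F] [NormedSpace ℝ F]
    {f : X → F} {c x : X} {n : ℕ∞} (hf : ContMDiffAt 𝓘(ℝ, ℂ) 𝓘(ℝ, F) n f x)
    (hx : x ∈ (chartAt ℂ c).source) :
    ContDiffAt ℝ n (fun w : ℂ => f ((chartAt ℂ c).symm w)) (chartAt ℂ c x) := by
  have : IsManifold 𝓘(ℝ, ℂ) ∞ X := isManifold_real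
  have : IsManifold 𝓘(ℝ, ℂ) n X := IsManifold.of_le (n := ∞) (by exact_mod_cast le_top)
  have h1 : ContMDiffAt 𝓘(ℝ, ℂ) 𝓘(ℝ, ℂ) n (chartAt ℂ c).symm (chartAt ℂ c x) :=
    (contMDiffOn_chart_symm _ ((chartAt ℂ c).map_source hx)).contMDiffAt
      ((chartAt ℂ c).open_target.mem_nhds ((chartAt ℂ c).map_source hx))
  rw [← contMDiffAt_iff_contDiffAt]
  exact ContMDiffAt.comp_of_eq (I' := 𝓘(ℝ, ℂ)) hf h1 ((chartAt ℂ c).left_inv hx)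

theorem analyticAt_comp_chart_symm {F : Type*} [NormedAddCommGroup F] [NormedSpace ℂ F]
    [CompleteSpace F] {f : X → F} {c x : X} (hf : ContMDiffAt 𝓘(ℂ) 𝓘(ℂ, F) ω f x)
    (hx : x ∈ (chartAt ℂ c).source) :
    AnalyticAt ℂ (fun w : ℂ => f ((chartAt ℂ c).symm w)) (chartAt ℂ c x) := by
  have h1 : ContMDiffAt 𝓘(ℂ) 𝓘(ℂ) ω (chartAt ℂ c).symm (chartAt ℂ c x) :=
    (contMDiffOn_chart_symm _ ((chartAt ℂ c).map_source hx)).contMDiffAt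
      ((chartAt ℂ c).open_target.mem_nhds ((chartAt ℂ c).map_source hx))
  have h2 : ContMDiffAt 𝓘(ℂ) 𝓘(ℂ, F) ω (fun w : ℂ => f ((chartAt ℂ c).symm w))
      (chartAt ℂ c x) :=
    ContMDiffAt.comp_of_eq (I' := 𝓘(ℂ)) hf h1 ((chartAt ℂ c).left_inv hx)
  exact contDiffAt_omega_iff_analyticAt.1 (contMDiffAt_iff_contDiffAt.1 h2)

theorem contMDiffAt_comp_chart {F : Type*} [NormedAddCommGroup F] [NormedSpace ℂ F]
    [CompleteSpace F] {f : ℂ → F} {c x : X} (hf : AnalyticAt ℂ f (chartAt ℂ c x))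
    (hx : x ∈ (chartAt ℂ c).source) :
    ContMDiffAt 𝓘(ℂ) 𝓘(ℂ, F) ω (fun y => f (chartAt ℂ c y)) x := by
  have h1 : ContMDiffAt 𝓘(ℂ) 𝓘(ℂ) ω (chartAt ℂ c) x :=
    (contMDiffOn_chart _ hx).contMDiffAt ((chartAt ℂ c).open_source.mem_nhds hx)
  have h2 : ContMDiffAt 𝓘(ℂ) 𝓘(ℂ, F) ω f (chartAt ℂ c x) :=
    contMDiffAt_iff_contDiffAt.2 (contDiffAt_omega_iff_analyticAt.2 hf)
  exact ContMDiffAt.comp x h2 h1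

theorem analyticAt_transition {c c' x : X} (hx : x ∈ (chartAt ℂ c).source)
    (hx' : x ∈ (chartAt ℂ c').source) :
    AnalyticAt ℂ (fun w : ℂ => chartAt ℂ c' ((chartAt ℂ c).symm w)) (chartAt ℂ c x) :=
  analyticAt_comp_chart_symm
    ((contMDiffOn_chart _ hx').contMDiffAt ((chartAt ℂ c').open_source.mem_nhds hx')) hx

/-- Coordinate changes are holomorphic, hence conformal. The factor `|τ'|²` is also their Jacobian
determinant, so the Laplacian of a function transforms as a density. -/
theorem chartLaplacian_transition {f : X → ℝ} {c c' x : X}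
    (hf : ContMDiffAt 𝓘(ℝ, ℂ) 𝓘(ℝ, ℝ) 2 f x) (hx : x ∈ (chartAt ℂ c).source)
    (hx' : x ∈ (chartAt ℂ c').source) :
    chartLaplacian f c x = transitionFactor c c' x * chartLaplacian f c' x := by
  have h1 := analyticAt_transition hx hx'
  have h2 : ContDiffAt ℝ 2 (fun w : ℂ => f ((chartAt ℂ c').symm w)) (chartAt ℂ c' x) :=
    contDiffAt_comp_chart_symm (n := 2) hf hx'
  have h3 : chartAt ℂ c' ((chartAt ℂ c).symm (chartAt ℂ c x)) = chartAt ℂ c' x := by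
    rw [(chartAt ℂ c).left_inv hx]
  rw [← h3] at h2
  have h4 := laplacian_comp_analytic h1 h2
  rw [h3] at h4
  rw [chartLaplacian, chartLaplacian, transitionFactor, ← h4]
  refine (InnerProductSpace.laplacian_congr_nhds ?_).self_of_nhds
  filter_upwards [eventually_chart_symm hx ((chartAt ℂ c').open_source.mem_nhds hx')] with w hw
  simp [(chartAt ℂ c').left_inv hw]

theorem continuousAt_laplacian {f : ℂ → ℝ} {z : ℂ} (hf : ContDiffAt ℝ 2 f z) :
    ContinuousAt (Laplacian.laplacian f) z := by
  have h1 : ContDiffAt ℝ 1 (fderiv ℝ f) z := hf.fderiv_right (by norm_num)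
  have h2 : ContDiffAt ℝ 0 (fderiv ℝ (fderiv ℝ f)) z := h1.fderiv_right (by norm_num)
  have h3 := h2.continuousAt
  have h4 : Laplacian.laplacian f = fun z => fderiv ℝ (fderiv ℝ f) z 1 1
      + fderiv ℝ (fderiv ℝ f) z Complex.I Complex.I := funext (laplacian_eq_fderiv_fderiv f)
  rw [h4]
  fun_prop

theorem continuousAt_chartLaplacian {f : X → ℝ} {c x : X}
    (hf : ContMDiffAt 𝓘(ℝ, ℂ) 𝓘(ℝ, ℝ) 2 f x) (hx : x ∈ (chartAt ℂ c).source) :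
    ContinuousAt (chartLaplacian f c) x :=
  ContinuousAt.comp (f := chartAt ℂ c)
    (continuousAt_laplacian (contDiffAt_comp_chart_symm (n := 2) hf hx))
    ((chartAt ℂ c).continuousAt hx)

theorem chartLaplacian_add {f g : X → ℝ} {c x : X}
    (hf : ContMDiffAt 𝓘(ℝ, ℂ) 𝓘(ℝ, ℝ) 2 f x) (hg : ContMDiffAt 𝓘(ℝ, ℂ) 𝓘(ℝ, ℝ) 2 g x)
    (hx : x ∈ (chartAt ℂ c).source) :
    chartLaplacian (fun y => f y + g y) c x = chartLaplacian f c x + chartLaplacian g c x :=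
  (contDiffAt_comp_chart_symm (n := 2) hf hx).laplacian_add
    (contDiffAt_comp_chart_symm (n := 2) hg hx)

theorem chartLaplacian_const_mul {f : X → ℝ} {c x : X} (r : ℝ)
    (hf : ContMDiffAt 𝓘(ℝ, ℂ) 𝓘(ℝ, ℝ) 2 f x)
    (hx : x ∈ (chartAt ℂ c).source) :
    chartLaplacian (fun y => r * f y) c x = r * chartLaplacian f c x :=
  InnerProductSpace.laplacian_smul r (contDiffAt_comp_chart_symm (n := 2) hf hx)

theorem chartLaplacian_sum {ι : Type*} (s : Finset ι) {f : ι → X → ℝ} {c x : X}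
    (hf : ∀ i, ContMDiffAt 𝓘(ℝ, ℂ) 𝓘(ℝ, ℝ) 2 (f i) x) (hx : x ∈ (chartAt ℂ c).source) :
    chartLaplacian (fun y => ∑ i ∈ s, f i y) c x = ∑ i ∈ s, chartLaplacian (f i) c x := by
  classical
  induction s using Finset.induction_on with
  | empty => simp [chartLaplacian]
  | insert i s hi ih =>
    simp only [Finset.sum_insert hi]
    rw [chartLaplacian_add (hf i) (contMDiffAt_finsetSum fun j _ => hf j) hx, ih]

theorem contMDiffAt_log_normSq {a : X → ℂ} {x : X} (ha : ContMDiffAt 𝓘(ℂ) 𝓘(ℂ) ω a x)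
    (h0 : a x ≠ 0) :
    ContMDiffAt 𝓘(ℝ, ℂ) 𝓘(ℝ, ℝ) 2 (fun y => Real.log (‖a y‖ ^ 2)) x := by
  have h1 : ContMDiffAt 𝓘(ℝ, ℂ) 𝓘(ℝ, ℂ) 2 a x :=
    (contMDiffAt_restrict_real ha).of_le ENat.LEInfty.out
  have h2 : ContDiffAt ℝ 2 (fun w : ℂ => Real.log (‖w‖ ^ 2)) (a x) :=
    (contDiffAt_log_normSq (a := id) analyticAt_id h0).1
  exact ContMDiffAt.comp x h2.contMDiffAt h1

theorem chartLaplacian_log_normSq {a : X → ℂ} {c x : X} (ha : ContMDiffAt 𝓘(ℂ) 𝓘(ℂ) ω a x)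
    (h0 : a x ≠ 0) (hx : x ∈ (chartAt ℂ c).source) :
    chartLaplacian (fun y => Real.log (‖a y‖ ^ 2)) c x = 0 := by
  refine (contDiffAt_log_normSq (analyticAt_comp_chart_symm ha hx) ?_).2
  rwa [(chartAt ℂ c).left_inv hx]

end Charts

/-! ### Integration of densities with a partition of unity -/

section Integration

variable {X : Type*} [TopologicalSpace X] [ChartedSpace ℂ X]

/-- A finite smooth partition of unity on `X`, each member of which is supported in the domain of a
preferred chart. -/
structure ChartPartition (X : Type*) [TopologicalSpace X] [ChartedSpace ℂ X] where
  N : ℕ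
  ρ : SmoothPartitionOfUnity (Fin N) 𝓘(ℝ, ℂ) X
  c : Fin N → X
  tsupport_subset : ∀ a, tsupport (ρ a) ⊆ (chartAt ℂ (c a)).source

/-- The integral of a family of local densities, one for each preferred chart. -/
def ChartPartition.integral (P : ChartPartition X) (κ : X → X → ℝ) : ℝ :=
  ∑ a, ∫ z in (chartAt ℂ (P.c a)).target,
    P.ρ a ((chartAt ℂ (P.c a)).symm z) * κ (P.c a) ((chartAt ℂ (P.c a)).symm z)

theorem ChartPartition.sum_eq_one (P : ChartPartition X) (x : X) : ∑ a, P.ρ a x = 1 := by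
  rw [← finsum_eq_sum_of_fintype]
  exact P.ρ.sum_eq_one (mem_univ x)

theorem ChartPartition.eq_zero_of_notMem (P : ChartPartition X) {a : Fin P.N} {x : X}
    (h : x ∉ tsupport (P.ρ a)) : P.ρ a x = 0 :=
  image_eq_zero_of_notMem_tsupport h

/-- A family of local functions, one for each preferred chart, which transforms like a density
with continuous coefficients. -/
structure IsDensity (κ : X → X → ℝ) : Prop where
  continuousOn : ∀ c, ContinuousOn (κ c) (chartAt ℂ c).source
  transition : ∀ c c' x, x ∈ (chartAt ℂ c).source → x ∈ (chartAt ℂ c').source →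
    κ c x = transitionFactor c c' x * κ c' x

variable [T2Space X] [CompactSpace X]

/-- The expression of `F` in the chart at `c`, extended by zero. -/
def pushChart (c : X) (F : X → ℝ) : ℂ → ℝ :=
  (chartAt ℂ c).target.indicator fun z => F ((chartAt ℂ c).symm z)

/-- The chart image of `K` is compact, hence closed in all of `ℂ`; this controls the extension by
zero at boundary points of the chart's target. -/
theorem pushChart_eventuallyEq_zero {c : X} {F : X → ℝ} {K : Set X} (hK : IsClosed K)
    (hKc : K ⊆ (chartAt ℂ c).source) (hF : ∀ x ∈ (chartAt ℂ c).source, x ∉ K → F x = 0)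
    {z : ℂ} (hz : z ∉ chartAt ℂ c '' K) : pushChart c F =ᶠ[𝓝 z] 0 := by
  have h1 : IsClosed (chartAt ℂ c '' K) :=
    (hK.isCompact.image_of_continuousOn ((chartAt ℂ c).continuousOn.mono hKc)).isClosed
  filter_upwards [h1.isOpen_compl.mem_nhds hz] with w hw
  rw [pushChart]
  by_cases hwt : w ∈ (chartAt ℂ c).target
  · rw [indicator_of_mem hwt]
    refine hF _ ((chartAt ℂ c).map_target hwt) fun h => hw ⟨_, h, ?_⟩
    exact (chartAt ℂ c).right_inv hwt
  · rw [indicator_of_notMem hwt]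
    rfl

theorem hasCompactSupport_pushChart {c : X} {F : X → ℝ} {K : Set X} (hK : IsClosed K)
    (hKc : K ⊆ (chartAt ℂ c).source) (hF : ∀ x ∈ (chartAt ℂ c).source, x ∉ K → F x = 0) :
    HasCompactSupport (pushChart c F) := by
  refine HasCompactSupport.intro
    (hK.isCompact.image_of_continuousOn ((chartAt ℂ c).continuousOn.mono hKc)) fun z hz => ?_
  exact (pushChart_eventuallyEq_zero hK hKc hF hz).self_of_nhds

theorem pushChart_eventuallyEq {c : X} {F : X → ℝ} {z : ℂ} (hz : z ∈ (chartAt ℂ c).target) :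
    pushChart c F =ᶠ[𝓝 z] fun w => F ((chartAt ℂ c).symm w) := by
  filter_upwards [(chartAt ℂ c).open_target.mem_nhds hz] with w hw
  rw [pushChart, indicator_of_mem hw]

theorem continuous_pushChart {c : X} {F : X → ℝ} {K : Set X} (hK : IsClosed K)
    (hKc : K ⊆ (chartAt ℂ c).source) (hF : ∀ x ∈ (chartAt ℂ c).source, x ∉ K → F x = 0)
    (hFc : ContinuousOn F (chartAt ℂ c).source) : Continuous (pushChart c F) := by
  rw [continuous_iff_continuousAt]
  intro z
  by_cases hz : z ∈ chartAt ℂ c '' K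
  · obtain ⟨x, hx, rfl⟩ := hz
    have hzt := (chartAt ℂ c).map_source (hKc hx)
    refine ContinuousAt.congr ?_ (pushChart_eventuallyEq hzt).symm
    refine ContinuousAt.comp (g := F) ?_ ((chartAt ℂ c).continuousAt_symm hzt)
    rw [(chartAt ℂ c).left_inv (hKc hx)]
    exact hFc.continuousAt ((chartAt ℂ c).open_source.mem_nhds (hKc hx))
  · exact continuousAt_const.congr (pushChart_eventuallyEq_zero hK hKc hF hz).symm

theorem contDiff_pushChart [IsManifold 𝓘(ℂ) ω X] {c : X} {F : X → ℝ} {K : Set X}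
    (hK : IsClosed K) (hKc : K ⊆ (chartAt ℂ c).source)
    (hF : ∀ x ∈ (chartAt ℂ c).source, x ∉ K → F x = 0)
    (hFc : ∀ x, ContMDiffAt 𝓘(ℝ, ℂ) 𝓘(ℝ, ℝ) 2 F x) : ContDiff ℝ 2 (pushChart c F) := by
  rw [contDiff_iff_contDiffAt]
  intro z
  by_cases hz : z ∈ chartAt ℂ c '' K
  · obtain ⟨x, hx, rfl⟩ := hz
    have hzt := (chartAt ℂ c).map_source (hKc hx)
    refine ContDiffAt.congr_of_eventuallyEq ?_ (pushChart_eventuallyEq hzt)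
    exact contDiffAt_comp_chart_symm (n := 2) (hFc x) (hKc hx)
  · exact contDiffAt_const.congr_of_eventuallyEq (pushChart_eventuallyEq_zero hK hKc hF hz)

theorem integrableOn_chart {c : X} {F : X → ℝ} {K : Set X} (hK : IsClosed K)
    (hKc : K ⊆ (chartAt ℂ c).source) (hF : ∀ x ∈ (chartAt ℂ c).source, x ∉ K → F x = 0)
    (hFc : ContinuousOn F (chartAt ℂ c).source) :
    IntegrableOn (fun z => F ((chartAt ℂ c).symm z)) (chartAt ℂ c).target := by
  rw [← integrable_indicator_iff (chartAt ℂ c).open_target.measurableSet]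
  exact (continuous_pushChart hK hKc hF hFc).integrable_of_hasCompactSupport
    (hasCompactSupport_pushChart hK hKc hF)

theorem ChartPartition.integrableOn (P : ChartPartition X) (a : Fin P.N) {F : X → ℝ}
    (hF : ContinuousOn F (chartAt ℂ (P.c a)).source) :
    IntegrableOn (fun z => P.ρ a ((chartAt ℂ (P.c a)).symm z) * F ((chartAt ℂ (P.c a)).symm z))
      (chartAt ℂ (P.c a)).target := by
  refine integrableOn_chart (F := fun x => P.ρ a x * F x) (isClosed_tsupport (P.ρ a))
    (P.tsupport_subset a) (fun x _ hx => ?_) ?_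
  · simp [P.eq_zero_of_notMem hx]
  · exact (P.ρ a).contMDiff.continuous.continuousOn.mul hF

theorem ChartPartition.integral_add (P : ChartPartition X) {κ κ' : X → X → ℝ}
    (h : ∀ c, ContinuousOn (κ c) (chartAt ℂ c).source)
    (h' : ∀ c, ContinuousOn (κ' c) (chartAt ℂ c).source) :
    P.integral (fun c x => κ c x + κ' c x) = P.integral κ + P.integral κ' := by
  simp only [ChartPartition.integral, mul_add, ← Finset.sum_add_distrib]
  exact Finset.sum_congr rfl fun a _ =>
    MeasureTheory.integral_add (P.integrableOn a (h _)) (P.integrableOn a (h' _))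

theorem ChartPartition.integral_const_mul (P : ChartPartition X) (r : ℝ) (κ : X → X → ℝ) :
    P.integral (fun c x => r * κ c x) = r * P.integral κ := by
  simp only [ChartPartition.integral, Finset.mul_sum, ← MeasureTheory.integral_const_mul]
  refine Finset.sum_congr rfl fun a _ => ?_
  congr 1
  ext z
  ring

theorem ChartPartition.integral_congr (P : ChartPartition X) {κ κ' : X → X → ℝ}
    (h : ∀ c, ∀ x ∈ (chartAt ℂ c).source, κ c x = κ' c x) :
    P.integral κ = P.integral κ' := by
  refine Finset.sum_congr rfl fun a _ => ?_
  refine setIntegral_congr_fun (chartAt ℂ _).open_target.measurableSet fun z hz => ?_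
  rw [h _ _ ((chartAt ℂ _).map_target hz)]

theorem abs_det_mul (t : ℂ) : |((ContinuousLinearMap.mul ℝ ℂ) t).det| = ‖t‖ ^ 2 := by
  have h : ((ContinuousLinearMap.mul ℝ ℂ) t).det = Algebra.norm ℝ t := rfl
  rw [h, Algebra.norm_complex_apply, Complex.sq_norm, abs_of_nonneg (Complex.normSq_nonneg _)]

variable [IsManifold 𝓘(ℂ) ω X]

/-- The first two vanishing conditions reduce both integrals to the overlap of the charts. There the
change of variables formula applies, with Jacobian `transitionFactor c c'`. -/
theorem setIntegral_chart_eq {F : X → X → ℝ} {c c' : X}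
    (hF : ∀ x ∈ (chartAt ℂ c).source, x ∉ (chartAt ℂ c').source → F c x = 0)
    (hF' : ∀ x ∈ (chartAt ℂ c').source, x ∉ (chartAt ℂ c).source → F c' x = 0)
    (htr : ∀ x ∈ (chartAt ℂ c).source, x ∈ (chartAt ℂ c').source →
      F c x = transitionFactor c c' x * F c' x) :
    ∫ z in (chartAt ℂ c).target, F c ((chartAt ℂ c).symm z) =
      ∫ z in (chartAt ℂ c').target, F c' ((chartAt ℂ c').symm z) := by
  set τ : ℂ → ℂ := fun w => chartAt ℂ c' ((chartAt ℂ c).symm w) with hτ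
  set S : Set ℂ := (chartAt ℂ c).target ∩ (chartAt ℂ c).symm ⁻¹' (chartAt ℂ c').source with hS
  set S' : Set ℂ := (chartAt ℂ c').target ∩ (chartAt ℂ c').symm ⁻¹' (chartAt ℂ c).source with hS'
  have hSo : IsOpen S :=
    (chartAt ℂ c).isOpen_inter_preimage_symm (chartAt ℂ c').open_source
  have hSo' : IsOpen S' :=
    (chartAt ℂ c').isOpen_inter_preimage_symm (chartAt ℂ c).open_source
  have himg : τ '' S = S' := by
    ext w
    constructor
    · rintro ⟨z, ⟨hz1, hz2⟩, rfl⟩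
      refine ⟨(chartAt ℂ c').map_source hz2, ?_⟩
      simp only [τ, mem_preimage]
      rw [(chartAt ℂ c').left_inv hz2]
      exact (chartAt ℂ c).map_target hz1
    · rintro ⟨hw1, hw2⟩
      refine ⟨chartAt ℂ c ((chartAt ℂ c').symm w), ⟨(chartAt ℂ c).map_source hw2, ?_⟩, ?_⟩
      · simp only [mem_preimage]
        rw [(chartAt ℂ c).left_inv hw2]
        exact (chartAt ℂ c').map_target hw1
      · simp only [τ]
        rw [(chartAt ℂ c).left_inv hw2, (chartAt ℂ c').right_inv hw1]
  have hinj : InjOn τ S := by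
    intro z hz w hw h
    have h1 := (chartAt ℂ c').injOn hz.2 hw.2 h
    exact (chartAt ℂ c).symm.injOn hz.1 hw.1 h1
  have hder : ∀ z ∈ S, HasFDerivWithinAt τ ((ContinuousLinearMap.mul ℝ ℂ) (deriv τ z)) S z := by
    intro z hz
    have h1 := analyticAt_transition ((chartAt ℂ c).map_target hz.1) hz.2
    rw [(chartAt ℂ c).right_inv hz.1] at h1
    exact (hasFDerivAt_real_mul h1.differentiableAt.hasDerivAt).hasFDerivWithinAt
  have e1 : ∫ z in (chartAt ℂ c).target, F c ((chartAt ℂ c).symm z)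
      = ∫ z in S, F c ((chartAt ℂ c).symm z) := by
    refine (setIntegral_eq_of_subset_of_forall_sdiff_eq_zero
      (chartAt ℂ c).open_target.measurableSet inter_subset_left fun z hz => ?_)
    exact hF _ ((chartAt ℂ c).map_target hz.1) fun h => hz.2 ⟨hz.1, h⟩
  have e2 : ∫ z in (chartAt ℂ c').target, F c' ((chartAt ℂ c').symm z)
      = ∫ z in S', F c' ((chartAt ℂ c').symm z) := by
    refine (setIntegral_eq_of_subset_of_forall_sdiff_eq_zero
      (chartAt ℂ c').open_target.measurableSet inter_subset_left fun z hz => ?_)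
    exact hF' _ ((chartAt ℂ c').map_target hz.1) fun h => hz.2 ⟨hz.1, h⟩
  rw [e1, e2, ← himg, integral_image_eq_integral_abs_det_fderiv_smul volume hSo.measurableSet
    hder hinj]
  refine setIntegral_congr_fun hSo.measurableSet fun z hz => ?_
  simp only [abs_det_mul, smul_eq_mul, τ]
  rw [(chartAt ℂ c').left_inv hz.2, htr _ ((chartAt ℂ c).map_target hz.1) hz.2, transitionFactor,
    (chartAt ℂ c).right_inv hz.1]

/-- Inserting the other partition of unity turns both sides into double sums. The terms correspond
by a change of chart, as a product of two members is supported in both chart domains. -/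
theorem ChartPartition.integral_eq (P Q : ChartPartition X) {κ : X → X → ℝ} (hκ : IsDensity κ) :
    P.integral κ = Q.integral κ := by
  have e1 : P.integral κ = ∑ a, ∑ b, ∫ z in (chartAt ℂ (P.c a)).target,
      P.ρ a ((chartAt ℂ (P.c a)).symm z) * (Q.ρ b ((chartAt ℂ (P.c a)).symm z) *
        κ (P.c a) ((chartAt ℂ (P.c a)).symm z)) := by
    refine Finset.sum_congr rfl fun a _ => ?_
    rw [← MeasureTheory.integral_finsetSum _ fun b _ => P.integrableOn a
      (F := fun x => Q.ρ b x * κ (P.c a) x)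
      ((Q.ρ b).contMDiff.continuous.continuousOn.mul (hκ.continuousOn _))]
    simp only [← Finset.mul_sum, ← Finset.sum_mul, Q.sum_eq_one, one_mul]
  have e2 : Q.integral κ = ∑ b, ∑ a, ∫ z in (chartAt ℂ (Q.c b)).target,
      Q.ρ b ((chartAt ℂ (Q.c b)).symm z) * (P.ρ a ((chartAt ℂ (Q.c b)).symm z) *
        κ (Q.c b) ((chartAt ℂ (Q.c b)).symm z)) := by
    refine Finset.sum_congr rfl fun b _ => ?_
    rw [← MeasureTheory.integral_finsetSum _ fun a _ => Q.integrableOn b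
      (F := fun x => P.ρ a x * κ (Q.c b) x)
      ((P.ρ a).contMDiff.continuous.continuousOn.mul (hκ.continuousOn _))]
    simp only [← Finset.mul_sum, ← Finset.sum_mul, P.sum_eq_one, one_mul]
  rw [e1, e2, Finset.sum_comm]
  refine Finset.sum_congr rfl fun b _ => Finset.sum_congr rfl fun a _ => ?_
  have := setIntegral_chart_eq (c := P.c a) (c' := Q.c b)
    (F := fun c x => P.ρ a x * (Q.ρ b x * κ c x)) ?_ ?_ ?_
  · rw [this]
    refine integral_congr_ae (Filter.Eventually.of_forall fun z => ?_)
    simp only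
    ring
  · intro x _ hx
    simp [Q.eq_zero_of_notMem fun h => hx (Q.tsupport_subset b h)]
  · intro x _ hx
    simp [P.eq_zero_of_notMem fun h => hx (P.tsupport_subset a h)]
  · intro x hx hx'
    rw [hκ.transition _ _ x hx hx']
    ring

theorem setIntegral_chartLaplacian_eq_zero {c : X} {g : X → ℝ} {K : Set X} (hK : IsClosed K)
    (hKc : K ⊆ (chartAt ℂ c).source) (hg0 : ∀ x ∈ (chartAt ℂ c).source, x ∉ K → g x = 0)
    (hg : ∀ x, ContMDiffAt 𝓘(ℝ, ℂ) 𝓘(ℝ, ℝ) 2 g x) :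
    ∫ z in (chartAt ℂ c).target, chartLaplacian g c ((chartAt ℂ c).symm z) = 0 := by
  have e3 : ∀ z ∈ (chartAt ℂ c).target, chartLaplacian g c ((chartAt ℂ c).symm z) =
      Laplacian.laplacian (pushChart c g) z := by
    intro z hz
    rw [chartLaplacian, (chartAt ℂ c).right_inv hz]
    exact (InnerProductSpace.laplacian_congr_nhds (pushChart_eventuallyEq hz)).self_of_nhds.symm
  rw [setIntegral_congr_fun (chartAt ℂ c).open_target.measurableSet e3,
    setIntegral_eq_integral_of_forall_compl_eq_zero]
  · exact integral_laplacian_eq_zero (contDiff_pushChart hK hKc hg0 hg)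
      (hasCompactSupport_pushChart hK hKc hg0)
  · intro z hz
    have h1 : z ∉ chartAt ℂ c '' K := by
      rintro ⟨x, hx, rfl⟩
      exact hz ((chartAt ℂ c).map_source (hKc hx))
    rw [(InnerProductSpace.laplacian_congr_nhds
      (pushChart_eventuallyEq_zero hK hKc hg0 h1)).self_of_nhds]
    exact congrFun (InnerProductSpace.laplacian_const (E := ℂ) (c := (0 : ℝ))) z

/-- Stokes' theorem: `f` is split into pieces `P.ρ b * f`, each supported in one chart. All
integrals for the piece `b` are moved to its chart, where the functions `P.ρ a` add up to `1`, and
the Laplacian of a compactly supported function on `ℂ` integrates to zero. -/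
theorem ChartPartition.integral_chartLaplacian (P : ChartPartition X) {f : X → ℝ}
    (hf : ∀ x, ContMDiffAt 𝓘(ℝ, ℂ) 𝓘(ℝ, ℝ) 2 f x) : P.integral (chartLaplacian f) = 0 := by
  have hρf : ∀ b x, ContMDiffAt 𝓘(ℝ, ℂ) 𝓘(ℝ, ℝ) 2 (fun y => P.ρ b y * f y) x := fun b x =>
    ((P.ρ b).contMDiff.contMDiffAt.of_le ENat.LEInfty.out).mul (hf x)
  have hsum : ∀ c, ∀ x ∈ (chartAt ℂ c).source,
      chartLaplacian f c x = ∑ b, chartLaplacian (fun y => P.ρ b y * f y) c x := by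
    intro c x hx
    rw [← chartLaplacian_sum _ (fun b => hρf b x) hx]
    simp only [← Finset.sum_mul, P.sum_eq_one, one_mul]
  have hcont : ∀ b c, ContinuousOn (chartLaplacian (fun y => P.ρ b y * f y) c)
      (chartAt ℂ c).source := fun b c x hx =>
    (continuousAt_chartLaplacian (hρf b x) hx).continuousWithinAt
  have hzero : ∀ b c x, x ∈ (chartAt ℂ c).source → x ∉ tsupport (P.ρ b) →
      chartLaplacian (fun y => P.ρ b y * f y) c x = 0 := by
    intro b c x hx hxb
    have h1 : (fun y => P.ρ b y * f y) =ᶠ[𝓝 x] fun _ => 0 := by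
      filter_upwards [(isClosed_tsupport (P.ρ b)).isOpen_compl.mem_nhds hxb] with y hy
      simp [P.eq_zero_of_notMem hy]
    rw [chartLaplacian_congr hx h1]
    simp [chartLaplacian]
  rw [P.integral_congr hsum]
  have e1 : P.integral (fun c x => ∑ b, chartLaplacian (fun y => P.ρ b y * f y) c x) =
      ∑ a, ∑ b, ∫ z in (chartAt ℂ (P.c a)).target, P.ρ a ((chartAt ℂ (P.c a)).symm z) *
        chartLaplacian (fun y => P.ρ b y * f y) (P.c a) ((chartAt ℂ (P.c a)).symm z) := by
    refine Finset.sum_congr rfl fun a _ => ?_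
    rw [← MeasureTheory.integral_finsetSum _ fun b _ => P.integrableOn a (hcont b _)]
    simp only [Finset.mul_sum]
  rw [e1, Finset.sum_comm]
  refine Finset.sum_eq_zero fun b _ => ?_
  have e2 : ∀ a, ∫ z in (chartAt ℂ (P.c a)).target, P.ρ a ((chartAt ℂ (P.c a)).symm z) *
        chartLaplacian (fun y => P.ρ b y * f y) (P.c a) ((chartAt ℂ (P.c a)).symm z) =
      ∫ z in (chartAt ℂ (P.c b)).target, P.ρ a ((chartAt ℂ (P.c b)).symm z) *
        chartLaplacian (fun y => P.ρ b y * f y) (P.c b) ((chartAt ℂ (P.c b)).symm z) := by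
    intro a
    refine setIntegral_chart_eq
      (F := fun c x => P.ρ a x * chartLaplacian (fun y => P.ρ b y * f y) c x) ?_ ?_ ?_
    · intro x hx hx'
      rw [hzero b _ x hx fun h => hx' (P.tsupport_subset b h), mul_zero]
    · intro x _ hx
      rw [P.eq_zero_of_notMem fun h => hx (P.tsupport_subset a h), zero_mul]
    · intro x hx hx'
      rw [chartLaplacian_transition (hρf b x) hx hx']
      ring
  have hint : ∀ a, IntegrableOn (fun z => P.ρ a ((chartAt ℂ (P.c b)).symm z) *
        chartLaplacian (fun y => P.ρ b y * f y) (P.c b) ((chartAt ℂ (P.c b)).symm z))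
        (chartAt ℂ (P.c b)).target := fun a =>
    integrableOn_chart
      (F := fun x => P.ρ a x * chartLaplacian (fun y => P.ρ b y * f y) (P.c b) x)
      (isClosed_tsupport (P.ρ b)) (P.tsupport_subset b)
      (fun x hx hxb => by rw [hzero b _ x hx hxb, mul_zero])
      ((P.ρ a).contMDiff.continuous.continuousOn.mul (hcont b _))
  rw [Finset.sum_congr rfl fun a _ => e2 a, ← MeasureTheory.integral_finsetSum _ fun a _ => hint a]
  simp only [← Finset.sum_mul, P.sum_eq_one, one_mul]
  exact setIntegral_chartLaplacian_eq_zero (isClosed_tsupport (P.ρ b)) (P.tsupport_subset b)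
    (fun x _ hx => by rw [P.eq_zero_of_notMem hx, zero_mul]) (hρf b)

end Integration

/-! ### Densities of nonnegative functions with isolated holomorphic zeros -/

section Potentials

variable {X : Type*} [TopologicalSpace X] [ChartedSpace ℂ X]

/-- Near `x`, the density `κ` is the Laplacian of `ψ`. -/
structure IsPotentialAt (κ : X → X → ℝ) (ψ : X → ℝ) (x : X) : Prop where
  smooth : ContMDiffAt 𝓘(ℝ, ℂ) 𝓘(ℝ, ℝ) 2 ψ x
  eventually_eq : ∀ᶠ y in 𝓝 x, ∀ c, y ∈ (chartAt ℂ c).source → κ c y = chartLaplacian ψ c y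

variable [IsManifold 𝓘(ℂ) ω X]

theorem eventually_contMDiffAt_two {f : X → ℝ} {x : X}
    (hf : ContMDiffAt 𝓘(ℝ, ℂ) 𝓘(ℝ, ℝ) 2 f x) :
    ∀ᶠ y in 𝓝 x, ContMDiffAt 𝓘(ℝ, ℂ) 𝓘(ℝ, ℝ) 2 f y := by
  have : IsManifold 𝓘(ℝ, ℂ) ∞ X := isManifold_real
  have : IsManifold 𝓘(ℝ, ℂ) 2 X := IsManifold.of_le (n := ∞) ENat.LEInfty.out
  exact (contMDiffAt_iff_contMDiffAt_nhds (by simp)).1 hf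

theorem eventually_contMDiffAt_omega {F : Type*} [NormedAddCommGroup F] [NormedSpace ℂ F]
    {f : X → F} {x : X} (hf : ContMDiffAt 𝓘(ℂ) 𝓘(ℂ, F) ω f x) :
    ∀ᶠ y in 𝓝 x, ContMDiffAt 𝓘(ℂ) 𝓘(ℂ, F) ω f y :=
  (contMDiffAt_iff_contMDiffAt_nhds (by simp)).1 hf

theorem IsPotentialAt.eventually {κ : X → X → ℝ} {ψ : X → ℝ} {x : X} (h : IsPotentialAt κ ψ x) :
    ∀ᶠ y in 𝓝 x, IsPotentialAt κ ψ y := by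
  filter_upwards [eventually_contMDiffAt_two h.smooth, h.eventually_eq.eventually_nhds]
    with y h1 h2 using ⟨h1, h2⟩

theorem IsPotentialAt.add {κ κ' : X → X → ℝ} {ψ ψ' : X → ℝ} {x : X} (h : IsPotentialAt κ ψ x)
    (h' : IsPotentialAt κ' ψ' x) :
    IsPotentialAt (fun c y => κ c y + κ' c y) (fun y => ψ y + ψ' y) x := by
  refine ⟨h.smooth.add h'.smooth, ?_⟩
  filter_upwards [h.eventually, h'.eventually] with y h1 h2 c hc
  rw [chartLaplacian_add h1.smooth h2.smooth hc, h1.eventually_eq.self_of_nhds c hc,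
    h2.eventually_eq.self_of_nhds c hc]

theorem IsPotentialAt.const_mul {κ : X → X → ℝ} {ψ : X → ℝ} {x : X} (r : ℝ)
    (h : IsPotentialAt κ ψ x) :
    IsPotentialAt (fun c y => r * κ c y) (fun y => r * ψ y) x := by
  refine ⟨contMDiffAt_const.mul h.smooth, ?_⟩
  filter_upwards [h.eventually] with y h1 c hc
  rw [chartLaplacian_const_mul r h1.smooth hc, h1.eventually_eq.self_of_nhds c hc]

theorem isDensity_of_isPotentialAt {κ : X → X → ℝ} (h : ∀ x, ∃ ψ, IsPotentialAt κ ψ x) :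
    IsDensity κ := by
  refine ⟨fun c x hx => ?_, fun c c' x hx hx' => ?_⟩
  · obtain ⟨ψ, hψ⟩ := h x
    refine ContinuousAt.continuousWithinAt ((continuousAt_chartLaplacian hψ.smooth hx).congr ?_)
    filter_upwards [hψ.eventually_eq, (chartAt ℂ c).open_source.mem_nhds hx] with y h1 h2
    exact (h1 c h2).symm
  · obtain ⟨ψ, hψ⟩ := h x
    have h1 := hψ.eventually_eq.self_of_nhds
    rw [h1 c hx, h1 c' hx', chartLaplacian_transition hψ.smooth hx hx']

/-- The shift by `ε` makes the logarithm smooth also at the zeros of `a`. -/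
theorem contMDiffAt_log_add {Φ ψ : X → ℝ} {a : X → ℂ} {x : X} {ε : ℝ} (hε : 0 < ε)
    (ha : ContMDiffAt 𝓘(ℂ) 𝓘(ℂ) ω a x) (hψ : ContMDiffAt 𝓘(ℝ, ℂ) 𝓘(ℝ, ℝ) 2 ψ x)
    (hΦ : ∀ᶠ y in 𝓝 x, Φ y = ‖a y‖ ^ 2 * Real.exp (ψ y)) :
    ContMDiffAt 𝓘(ℝ, ℂ) 𝓘(ℝ, ℝ) 2 (fun y => Real.log (Φ y + ε)) x := by
  have h1 : ContMDiffAt 𝓘(ℝ, ℂ) 𝓘(ℝ, ℂ) 2 a x := (contMDiffAt_restrict_real ha).of_le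
    ENat.LEInfty.out
  have h2 : ContDiffAt ℝ 2 (fun w : ℂ => ‖w‖ ^ 2) (a x) := (contDiff_norm_sq ℝ).contDiffAt
  have h3 : ContMDiffAt 𝓘(ℝ, ℂ) 𝓘(ℝ, ℝ) 2 (fun y => ‖a y‖ ^ 2) x :=
    ContMDiffAt.comp x h2.contMDiffAt h1
  have h4 : ContMDiffAt 𝓘(ℝ, ℂ) 𝓘(ℝ, ℝ) 2 (fun y => Real.exp (ψ y)) x :=
    ContMDiffAt.comp x (g := Real.exp) Real.contDiff_exp.contDiffAt.contMDiffAt hψ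
  have h5 : ContMDiffAt 𝓘(ℝ, ℂ) 𝓘(ℝ, ℝ) 2 (fun y => ‖a y‖ ^ 2 * Real.exp (ψ y) + ε) x :=
    (h3.mul h4).add contMDiffAt_const
  have h6 : ContMDiffAt 𝓘(ℝ, ℂ) 𝓘(ℝ, ℝ) 2
      (fun y => Real.log (‖a y‖ ^ 2 * Real.exp (ψ y) + ε)) x := by
    refine ContMDiffAt.comp x (g := Real.log) (ContDiffAt.contMDiffAt ?_) h5
    exact Real.contDiffAt_log.2 (by positivity)
  refine h6.congr_of_eventuallyEq ?_
  filter_upwards [hΦ] with y hy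
  rw [hy]

/-- Where `a ≠ 0`, `log Φ = log ‖a‖² + ψ` with a harmonic first term, so `log Φ` has Laplacian `κ`
and the convexity estimate applies to it. -/
theorem le_chartLaplacian_log_add {Φ : X → ℝ} {κ : X → X → ℝ} {ψ : X → ℝ} {a : X → ℂ} {c x : X}
    {ε : ℝ} (hε : 0 < ε) (ha : ContMDiffAt 𝓘(ℂ) 𝓘(ℂ) ω a x) (hψ : IsPotentialAt κ ψ x)
    (hΦ : ∀ᶠ y in 𝓝 x, Φ y = ‖a y‖ ^ 2 * Real.exp (ψ y)) (h0 : a x ≠ 0)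
    (hx : x ∈ (chartAt ℂ c).source) :
    Φ x / (Φ x + ε) * κ c x ≤ chartLaplacian (fun y => Real.log (Φ y + ε)) c x := by
  have h1 := contMDiffAt_log_normSq ha h0
  set u : X → ℝ := fun y => Real.log (‖a y‖ ^ 2) + ψ y with hu
  have hus : ContMDiffAt 𝓘(ℝ, ℂ) 𝓘(ℝ, ℝ) 2 u x := h1.add hψ.smooth
  have h2 : ∀ᶠ y in 𝓝 x, Φ y = Real.exp (u y) := by
    filter_upwards [hΦ, ha.continuousAt.eventually_ne h0] with y hy hy0
    rw [hy, hu, Real.exp_add, Real.exp_log (by positivity)]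
  have h3 : chartLaplacian u c x = κ c x := by
    rw [hu, chartLaplacian_add h1 hψ.smooth hx, chartLaplacian_log_normSq ha h0 hx, zero_add,
      hψ.eventually_eq.self_of_nhds c hx]
  have h4 : (fun y => Real.log (Φ y + ε)) =ᶠ[𝓝 x] fun y => Real.log (Real.exp (u y) + ε) := by
    filter_upwards [h2] with y hy
    rw [hy]
  rw [chartLaplacian_congr hx h4, h2.self_of_nhds, ← h3]
  have h5 := le_laplacian_log_exp_add (contDiffAt_comp_chart_symm (n := 2) hus hx) hε
  rw [(chartAt ℂ c).left_inv hx] at h5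
  exact h5

/-- Near `x`, the function `Φ` is `‖a‖² exp ψ` for a potential `ψ` of the density `κ` and a
holomorphic function `a`. -/
structure IsLocalNormSq (Φ : X → ℝ) (κ : X → X → ℝ) (a : X → ℂ) (ψ : X → ℝ) (x : X) : Prop where
  holomorphic : ContMDiffAt 𝓘(ℂ) 𝓘(ℂ) ω a x
  potential : IsPotentialAt κ ψ x
  eventually_eq : ∀ᶠ y in 𝓝 x, Φ y = ‖a y‖ ^ 2 * Real.exp (ψ y)

theorem IsLocalNormSq.eventually {Φ : X → ℝ} {κ : X → X → ℝ} {a : X → ℂ} {ψ : X → ℝ} {x : X}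
    (h : IsLocalNormSq Φ κ a ψ x) : ∀ᶠ y in 𝓝 x, IsLocalNormSq Φ κ a ψ y := by
  filter_upwards [eventually_contMDiffAt_omega h.holomorphic, h.potential.eventually,
    h.eventually_eq.eventually_nhds] with y h1 h2 h3 using ⟨h1, h2, h3⟩

variable [T2Space X] [CompactSpace X]

/-- Each point has a neighbourhood in which it is the only possible bad point; by compactness
finitely many of these cover `X`. -/
theorem finite_setOf_zero {Φ : X → ℝ} {κ : X → X → ℝ}
    (h : ∀ x, ∃ a ψ, IsLocalNormSq Φ κ a ψ x ∧ ∀ᶠ y in 𝓝[≠] x, a y ≠ 0) :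
    {x | ¬ ∃ a ψ, IsLocalNormSq Φ κ a ψ x ∧ a x ≠ 0}.Finite := by
  have h1 : ∀ x, {y | y = x ∨ ∃ a ψ, IsLocalNormSq Φ κ a ψ y ∧ a y ≠ 0} ∈ 𝓝 x := by
    intro x
    obtain ⟨a, ψ, h2, h3⟩ := h x
    rw [eventually_nhdsWithin_iff] at h3
    filter_upwards [h2.eventually, h3] with y h4 h5
    by_cases hy : y = x
    · exact Or.inl hy
    · exact Or.inr ⟨a, ψ, h4, h5 hy⟩
  obtain ⟨t, ht⟩ := (isCompact_univ (X := X)).elim_nhds_subcover _ fun x _ => h1 x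
  refine t.finite_toSet.subset fun y hy => ?_
  have := ht.2 (mem_univ y)
  simp only [mem_iUnion, mem_ofPred_eq] at this
  obtain ⟨x, hx, h | h⟩ := this
  · rw [h]; exact hx
  · exact absurd h hy

/-- The integrated form of the fact that a line bundle with a non-zero holomorphic section has
non-negative degree; the sign is reversed because degrees carry the factor `-1 / (4π)`. -/
theorem ChartPartition.integral_nonpos (P : ChartPartition X) {Φ : X → ℝ} {κ : X → X → ℝ}
    (h : ∀ x, ∃ a ψ, IsLocalNormSq Φ κ a ψ x ∧ ∀ᶠ y in 𝓝[≠] x, a y ≠ 0) :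
    P.integral κ ≤ 0 := by
  have hκ : IsDensity κ := isDensity_of_isPotentialAt fun x => by
    obtain ⟨a, ψ, h1, -⟩ := h x
    exact ⟨ψ, h1.potential⟩
  have hΦ0 : ∀ x, 0 ≤ Φ x := fun x => by
    obtain ⟨a, ψ, h1, -⟩ := h x
    rw [h1.eventually_eq.self_of_nhds]
    positivity
  have hΦc : Continuous Φ := by
    rw [continuous_iff_continuousAt]
    intro x
    obtain ⟨a, ψ, h1, -⟩ := h x
    refine ContinuousAt.congr ?_ (h1.eventually_eq.mono fun y hy => hy.symm)
    exact (h1.holomorphic.continuousAt.norm.pow 2).mul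
      (Real.continuous_exp.continuousAt.comp h1.potential.smooth.continuousAt)
  set B : Set X := {x | ¬ ∃ a ψ, IsLocalNormSq Φ κ a ψ x ∧ a x ≠ 0} with hB
  have hBfin : B.Finite := finite_setOf_zero h
  -- The exceptional set is finite, so its chart images are null sets and the pointwise inequality
  -- is only needed off it.
  have hae : ∀ c, ∀ᵐ z ∂(volume.restrict (chartAt ℂ c).target),
      z ∈ (chartAt ℂ c).target ∧ (chartAt ℂ c).symm z ∉ B := by
    intro c
    have h1 : ((chartAt ℂ c) '' B).Finite := hBfin.image _
    have h2 : ∀ᵐ z ∂(volume : Measure ℂ), z ∉ (chartAt ℂ c) '' B :=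
      (measure_eq_zero_iff_ae_notMem.1 (h1.measure_zero _))
    filter_upwards [ae_restrict_of_ae h2, ae_restrict_mem (chartAt ℂ c).open_target.measurableSet]
      with z h3 h4
    exact ⟨h4, fun h5 => h3 ⟨_, h5, (chartAt ℂ c).right_inv h4⟩⟩
  have hle : ∀ ε : ℝ, 0 < ε → P.integral (fun c x => Φ x / (Φ x + ε) * κ c x) ≤ 0 := by
    intro ε hε
    have hsm : ∀ x, ContMDiffAt 𝓘(ℝ, ℂ) 𝓘(ℝ, ℝ) 2 (fun y => Real.log (Φ y + ε)) x := by
      intro x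
      obtain ⟨a, ψ, h1, -⟩ := h x
      exact contMDiffAt_log_add hε h1.holomorphic h1.potential.smooth h1.eventually_eq
    rw [← P.integral_chartLaplacian hsm]
    refine Finset.sum_le_sum fun a _ => ?_
    refine integral_mono_ae (P.integrableOn a
      (F := fun x => Φ x / (Φ x + ε) * κ (P.c a) x) ?_) (P.integrableOn a ?_) ?_
    · refine ContinuousOn.mul ?_ (hκ.continuousOn _)
      exact (hΦc.div (hΦc.add continuous_const)
        fun x => (add_pos_of_nonneg_of_pos (hΦ0 x) hε).ne').continuousOn
    · exact fun x hx => (continuousAt_chartLaplacian (hsm x) hx).continuousWithinAt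
    · filter_upwards [hae (P.c a)] with z hz
      have h1 := hz.2
      simp only [hB, mem_ofPred_eq, not_not] at h1
      obtain ⟨b, ψ, h2, h3⟩ := h1
      exact mul_le_mul_of_nonneg_left (le_chartLaplacian_log_add hε h2.holomorphic h2.potential
        h2.eventually_eq h3 ((chartAt ℂ _).map_target hz.1)) (P.ρ.nonneg a _)
  -- Dominated convergence: the factor `Φ / (Φ + ε)` lies in `[0, 1]` and tends to `1` wherever `Φ ≠
  -- 0`, hence almost everywhere.
  have hlim : Filter.Tendsto (fun n : ℕ =>
      P.integral (fun c x => Φ x / (Φ x + 1 / ((n : ℝ) + 1)) * κ c x)) Filter.atTop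
      (𝓝 (P.integral κ)) := by
    refine tendsto_finsetSum _ fun a _ => ?_
    refine tendsto_integral_of_dominated_convergence (fun z =>
      ‖P.ρ a ((chartAt ℂ (P.c a)).symm z) * κ (P.c a) ((chartAt ℂ (P.c a)).symm z)‖)
      (fun n => ?_) (P.integrableOn a (hκ.continuousOn _)).norm (fun n => ?_) ?_
    · refine (P.integrableOn a
        (F := fun x => Φ x / (Φ x + 1 / ((n : ℝ) + 1)) * κ (P.c a) x) ?_).aestronglyMeasurable
      refine ContinuousOn.mul ?_ (hκ.continuousOn _)
      exact (hΦc.div (hΦc.add continuous_const) fun x =>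
        (add_pos_of_nonneg_of_pos (hΦ0 x) (by positivity)).ne').continuousOn
    · refine Filter.Eventually.of_forall fun z => ?_
      have h1 : 0 < 1 / ((n : ℝ) + 1) := by positivity
      have h2 := hΦ0 ((chartAt ℂ (P.c a)).symm z)
      have h3 : ‖Φ ((chartAt ℂ (P.c a)).symm z) /
          (Φ ((chartAt ℂ (P.c a)).symm z) + 1 / ((n : ℝ) + 1))‖ ≤ 1 := by
        rw [Real.norm_of_nonneg (by positivity)]
        exact div_le_one_of_le₀ (by linarith) (by positivity)
      rw [norm_mul, norm_mul, norm_mul]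
      refine mul_le_mul_of_nonneg_left ?_ (norm_nonneg _)
      exact mul_le_of_le_one_left (norm_nonneg _) h3
    · filter_upwards [hae (P.c a)] with z hz
      have h1 := hz.2
      simp only [hB, mem_ofPred_eq, not_not] at h1
      obtain ⟨b, ψ, h2, h3⟩ := h1
      have h4 : Φ ((chartAt ℂ (P.c a)).symm z) ≠ 0 := by
        rw [h2.eventually_eq.self_of_nhds]
        have := Real.exp_pos (ψ ((chartAt ℂ (P.c a)).symm z))
        positivity
      refine Filter.Tendsto.const_mul _ ?_
      have h5 : Filter.Tendsto (fun n : ℕ => Φ ((chartAt ℂ (P.c a)).symm z) /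
          (Φ ((chartAt ℂ (P.c a)).symm z) + 1 / ((n : ℝ) + 1))) Filter.atTop (𝓝 1) := by
        have h6 := (tendsto_const_nhds (x := Φ ((chartAt ℂ (P.c a)).symm z))).div
          (tendsto_const_nhds.add (tendsto_one_div_add_atTop_nhds_zero_nat (𝕜 := ℝ)))
          (by simpa using h4)
        simpa [div_self h4, Pi.div_def] using h6
      simpa using h5.mul_const (κ (P.c a) ((chartAt ℂ (P.c a)).symm z))
  exact le_of_tendsto hlim (Filter.Eventually.of_forall fun n => hle _ (by positivity))

end Potentials

/-! ### Gram determinants -/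

section Gram

variable {M : Type*} [AddCommGroup M] [Module ℂ M]

/-- The Gram determinant of a finite family of vectors with respect to a sesquilinear form. -/
def gramDet {ι : Type*} [Fintype ι] [DecidableEq ι] (B : M →ₗ⋆[ℂ] M →ₗ[ℂ] ℂ) (v : ι → M) : ℝ :=
  (Matrix.det (Matrix.of fun i j => B (v i) (v j))).re

open scoped ComplexOrder in
theorem gramDet_pos {ι : Type*} [Fintype ι] [DecidableEq ι] {B : M →ₗ⋆[ℂ] M →ₗ[ℂ] ℂ}
    (hsymm : ∀ v w, starRingEnd ℂ (B v w) = B w v) (hpos : ∀ v, v ≠ 0 → 0 < (B v v).re)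
    {v : ι → M} (hv : LinearIndependent ℂ v) : 0 < gramDet B v := by
  have h : (Matrix.of fun i j => B (v i) (v j)).PosDef := by
    refine Matrix.PosDef.of_dotProduct_mulVec_pos ?_ fun x hx => ?_
    · ext i j
      simp [Matrix.conjTranspose_apply, hsymm]
    · have h1 : star x ⬝ᵥ ((Matrix.of fun i j => B (v i) (v j)).mulVec x) =
          B (∑ i, x i • v i) (∑ i, x i • v i) := by
        simp only [dotProduct, Matrix.mulVec, map_sum, LinearMap.sum_apply, map_smulₛₗ,
          LinearMap.smul_apply, Matrix.of_apply, Pi.star_apply, Finset.mul_sum, smul_eq_mul,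
          RingHom.id_apply]
        rw [Finset.sum_comm]
        refine Finset.sum_congr rfl fun i _ => Finset.sum_congr rfl fun j _ => ?_
        simp only [RCLike.star_def]
        ring
      have h2 : ∑ i, x i • v i ≠ 0 := fun h0 => hx (by
        ext i
        exact Fintype.linearIndependent_iff.1 hv x h0 i)
      have h3 := hsymm (∑ i, x i • v i) (∑ i, x i • v i)
      rw [h1, Complex.lt_def]
      refine ⟨hpos _ h2, ?_⟩
      rw [Complex.conj_eq_iff_im] at h3
      simpa using h3.symm
  exact (Complex.lt_def.1 h.det_pos).1

theorem gramDet_change {ι : Type*} [Fintype ι] [DecidableEq ι] (B : M →ₗ⋆[ℂ] M →ₗ[ℂ] ℂ)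
    {v w : ι → M} {A : Matrix ι ι ℂ} (h : ∀ j, w j = ∑ i, A i j • v i) :
    gramDet B w = ‖A.det‖ ^ 2 * gramDet B v := by
  have h1 : (Matrix.of fun i j => B (w i) (w j)) =
      A.conjTranspose * (Matrix.of fun i j => B (v i) (v j)) * A := by
    ext i j
    simp only [Matrix.of_apply, h, Matrix.mul_apply, Matrix.conjTranspose_apply, map_sum,
      LinearMap.sum_apply, map_smulₛₗ, LinearMap.smul_apply, smul_eq_mul, RingHom.id_apply,
      Finset.sum_mul, Finset.mul_sum]
    refine Finset.sum_congr rfl fun l _ => Finset.sum_congr rfl fun m _ => ?_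
    simp only [RCLike.star_def]
    ring
  rw [gramDet, h1, Matrix.det_mul, Matrix.det_mul, Matrix.det_conjTranspose, gramDet]
  have h2 : star A.det * (Matrix.of fun i j => B (v i) (v j)).det * A.det =
      ((‖A.det‖ ^ 2 : ℝ) : ℂ) * (Matrix.of fun i j => B (v i) (v j)).det := by
    rw [Complex.ofReal_pow, ← Complex.conj_mul']
    simp only [RCLike.star_def]
    ring
  rw [h2, Complex.re_ofReal_mul]

theorem gramDet_reindex {ι κ : Type*} [Fintype ι] [DecidableEq ι] [Fintype κ] [DecidableEq κ]
    (B : M →ₗ⋆[ℂ] M →ₗ[ℂ] ℂ) (v : ι → M) (e : κ ≃ ι) :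
    gramDet B (fun i => v (e i)) = gramDet B v := by
  rw [gramDet, gramDet]
  exact congrArg Complex.re
    (Matrix.det_submatrix_equiv_self e (Matrix.of fun i j => B (v i) (v j)))

theorem exists_matrix_of_mem_span {ι κ : Type*} [Fintype ι] {v : ι → M} {w : κ → M}
    (h : ∀ j, w j ∈ Submodule.span ℂ (Set.range v)) :
    ∃ A : Matrix ι κ ℂ, ∀ j, w j = ∑ i, A i j • v i := by
  choose f hf using fun j => (Submodule.mem_span_range_iff_exists_fun ℂ).1 (h j)
  exact ⟨Matrix.of fun i j => f j i, fun j => (hf j).symm⟩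

theorem det_ne_zero_of_linearIndependent {ι : Type*} [Fintype ι] [DecidableEq ι] {v w : ι → M}
    {A : Matrix ι ι ℂ} (h : ∀ j, w j = ∑ i, A i j • v i) (hw : LinearIndependent ℂ w) :
    A.det ≠ 0 := by
  intro h0
  obtain ⟨x, hx, hx0⟩ := Matrix.exists_mulVec_eq_zero_iff.2 h0
  apply hx
  ext j
  refine Fintype.linearIndependent_iff.1 hw x ?_ j
  simp only [h, Finset.smul_sum, smul_smul]
  rw [Finset.sum_comm]
  refine Finset.sum_eq_zero fun i _ => ?_
  rw [← Finset.sum_smul]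
  have := congrFun hx0 i
  simp only [Matrix.mulVec, dotProduct, Pi.zero_apply] at this
  rw [Finset.sum_congr rfl fun j _ => mul_comm (x j) (A i j), this, zero_smul]

end Gram

/-! ### Curvature of a subbundle, computed in holomorphic frames. -/

section Frames

variable {X : Type*} [TopologicalSpace X] [ChartedSpace ℂ X]

theorem contMDiffAt_det {ι : Type*} [Fintype ι] [DecidableEq ι] {A : X → Matrix ι ι ℂ} {x : X}
    (h : ∀ i j, ContMDiffAt 𝓘(ℂ) 𝓘(ℂ) ω (fun y => A y i j) x) :
    ContMDiffAt 𝓘(ℂ) 𝓘(ℂ) ω (fun y => (A y).det) x := by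
  simp only [Matrix.det_apply']
  exact contMDiffAt_finsetSum fun σ _ =>
    contMDiffAt_const.mul (contMDiffAt_finsetProd fun i _ => h _ _)

theorem contMDiffAt_det_real {ι : Type*} [Fintype ι] [DecidableEq ι] {A : X → Matrix ι ι ℂ} {x : X}
    (h : ∀ i j, ContMDiffAt 𝓘(ℝ, ℂ) 𝓘(ℝ, ℂ) 2 (fun y => A y i j) x) :
    ContMDiffAt 𝓘(ℝ, ℂ) 𝓘(ℝ, ℂ) 2 (fun y => (A y).det) x := by
  have h1 : ContMDiffAt 𝓘(ℝ, ℂ) 𝓘(ℝ, ι → ι → ℂ) 2 (fun y i j => A y i j) x :=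
    contMDiffAt_pi_space.2 fun i => contMDiffAt_pi_space.2 fun j => h i j
  have h2 : ContDiff ℝ 2 fun B : ι → ι → ℂ => (Matrix.of B).det := by
    simp only [Matrix.det_apply', Matrix.of_apply]
    refine ContDiff.sum fun σ _ => contDiff_const.mul (contDiff_prod fun i _ => ?_)
    fun_prop
  exact ContMDiffAt.comp x (g := fun B : ι → ι → ℂ => (Matrix.of B).det)
    h2.contDiffAt.contMDiffAt h1

variable {F : Type*} [NormedAddCommGroup F] [NormedSpace ℂ F]
variable {V : X → Type*} [∀ x, AddCommGroup (V x)] [∀ x, Module ℂ (V x)]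
  [∀ x, TopologicalSpace (V x)] [TopologicalSpace (TotalSpace F V)] [FiberBundle F V]

theorem IsHolomorphicFrameOn.mono {k : ℕ} {S : ∀ x, Submodule ℂ (V x)} {U U' : Set X}
    {s : Fin k → ∀ x, V x} (h : IsHolomorphicFrameOn F S U s) (hU' : IsOpen U') (hU : U' ⊆ U) :
    IsHolomorphicFrameOn F S U' s where
  isOpen := hU'
  holomorphic i := (h.holomorphic i).mono hU
  linearIndependent x hx := h.linearIndependent x (hU hx)
  span_eq x hx := h.span_eq x (hU hx)

theorem HermitianMetric.logGram_eq (h : HermitianMetric F V) {k : ℕ} (s : Fin k → ∀ x, V x)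
    (x : X) : h.logGram s x = Real.log (gramDet (h.form x) fun i => s i x) := rfl

theorem HermitianMetric.gramDet_pos (h : HermitianMetric F V) {ι : Type*} [Fintype ι]
    [DecidableEq ι] {x : X} {v : ι → V x} (hv : LinearIndependent ℂ v) :
    0 < gramDet (h.form x) v :=
  TwistedHiggs.gramDet_pos (h.conj_symm x) (h.pos_def x) hv

theorem IsHolomorphicFrameOn.contMDiffAt_logGram {k : ℕ} {S : ∀ x, Submodule ℂ (V x)} {U : Set X}
    {s : Fin k → ∀ x, V x} (hs : IsHolomorphicFrameOn F S U s) (h : HermitianMetric F V) {x : X}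
    (hx : x ∈ U) : ContMDiffAt 𝓘(ℝ, ℂ) 𝓘(ℝ, ℝ) 2 (h.logGram s) x := by
  have h1 : ContMDiffAt 𝓘(ℝ, ℂ) 𝓘(ℝ, ℂ) 2 (fun y =>
      (Matrix.of fun i j => h.form y (s i y) (s j y)).det) x := by
    refine contMDiffAt_det_real fun i j => ?_
    exact ((h.smooth U (s i) (s j) hs.isOpen (hs.holomorphic i) (hs.holomorphic j)).contMDiffAt
      (hs.isOpen.mem_nhds hx)).of_le ENat.LEInfty.out
  have h2 : ContMDiffAt 𝓘(ℝ, ℂ) 𝓘(ℝ, ℝ) 2 (fun y =>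
      gramDet (h.form y) fun i => s i y) x :=
    ContMDiffAt.comp x (g := Complex.reCLM) Complex.reCLM.contDiff.contDiffAt.contMDiffAt h1
  refine ContMDiffAt.comp x (g := Real.log) (ContDiffAt.contMDiffAt ?_) h2
  exact Real.contDiffAt_log.2 (h.gramDet_pos (hs.linearIndependent x hx)).ne'

variable [VectorBundle ℂ F V] [FiniteDimensional ℂ F]

theorem IsHolomorphicOn.contMDiffAt_trivialization {U : Set X} (hU : IsOpen U) {s : ∀ x, V x}
    (hs : IsHolomorphicOn F U s) {x : X} (hx : x ∈ U) :
    ContMDiffAt 𝓘(ℂ) 𝓘(ℂ, F) ω (fun y => (trivializationAt F V x ⟨y, s y⟩).2) x :=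
  (contMDiffAt_section x).1 (hs.contMDiffAt (hU.mem_nhds hx))

/-- If `A` is the matrix from `s` to `s'`, the Gram determinants differ by `‖det A‖²`. Holomorphy of
`det A` is obtained by writing it as a quotient `D s' / D s` of two holomorphic functions, which are
the witnesses `a` and `b`. -/
theorem IsHolomorphicFrameOn.logGram_change [IsManifold 𝓘(ℂ) ω X] {k : ℕ}
    {S : ∀ x, Submodule ℂ (V x)} {U U' : Set X}
    {s s' : Fin k → ∀ x, V x} (hs : IsHolomorphicFrameOn F S U s)
    (hs' : IsHolomorphicFrameOn F S U' s') (h : HermitianMetric F V) {x : X}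
    (hx : x ∈ U) (hx' : x ∈ U') :
    ∃ a b : X → ℂ, ContMDiffAt 𝓘(ℂ) 𝓘(ℂ) ω a x ∧ ContMDiffAt 𝓘(ℂ) 𝓘(ℂ) ω b x ∧ a x ≠ 0 ∧ b x ≠ 0 ∧
      ∀ᶠ y in 𝓝 x, h.logGram s' y =
        h.logGram s y + (Real.log (‖a y‖ ^ 2) + (-1) * Real.log (‖b y‖ ^ 2)) := by
  set e := trivializationAt F V x with he
  have hxe : x ∈ e.baseSet := FiberBundle.mem_baseSet_trivializationAt' x
  have hsx := hs.linearIndependent x hx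
  have h1 : LinearIndependent ℂ fun i => e.linearEquivAt ℂ x hxe (s i x) :=
    hsx.map' (e.linearEquivAt ℂ x hxe).toLinearMap (LinearEquiv.ker _)
  -- A constant left inverse of the frame `s` at `x`, in the trivialization. The determinant `D t`
  -- of `pr` applied to a family `t` is then holomorphic, and `D s x = 1`.
  obtain ⟨pr, hpr⟩ := (Fintype.linearCombination ℂ
    fun i => e.linearEquivAt ℂ x hxe (s i x)).exists_leftInverse_of_injective
      (LinearMap.ker_eq_bot.2 h1.fintypeLinearCombination_injective)
  have hprs : ∀ i, pr (e.linearEquivAt ℂ x hxe (s i x)) = Pi.single i 1 := by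
    intro i
    have := LinearMap.congr_fun hpr (Pi.single i 1)
    simpa [Fintype.linearCombination_apply_single] using this
  set D : (Fin k → ∀ x, V x) → X → ℂ := fun t y =>
    (Matrix.of fun i j => pr (e ⟨y, t j y⟩).2 i).det with hD
  have hDs : ∀ {U : Set X} {t : Fin k → ∀ x, V x}, IsHolomorphicFrameOn F S U t → x ∈ U →
      ContMDiffAt 𝓘(ℂ) 𝓘(ℂ) ω (D t) x := by
    intro U t ht hxU
    refine contMDiffAt_det fun i j => ?_
    have h2 := (ht.holomorphic j).contMDiffAt_trivialization ht.isOpen hxU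
    exact ContMDiffAt.comp x
      (g := ((ContinuousLinearMap.proj i).comp (LinearMap.toContinuousLinearMap pr) : F →L[ℂ] ℂ))
      (ContinuousLinearMap.contDiff _).contDiffAt.contMDiffAt h2
  have hDmul : ∀ y ∈ e.baseSet, ∀ A : Matrix (Fin k) (Fin k) ℂ,
      (∀ j, s' j y = ∑ i, A i j • s i y) → D s' y = D s y * A.det := by
    intro y hy A hA
    rw [hD]
    simp only
    rw [← Matrix.det_mul]
    congr 1
    ext i j
    simp only [Matrix.of_apply, Matrix.mul_apply]
    have h3 : ∀ v, (e ⟨y, v⟩).2 = e.linearEquivAt ℂ y hy v := fun v => rfl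
    simp only [h3, hA, map_sum, map_smul, Finset.sum_apply, Pi.smul_apply, smul_eq_mul]
    exact Finset.sum_congr rfl fun l _ => mul_comm _ _
  have hDx : D s x = 1 := by
    rw [hD, ← Matrix.det_one (n := Fin k)]
    simp only
    congr 1
    ext i j
    have h3 : ∀ v, (e ⟨x, v⟩).2 = e.linearEquivAt ℂ x hxe v := fun v => rfl
    simp only [Matrix.of_apply, h3, hprs, Matrix.one_apply, Pi.single_apply]
  have hmat : ∀ y, y ∈ U → y ∈ U' → ∃ A : Matrix (Fin k) (Fin k) ℂ,
      (∀ j, s' j y = ∑ i, A i j • s i y) ∧ A.det ≠ 0 := by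
    intro y hy hy'
    obtain ⟨A, hA⟩ := exists_matrix_of_mem_span (v := fun i => s i y) (w := fun j => s' j y)
      fun j => by
        rw [hs.span_eq y hy, ← hs'.span_eq y hy']
        exact Submodule.subset_span ⟨j, rfl⟩
    exact ⟨A, hA, det_ne_zero_of_linearIndependent hA (hs'.linearIndependent y hy')⟩
  have hDx0 : D s x ≠ 0 := by rw [hDx]; exact one_ne_zero
  have hDx' : D s' x ≠ 0 := by
    obtain ⟨A, hA, hA0⟩ := hmat x hx hx'
    rw [hDmul x hxe A hA]
    exact mul_ne_zero hDx0 hA0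
  refine ⟨D s', D s, hDs hs' hx', hDs hs hx, hDx', hDx0, ?_⟩
  filter_upwards [hs.isOpen.mem_nhds hx, hs'.isOpen.mem_nhds hx', e.open_baseSet.mem_nhds hxe,
    (hDs hs hx).continuousAt.eventually_ne hDx0] with y hy hy' hye hy0
  obtain ⟨A, hA, hA0⟩ := hmat y hy hy'
  have h4 := (h.gramDet_pos (hs.linearIndependent y hy)).ne'
  have hA0' : ‖A.det‖ ≠ 0 := norm_ne_zero_iff.2 hA0
  have hy0' : ‖D s y‖ ≠ 0 := norm_ne_zero_iff.2 hy0
  rw [h.logGram_eq, h.logGram_eq, gramDet_change (h.form y) hA, hDmul y hye A hA, norm_mul,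
    mul_pow, Real.log_mul (by positivity) h4, Real.log_mul (by positivity) (by positivity)]
  ring

open Classical in
/-- The Laplacian `Δ log det h(sᵢ, sⱼ)`, in the preferred chart at `c`, for any holomorphic frame `s`
of `S` near `x`. -/
def curvature (h : HermitianMetric F V) (S : ∀ x, Submodule ℂ (V x)) (k : ℕ) (c x : X) : ℝ :=
  if H : ∃ (s : Fin k → ∀ x, V x) (U : Set X), x ∈ U ∧ IsHolomorphicFrameOn F S U s then
    chartLaplacian (h.logGram H.choose) c x
  else 0

/-- A change of frame alters `logGram` by a harmonic function, so the frame chosen in `curvature`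
may be replaced by `s`. -/
theorem IsHolomorphicFrameOn.isPotentialAt_logGram [IsManifold 𝓘(ℂ) ω X] {k : ℕ}
    {S : ∀ x, Submodule ℂ (V x)} {U : Set X} {s : Fin k → ∀ x, V x}
    (hs : IsHolomorphicFrameOn F S U s) (h : HermitianMetric F V) {x : X} (hx : x ∈ U) :
    IsPotentialAt (curvature h S k) (h.logGram s) x := by
  refine ⟨hs.contMDiffAt_logGram h hx, ?_⟩
  filter_upwards [hs.isOpen.mem_nhds hx] with y hy c hyc
  have H : ∃ (s : Fin k → ∀ x, V x) (U : Set X), y ∈ U ∧ IsHolomorphicFrameOn F S U s :=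
    ⟨s, U, hy, hs⟩
  rw [curvature, dif_pos H]
  obtain ⟨U', hy', hs'⟩ := H.choose_spec
  obtain ⟨a, b, ha, hb, ha0, hb0, hab⟩ := hs.logGram_change hs' h hy hy'
  have h1 := contMDiffAt_log_normSq ha ha0
  have h2 := contMDiffAt_log_normSq hb hb0
  have h3 : ContMDiffAt 𝓘(ℝ, ℂ) 𝓘(ℝ, ℝ) 2 (fun y => (-1) * Real.log (‖b y‖ ^ 2)) y :=
    contMDiffAt_const.mul h2
  have h4 : ContMDiffAt 𝓘(ℝ, ℂ) 𝓘(ℝ, ℝ) 2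
      (fun y => Real.log (‖a y‖ ^ 2) + (-1) * Real.log (‖b y‖ ^ 2)) y := h1.add h3
  rw [chartLaplacian_congr hyc hab, chartLaplacian_add (hs.contMDiffAt_logGram h hy) h4 hyc,
    chartLaplacian_add h1 h3 hyc, chartLaplacian_const_mul _ h2 hyc,
    chartLaplacian_log_normSq ha ha0 hyc, chartLaplacian_log_normSq hb hb0 hyc]
  ring

end Frames

/-! ### The degree is well defined -/

section Degree

variable {X : Type*} [TopologicalSpace X] [ChartedSpace ℂ X] [IsManifold 𝓘(ℂ) ω X]
variable {F : Type*} [NormedAddCommGroup F] [NormedSpace ℂ F] [FiniteDimensional ℂ F]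
variable {V : X → Type*} [∀ x, AddCommGroup (V x)] [∀ x, Module ℂ (V x)]
  [∀ x, TopologicalSpace (V x)] [TopologicalSpace (TotalSpace F V)] [FiberBundle F V]
  [VectorBundle ℂ F V]

theorem isDensity_curvature {S : ∀ x, Submodule ℂ (V x)} {k : ℕ}
    (hS : IsHolomorphicSubbundle F S k) (h : HermitianMetric F V) :
    IsDensity (curvature h S k) :=
  isDensity_of_isPotentialAt fun x => by
    obtain ⟨U, s, hx, hs⟩ := hS x
    exact ⟨_, hs.isPotentialAt_logGram h hx⟩

/-- This matches a summand of `IsDegree` with the intrinsic curvature: where `s` fails to be a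
frame, `ρ` vanishes. -/
theorem chartLaplacian_logGram_eq {S : ∀ x, Submodule ℂ (V x)} {k : ℕ} (h : HermitianMetric F V)
    (ρ : X → ℝ) {c : X} {U : Set X} {s : Fin k → ∀ x, V x} (hs : IsHolomorphicFrameOn F S U s)
    (hρ : tsupport ρ ⊆ U) (r : ℝ) :
    ∫ z in (chartAt ℂ c).target, ρ ((chartAt ℂ c).symm z) *
        (r * Laplacian.laplacian (fun w : ℂ => h.logGram s ((chartAt ℂ c).symm w)) z) =
      r * ∫ z in (chartAt ℂ c).target, ρ ((chartAt ℂ c).symm z) *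
        curvature h S k c ((chartAt ℂ c).symm z) := by
  rw [← integral_const_mul]
  refine setIntegral_congr_fun (chartAt ℂ c).open_target.measurableSet fun z hz => ?_
  by_cases hU : (chartAt ℂ c).symm z ∈ U
  · have h1 := (hs.isPotentialAt_logGram h hU).eventually_eq.self_of_nhds c
      ((chartAt ℂ c).map_target hz)
    rw [h1, chartLaplacian, (chartAt ℂ c).right_inv hz]
    ring
  · rw [image_eq_zero_of_notMem_tsupport fun h => hU (hρ h)]
    simp

theorem IsDegree.exists_eq_integral {S : ∀ x, Submodule ℂ (V x)} {k : ℕ} {d : ℝ}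
    (hd : IsDegree F S k d) : ∃ (h : HermitianMetric F V) (P : ChartPartition X),
      d = -(1 / (4 * Real.pi)) * P.integral (curvature h S k) := by
  obtain ⟨h, N, ρ, U, c, s, hρ, hU, hs, rfl⟩ := hd
  refine ⟨h, ⟨N, ρ, c, fun a => (hρ a).trans (hU a)⟩, ?_⟩
  rw [ChartPartition.integral, Finset.mul_sum]
  exact Finset.sum_congr rfl fun a _ => chartLaplacian_logGram_eq h (ρ a) (hs a) (hρ a) _

variable [T2Space X] [CompactSpace X]

theorem exists_finite_partition {ι : Type*} (U : ι → Set X) (hU : ∀ i, IsOpen (U i))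
    (hcov : ∀ x, ∃ i, x ∈ U i) :
    ∃ (N : ℕ) (j : Fin N → ι) (ρ : SmoothPartitionOfUnity (Fin N) 𝓘(ℝ, ℂ) X),
      ρ.IsSubordinate fun a => U (j a) := by
  have : IsManifold 𝓘(ℝ, ℂ) ∞ X := isManifold_real
  obtain ⟨t, ht⟩ := (isCompact_univ (X := X)).elim_finite_subcover U hU
    fun x _ => mem_iUnion.2 (hcov x)
  have ht' : (univ : Set X) ⊆ ⋃ a : Fin t.card, U (t.equivFin.symm a) := by
    intro x _
    obtain ⟨i, hi⟩ := mem_iUnion.1 (ht (mem_univ x))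
    obtain ⟨hit, hxi⟩ := mem_iUnion.1 hi
    refine mem_iUnion.2 ⟨t.equivFin ⟨i, hit⟩, ?_⟩
    simpa using hxi
  obtain ⟨ρ, hρ⟩ := SmoothPartitionOfUnity.exists_isSubordinate 𝓘(ℝ, ℂ) isClosed_univ
    (fun a : Fin t.card => U (t.equivFin.symm a)) (fun a => hU _) ht'
  exact ⟨t.card, fun a => t.equivFin.symm a, ρ, hρ⟩

variable (X) in
theorem nonempty_chartPartition : Nonempty (ChartPartition X) := by
  obtain ⟨N, j, ρ, hρ⟩ := exists_finite_partition (X := X) (fun c => (chartAt ℂ c).source)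
    (fun c => (chartAt ℂ c).open_source) fun x => ⟨x, mem_chart_source ℂ x⟩
  exact ⟨⟨N, ρ, j, hρ⟩⟩

theorem exists_isDegree {S : ∀ x, Submodule ℂ (V x)} {k : ℕ}
    (hS : IsHolomorphicSubbundle F S k) (h : HermitianMetric F V) : ∃ d, IsDegree F S k d := by
  choose U s hx hs using hS
  obtain ⟨N, j, ρ, hρ⟩ := exists_finite_partition (X := X)
    (fun c => (chartAt ℂ c).source ∩ U c) (fun c => (chartAt ℂ c).open_source.inter (hs c).isOpen)
    fun x => ⟨x, mem_chart_source ℂ x, hx x⟩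
  exact ⟨_, h, N, ρ, fun a => (chartAt ℂ (j a)).source ∩ U (j a), j, fun a => s (j a), hρ,
    fun a => inter_subset_left, fun a => (hs (j a)).mono
      ((chartAt ℂ (j a)).open_source.inter (hs (j a)).isOpen) inter_subset_right, rfl⟩

/-- A change of frame multiplies both Gram determinants by the same factor, so the logarithm of
their ratio is a global smooth function. Its Laplacian is the difference of the curvatures and
integrates to zero. -/
theorem ChartPartition.integral_curvature_eq (P : ChartPartition X) {S : ∀ x, Submodule ℂ (V x)}
    {k : ℕ} (hS : IsHolomorphicSubbundle F S k) (h h' : HermitianMetric F V) :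
    P.integral (curvature h S k) = P.integral (curvature h' S k) := by
  choose U s hx hs using hS
  -- The frame used here varies with the point; `hloc` replaces it near `x` by the fixed frame `s
  -- x`, which yields smoothness.
  set f : X → ℝ := fun x => h.logGram (s x) x + (-1) * h'.logGram (s x) x with hf
  have hloc : ∀ x, ∀ y ∈ U x, f y = h.logGram (s x) y + (-1) * h'.logGram (s x) y := by
    intro x y hy
    obtain ⟨A, hA⟩ := exists_matrix_of_mem_span (v := fun i => s x i y) (w := fun j => s y j y)
      fun j => by
        rw [(hs x).span_eq y hy, ← (hs y).span_eq y (hx y)]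
        exact Submodule.subset_span ⟨j, rfl⟩
    have hA0 := norm_ne_zero_iff.2
      (det_ne_zero_of_linearIndependent hA ((hs y).linearIndependent y (hx y)))
    have h1 := (h.gramDet_pos ((hs x).linearIndependent y hy)).ne'
    have h2 := (h'.gramDet_pos ((hs x).linearIndependent y hy)).ne'
    rw [hf]
    simp only [HermitianMetric.logGram_eq]
    rw [gramDet_change (h.form y) hA, gramDet_change (h'.form y) hA,
      Real.log_mul (by positivity) h1, Real.log_mul (by positivity) h2]
    ring
  have hpot : ∀ x, IsPotentialAt (fun c y => curvature h S k c y + (-1) * curvature h' S k c y)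
      f x := by
    intro x
    have h1 := ((hs x).isPotentialAt_logGram h (hx x)).add
      (((hs x).isPotentialAt_logGram h' (hx x)).const_mul (-1))
    have h2 : f =ᶠ[𝓝 x] fun y => h.logGram (s x) y + (-1) * h'.logGram (s x) y := by
      filter_upwards [(hs x).isOpen.mem_nhds (hx x)] with y hy using hloc x y hy
    refine ⟨h1.smooth.congr_of_eventuallyEq h2, ?_⟩
    filter_upwards [h1.eventually_eq, h2.eventually_nhds] with y h3 h4 c hc
    rw [h3 c hc, chartLaplacian_congr hc h4]
  have hd := isDensity_curvature (fun x => ⟨U x, s x, hx x, hs x⟩) h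
  have hd' := isDensity_curvature (fun x => ⟨U x, s x, hx x, hs x⟩) h'
  have e1 := P.integral_chartLaplacian fun x => (hpot x).smooth
  rw [← P.integral_congr fun c x hc => (hpot x).eventually_eq.self_of_nhds c hc,
    P.integral_add (κ' := fun c y => (-1) * curvature h' S k c y) hd.continuousOn
      fun c => continuousOn_const.mul (hd'.continuousOn c),
    P.integral_const_mul] at e1
  linarith

/-- Independence of all choices: degrees of different subbundles may be compared using a single
metric on each bundle and a single partition of unity. -/
theorem degree_eq_integral {S : ∀ x, Submodule ℂ (V x)} {k : ℕ}
    (hS : IsHolomorphicSubbundle F S k) (h : HermitianMetric F V) (P : ChartPartition X) :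
    degree F S k = -(1 / (4 * Real.pi)) * P.integral (curvature h S k) := by
  have H := exists_isDegree hS h
  rw [degree, dif_pos H]
  obtain ⟨h', Q, e⟩ := H.choose_spec.exists_eq_integral
  rw [e, Q.integral_eq P (isDensity_curvature hS h'), P.integral_curvature_eq hS h' h]

/-- The empty Gram determinant is `1`, with logarithm `0`. If no degree exists, the default value in
`degree` is `0` as well, so nothing need be known about `S`. -/
theorem degree_zero (S : ∀ x, Submodule ℂ (V x)) : degree F S 0 = 0 := by
  rw [degree]
  split_ifs with H
  · obtain ⟨h, N, ρ, U, c, s, -, -, -, e⟩ := H.choose_spec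
    rw [e]
    have h1 : ∀ a z, Laplacian.laplacian
        (fun w : ℂ => h.logGram (s a) ((chartAt ℂ (c a)).symm w)) z = 0 := by
      intro a z
      have h2 : (fun w : ℂ => h.logGram (s a) ((chartAt ℂ (c a)).symm w)) = fun _ => (0 : ℝ) := by
        ext w
        simp [HermitianMetric.logGram]
      rw [h2]
      exact congrFun (InnerProductSpace.laplacian_const (E := ℂ) (c := (0 : ℝ))) z
    simp [h1]
  · rfl

variable (F V) in
-- The standard Hermitian products in local trivializations are averaged by a partition of unity;
-- positivity survives since some weight is positive at each point.
theorem nonempty_hermitianMetric [ContMDiffVectorBundle ω F V 𝓘(ℂ)] :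
    Nonempty (HermitianMetric F V) := by
  obtain ⟨N, j, ρ, hρ⟩ := exists_finite_partition (X := X)
    (fun x => (trivializationAt F V x).baseSet) (fun x => (trivializationAt F V x).open_baseSet)
    fun x => ⟨x, FiberBundle.mem_baseSet_trivializationAt' x⟩
  set n := finrank ℂ F
  let φ : F ≃L[ℂ] (Fin n → ℂ) := (finBasis ℂ F).equivFunL
  let T : Fin N → ∀ x, V x →ₗ[ℂ] (Fin n → ℂ) := fun a x =>
    φ.toLinearEquiv.toLinearMap ∘ₗ (trivializationAt F V (j a)).linearMapAt ℂ x
  refine ⟨⟨fun x => LinearMap.mk₂'ₛₗ (starRingEnd ℂ) (RingHom.id ℂ)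
    (fun v w => ∑ a, (ρ a x : ℂ) * ∑ i, starRingEnd ℂ (T a x v i) * T a x w i) ?_ ?_ ?_ ?_,
    ?_, ?_, ?_⟩⟩
  · intro v v' w
    simp only [map_add, Pi.add_apply, add_mul, Finset.sum_add_distrib, mul_add]
  · intro r v w
    simp only [map_smul, Pi.smul_apply, smul_eq_mul, map_mul, Finset.mul_sum]
    exact Finset.sum_congr rfl fun a _ => Finset.sum_congr rfl fun i _ => by ring
  · intro v v' w
    simp only [map_add, Pi.add_apply, Finset.sum_add_distrib, mul_add]
  · intro r v w
    simp only [map_smul, Pi.smul_apply, smul_eq_mul, Finset.mul_sum, RingHom.id_apply]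
    exact Finset.sum_congr rfl fun a _ => Finset.sum_congr rfl fun i _ => by ring
  · intro x v w
    simp only [LinearMap.mk₂'ₛₗ_apply, map_sum, map_mul, Complex.conj_ofReal, Complex.conj_conj]
    exact Finset.sum_congr rfl fun a _ => congrArg _ (Finset.sum_congr rfl fun i _ => mul_comm _ _)
  · intro x v hv
    simp only [LinearMap.mk₂'ₛₗ_apply]
    have h1 : ∀ a, ((ρ a x : ℂ) * ∑ i, starRingEnd ℂ (T a x v i) * T a x v i).re =
        ρ a x * ∑ i, ‖T a x v i‖ ^ 2 := by
      intro a
      rw [Complex.re_ofReal_mul, Complex.re_sum]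
      congr 1
      refine Finset.sum_congr rfl fun i _ => ?_
      rw [Complex.conj_mul', ← Complex.ofReal_pow, Complex.ofReal_re]
    rw [Complex.re_sum, Finset.sum_congr rfl fun a _ => h1 a]
    obtain ⟨a, ha⟩ : ∃ a, 0 < ρ a x := ρ.exists_pos_of_mem (mem_univ x)
    refine Finset.sum_pos' (fun a _ => mul_nonneg (ρ.nonneg a x)
      (Finset.sum_nonneg fun i _ => sq_nonneg _)) ⟨a, Finset.mem_univ a, mul_pos ha ?_⟩
    have hxa : x ∈ (trivializationAt F V (j a)).baseSet :=
      hρ a (subset_tsupport _ (Function.mem_support.2 ha.ne'))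
    have h2 : T a x v ≠ 0 := by
      intro h0
      apply hv
      have h3 : (trivializationAt F V (j a)).linearMapAt ℂ x v = 0 := by
        apply φ.toLinearEquiv.injective
        rw [map_zero]
        exact h0
      rw [Trivialization.linearMapAt_def_of_mem _ hxa] at h3
      exact (LinearEquiv.map_eq_zero_iff _).1 h3
    obtain ⟨i, hi⟩ := Function.ne_iff.1 h2
    refine Finset.sum_pos' (fun i _ => sq_nonneg _) ⟨i, Finset.mem_univ i, ?_⟩
    have := norm_pos_iff.2 hi
    positivity
  · intro U s t hU hs ht x hx
    apply ContMDiffAt.contMDiffWithinAt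
    simp only [LinearMap.mk₂'ₛₗ_apply]
    refine contMDiffAt_finsetSum fun a _ => ?_
    by_cases hxa : x ∈ tsupport (ρ a)
    · have hxb := hρ a hxa
      have key : ∀ u : ∀ x, V x, IsHolomorphicOn F U u →
          ContMDiffAt 𝓘(ℝ, ℂ) 𝓘(ℝ, Fin n → ℂ) ∞ (fun y => T a y (u y)) x := by
        intro u hu
        have h1 : ContMDiffAt 𝓘(ℂ) 𝓘(ℂ, F) ω
            (fun y => (trivializationAt F V (j a) ⟨y, u y⟩).2) x :=
          ((trivializationAt F V (j a)).contMDiffAt_section_iff hxb).1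
            (hu.contMDiffAt (hU.mem_nhds hx))
        have h2 : ContMDiffAt 𝓘(ℂ) 𝓘(ℂ, Fin n → ℂ) ω
            (fun y => φ (trivializationAt F V (j a) ⟨y, u y⟩).2) x :=
          ContMDiffAt.comp x φ.contDiff.contDiffAt.contMDiffAt h1
        refine (contMDiffAt_restrict_real h2).congr_of_eventuallyEq ?_
        filter_upwards [(trivializationAt F V (j a)).open_baseSet.mem_nhds hxb] with y hy
        simp only [T, LinearMap.comp_apply]
        rw [Trivialization.coe_linearMapAt_of_mem _ hy]
        rfl
      have h3 : ContMDiffAt 𝓘(ℝ, ℂ) 𝓘(ℝ, ℝ) ∞ (ρ a) x := (ρ a).contMDiff.contMDiffAt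
      have h4 : ContDiff ℝ ∞ fun q : ℝ × (Fin n → ℂ) × (Fin n → ℂ) =>
          (q.1 : ℂ) * ∑ i, starRingEnd ℂ (q.2.1 i) * q.2.2 i := by
        have h5 : ContDiff ℝ ∞ (fun r : ℝ => (r : ℂ)) := Complex.ofRealCLM.contDiff
        have h6 : ContDiff ℝ ∞ (fun r : ℂ => starRingEnd ℂ r) := Complex.conjCLE.contDiff
        refine (h5.comp contDiff_fst).mul (ContDiff.sum fun i _ => ?_)
        refine (h6.comp ?_).mul ?_ <;> fun_prop
      exact ContMDiffAt.comp x
        (g := fun q : ℝ × (Fin n → ℂ) × (Fin n → ℂ) =>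
          (q.1 : ℂ) * ∑ i, starRingEnd ℂ (q.2.1 i) * q.2.2 i)
        h4.contDiffAt.contMDiffAt (h3.prodMk_space ((key s hs).prodMk_space (key t ht)))
    · refine (contMDiffAt_const (c := (0 : ℂ))).congr_of_eventuallyEq ?_
      filter_upwards [(isClosed_tsupport (ρ a)).isOpen_compl.mem_nhds hxa] with y hy
      rw [image_eq_zero_of_notMem_tsupport hy]
      simp

end Degree

/-! ### Germs of holomorphic functions and the Smith normal form -/

section Germs

/-- The ring of germs at `z₀` of holomorphic functions of one variable. -/
def analyticGerms (z₀ : ℂ) : Subring (Filter.Germ (𝓝 z₀) ℂ) where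
  carrier := {g | ∃ f : ℂ → ℂ, AnalyticAt ℂ f z₀ ∧ (f : Filter.Germ (𝓝 z₀) ℂ) = g}
  mul_mem' := by
    rintro _ _ ⟨f, hf, rfl⟩ ⟨g, hg, rfl⟩
    exact ⟨f * g, hf.mul hg, rfl⟩
  one_mem' := ⟨1, analyticAt_const, rfl⟩
  add_mem' := by
    rintro _ _ ⟨f, hf, rfl⟩ ⟨g, hg, rfl⟩
    exact ⟨f + g, hf.add hg, rfl⟩
  zero_mem' := ⟨0, analyticAt_const, rfl⟩
  neg_mem' := by
    rintro _ ⟨f, hf, rfl⟩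
    exact ⟨-f, hf.neg, rfl⟩

/-- A germ at `z₀` of a holomorphic function of one variable. -/
def AnalyticGerm (z₀ : ℂ) : Type := analyticGerms z₀

namespace AnalyticGerm

instance (z₀ : ℂ) : CommRing (AnalyticGerm z₀) := inferInstanceAs (CommRing (analyticGerms z₀))

variable {z₀ : ℂ}

/-- The germ of a holomorphic function. -/
def mk (f : ℂ → ℂ) (hf : AnalyticAt ℂ f z₀) : AnalyticGerm z₀ := ⟨f, f, hf, rfl⟩

/-- A holomorphic function with the given germ. -/
def rep (g : AnalyticGerm z₀) : ℂ → ℂ := g.2.choose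

theorem analyticAt_rep (g : AnalyticGerm z₀) : AnalyticAt ℂ g.rep z₀ := g.2.choose_spec.1

theorem mk_rep (g : AnalyticGerm z₀) : mk g.rep g.analyticAt_rep = g :=
  Subtype.ext g.2.choose_spec.2

theorem mk_eq_mk {f g : ℂ → ℂ} {hf : AnalyticAt ℂ f z₀} {hg : AnalyticAt ℂ g z₀} :
    mk f hf = mk g hg ↔ f =ᶠ[𝓝 z₀] g :=
  Subtype.ext_iff.trans Filter.Germ.coe_eq

theorem rep_mk (f : ℂ → ℂ) (hf : AnalyticAt ℂ f z₀) : (mk f hf).rep =ᶠ[𝓝 z₀] f :=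
  mk_eq_mk.1 (mk_rep (mk f hf))

theorem rep_add (g h : AnalyticGerm z₀) : (g + h).rep =ᶠ[𝓝 z₀] g.rep + h.rep := by
  conv_lhs => rw [← mk_rep g, ← mk_rep h]
  exact rep_mk _ (g.analyticAt_rep.add h.analyticAt_rep)

theorem rep_mul (g h : AnalyticGerm z₀) : (g * h).rep =ᶠ[𝓝 z₀] g.rep * h.rep := by
  conv_lhs => rw [← mk_rep g, ← mk_rep h]
  exact rep_mk _ (g.analyticAt_rep.mul h.analyticAt_rep)

theorem rep_zero : (0 : AnalyticGerm z₀).rep =ᶠ[𝓝 z₀] 0 := rep_mk 0 analyticAt_const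

theorem rep_one : (1 : AnalyticGerm z₀).rep =ᶠ[𝓝 z₀] 1 := rep_mk 1 analyticAt_const

theorem rep_sum {ι : Type*} (s : Finset ι) (g : ι → AnalyticGerm z₀) :
    (∑ i ∈ s, g i).rep =ᶠ[𝓝 z₀] fun z => ∑ i ∈ s, (g i).rep z := by
  classical
  induction s using Finset.induction_on with
  | empty =>
    simp only [Finset.sum_empty]
    exact rep_zero
  | insert i s hi ih =>
    rw [Finset.sum_insert hi]
    filter_upwards [rep_add (g i) (∑ j ∈ s, g j), ih] with z h1 h2
    rw [h1, Pi.add_apply, h2, Finset.sum_insert hi]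

/-- The value of a germ at its base point. -/
def value : AnalyticGerm z₀ →+* ℂ where
  toFun g := g.rep z₀
  map_one' := rep_one.self_of_nhds
  map_mul' g h := (rep_mul g h).self_of_nhds
  map_zero' := rep_zero.self_of_nhds
  map_add' g h := (rep_add g h).self_of_nhds

theorem value_mk (f : ℂ → ℂ) (hf : AnalyticAt ℂ f z₀) : value (mk f hf) = f z₀ :=
  (rep_mk f hf).self_of_nhds

theorem eq_zero_iff {g : AnalyticGerm z₀} : g = 0 ↔ g.rep =ᶠ[𝓝 z₀] 0 := by
  conv_lhs => rw [← mk_rep g]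
  exact mk_eq_mk (hg := analyticAt_const)

theorem eventually_ne_zero {g : AnalyticGerm z₀} (hg : g ≠ 0) : ∀ᶠ z in 𝓝[≠] z₀, g.rep z ≠ 0 :=
  g.analyticAt_rep.eventually_eq_zero_or_eventually_ne_zero.resolve_left
    fun h => hg (eq_zero_iff.2 h)

theorem isUnit_iff {g : AnalyticGerm z₀} : IsUnit g ↔ value g ≠ 0 := by
  refine ⟨fun h => (h.map value).ne_zero, fun h => ?_⟩
  have h' : g.rep z₀ ≠ 0 := h
  have hm : g * mk g.rep⁻¹ (g.analyticAt_rep.inv h') =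
      mk g.rep g.analyticAt_rep * mk g.rep⁻¹ (g.analyticAt_rep.inv h') := by rw [mk_rep]
  refine IsUnit.of_mul_eq_one (mk g.rep⁻¹ (g.analyticAt_rep.inv h')) (hm.trans ?_)
  refine (mk_eq_mk (hf := g.analyticAt_rep.mul (g.analyticAt_rep.inv h'))
    (hg := analyticAt_const)).2 ?_
  filter_upwards [g.analyticAt_rep.continuousAt.eventually_ne h] with z hz
  exact mul_inv_cancel₀ hz

instance : Nontrivial (AnalyticGerm z₀) := value.domain_nontrivial

instance : NoZeroDivisors (AnalyticGerm z₀) where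
  eq_zero_or_eq_zero_of_mul_eq_zero {g h} hgh := by
    by_contra! hne
    have h1 := (eq_zero_iff.1 hgh).filter_mono (nhdsWithin_le_nhds (s := {z₀}ᶜ))
    have h2 := (rep_mul g h).filter_mono (nhdsWithin_le_nhds (s := {z₀}ᶜ))
    obtain ⟨z, h3, h4, h5, h6⟩ := (((eventually_ne_zero hne.1).and
      ((eventually_ne_zero hne.2).and (h1.and h2)))).exists
    rw [h6] at h5
    exact mul_ne_zero h3 h4 h5

instance : IsDomain (AnalyticGerm z₀) := NoZeroDivisors.to_isDomain _

/-- The germ of the coordinate function. -/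
def uniformizer (z₀ : ℂ) : AnalyticGerm z₀ := mk (fun z => z - z₀) (by fun_prop)

theorem value_uniformizer : value (uniformizer z₀) = 0 := by
  rw [uniformizer, value_mk, sub_self]

theorem mk_pow (n : ℕ) (f : ℂ → ℂ) (hf : AnalyticAt ℂ f z₀) : mk f hf ^ n = mk (f ^ n) (hf.pow n) :=
  rfl

theorem exists_eq_pow_mul {g : AnalyticGerm z₀} (hg : g ≠ 0) :
    ∃ (n : ℕ) (u : AnalyticGerm z₀), IsUnit u ∧ uniformizer z₀ ^ n * u = g := by
  obtain ⟨n, f, hf, hf0, hfg⟩ := g.analyticAt_rep.exists_eventuallyEq_pow_smul_nonzero_iff.2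
    fun h => hg (eq_zero_iff.2 h)
  refine ⟨n, mk f hf, isUnit_iff.2 (by rwa [value_mk]), ?_⟩
  conv_rhs => rw [← mk_rep g]
  rw [uniformizer, mk_pow]
  refine mk_eq_mk (hf := (AnalyticAt.pow (by fun_prop) n).mul hf).2 ?_
  filter_upwards [hfg] with z hz
  rw [hz]
  rfl

/-- Every non-zero non-unit is divisible by the uniformizer. Were it a product of two non-units,
cancelling one factor would give `1 = uniformizer * _`, which fails at the base point. -/
theorem irreducible_uniformizer : Irreducible (uniformizer z₀) := by
  have key : ∀ g : AnalyticGerm z₀, g ≠ 0 → ¬ IsUnit g → uniformizer z₀ ∣ g := by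
    intro g hg hu
    obtain ⟨n, u, hu', rfl⟩ := exists_eq_pow_mul hg
    rcases n with _ | n
    · rw [pow_zero, one_mul] at hu
      exact absurd hu' hu
    · exact Dvd.intro (uniformizer z₀ ^ n * u) (by ring)
  have h0 : uniformizer z₀ ≠ 0 := by
    rw [Ne, eq_zero_iff]
    intro h
    have h1 := ((rep_mk (z₀ := z₀) (fun z => z - z₀) (by fun_prop)).symm.trans h).filter_mono
      (nhdsWithin_le_nhds (s := {z₀}ᶜ))
    obtain ⟨z, hz, hz'⟩ := (h1.and self_mem_nhdsWithin).exists
    exact hz' (sub_eq_zero.1 hz)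
  refine ⟨fun h => isUnit_iff.1 h value_uniformizer, fun a b hab => ?_⟩
  by_contra! hne
  have ha0 : a ≠ 0 := by rintro rfl; exact h0 (by rw [hab, zero_mul])
  have hb0 : b ≠ 0 := by rintro rfl; exact h0 (by rw [hab, mul_zero])
  obtain ⟨a', rfl⟩ := key a ha0 hne.1
  obtain ⟨b', rfl⟩ := key b hb0 hne.2
  have h1 : uniformizer z₀ * 1 = uniformizer z₀ * (uniformizer z₀ * (a' * b')) := by
    rw [mul_one]
    nth_rw 1 [hab]
    ring
  have h2 := congrArg value (mul_left_cancel₀ h0 h1)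
  rw [map_one, map_mul, value_uniformizer, zero_mul] at h2
  exact one_ne_zero h2

/-- The order of vanishing makes the ring of germs a discrete valuation ring; being principal is
what the Smith normal form needs. -/
instance : IsPrincipalIdealRing (AnalyticGerm z₀) := by
  have : IsDiscreteValuationRing (AnalyticGerm z₀) :=
    IsDiscreteValuationRing.ofHasUnitMulPowIrreducibleFactorization
      ⟨uniformizer z₀, irreducible_uniformizer, fun {g} hg => by
        obtain ⟨n, u, hu, h⟩ := exists_eq_pow_mul hg
        exact ⟨n, hu.unit, h⟩⟩
  infer_instance

end AnalyticGerm

/-- The Smith normal form of the submodule `range T` gives adapted bases of it and of the target.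
Lifts of the basis of `range T`, together with a basis of `ker T`, form a basis of the source. -/
theorem exists_basis_smith {R : Type*} [CommRing R] [IsDomain R] [IsPrincipalIdealRing R] {p q : ℕ}
    (T : (Fin p → R) →ₗ[R] (Fin q → R)) :
    ∃ (k r : ℕ) (b : Basis (Fin k ⊕ Fin r) R (Fin p → R)) (b' : Basis (Fin q) R (Fin q → R))
      (f : Fin r ↪ Fin q) (a : Fin r → R), (∀ i, T (b (Sum.inl i)) = 0) ∧
      (∀ i, T (b (Sum.inr i)) = a i • b' (f i)) ∧ ∀ i, a i ≠ 0 := by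
  obtain ⟨r, snf⟩ := Submodule.smithNormalForm (Pi.basisFun R (Fin q)) (LinearMap.range T)
  obtain ⟨k, ⟨bk⟩⟩ := Submodule.nonempty_basis_of_pid (Pi.basisFun R (Fin p)) (LinearMap.ker T)
  choose e he using fun i => (snf.bN i).2
  set v : Fin k ⊕ Fin r → (Fin p → R) := Sum.elim (fun i => (bk i : Fin p → R)) e with hv
  have hli : LinearIndependent R v := by
    rw [Fintype.linearIndependent_iff]
    intro g hg
    rw [Fintype.sum_sum_type] at hg
    simp only [hv, Sum.elim_inl, Sum.elim_inr] at hg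
    have h1 : ∑ i, g (Sum.inr i) • snf.bN i = 0 := by
      have h2 := congrArg T hg
      simp only [map_add, map_sum, map_smul, he, LinearMap.map_coe_ker, smul_zero,
        Finset.sum_const_zero, zero_add, map_zero] at h2
      apply Subtype.ext
      simpa using h2
    have h3 := Fintype.linearIndependent_iff.1 snf.bN.linearIndependent _ h1
    simp only [h3, zero_smul, Finset.sum_const_zero, add_zero] at hg
    have h4 : ∑ i, g (Sum.inl i) • bk i = 0 := by
      apply Subtype.ext
      simpa using hg
    have h5 := Fintype.linearIndependent_iff.1 bk.linearIndependent _ h4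
    rintro (i | i)
    · exact h5 i
    · exact h3 i
  have hsp : ⊤ ≤ Submodule.span R (Set.range v) := by
    intro w _
    set c := snf.bN.repr ⟨T w, w, rfl⟩ with hc
    have h1 : T (∑ i, c i • e i) = T w := by
      have h2 := congrArg Subtype.val (snf.bN.sum_repr ⟨T w, w, rfl⟩)
      rw [Submodule.coe_sum] at h2
      simp only [map_sum, map_smul, he]
      exact h2
    have h3 : w - ∑ i, c i • e i ∈ LinearMap.ker T := by
      rw [LinearMap.mem_ker, map_sub, h1, sub_self]
    have h4 : ((⟨_, h3⟩ : LinearMap.ker T) : Fin p → R) ∈ Submodule.span R (Set.range v) := by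
      rw [← bk.sum_repr ⟨_, h3⟩, Submodule.coe_sum]
      exact Submodule.sum_mem _ fun i _ =>
        Submodule.smul_mem _ _ (Submodule.subset_span ⟨Sum.inl i, rfl⟩)
    have h5 : ∑ i, c i • e i ∈ Submodule.span R (Set.range v) :=
      Submodule.sum_mem _ fun i _ =>
        Submodule.smul_mem _ _ (Submodule.subset_span ⟨Sum.inr i, rfl⟩)
    simpa using Submodule.add_mem _ h4 h5
  refine ⟨k, r, Basis.mk hli hsp, snf.bM, snf.f, snf.a, fun i => ?_, fun i => ?_, fun i h0 => ?_⟩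
  · rw [Basis.mk_apply]
    exact (bk i).2
  · rw [Basis.mk_apply, ← snf.snf i]
    exact he i
  · have h1 := snf.snf i
    rw [h0, zero_smul] at h1
    exact snf.bN.ne_zero i (Subtype.ext h1)

/-- The images under the surjection `φ` span `ℂᵖ`, and there are exactly `p` of them. With `φ` the
evaluation of germs, a basis over the ring of germs becomes a basis at the base point. -/
theorem linearIndependent_map_basis {R : Type*} [CommRing R] [Nontrivial R] {p : ℕ} {ι : Type*}
    [Fintype ι] (b : Basis ι R (Fin p → R)) (φ : R →+* ℂ) (hφ : Function.Surjective φ) :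
    LinearIndependent ℂ fun i j => φ (b i j) := by
  refine linearIndependent_of_top_le_span_of_card_eq_finrank ?_ ?_
  · intro w _
    choose u hu using fun j => hφ (w j)
    have h1 : w = ∑ i, φ (b.repr u i) • fun j => φ (b i j) := by
      ext j
      rw [← hu j]
      nth_rw 1 [← b.sum_repr u]
      simp
    rw [h1]
    exact Submodule.sum_mem _ fun i _ => Submodule.smul_mem _ _ (Submodule.subset_span ⟨i, rfl⟩)
  · rw [← Module.finrank_eq_card_basis b]
    simp

/-- Identities over the ring of germs become identities near `z₀`. The frame vectors remain
independent at `z₀` itself, so any drop of rank there is carried by the coefficients `a`. -/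
theorem exists_analytic_smith {z₀ : ℂ} {p q : ℕ} (G : Fin q → Fin p → ℂ → ℂ)
    (hG : ∀ i j, AnalyticAt ℂ (G i j) z₀) :
    ∃ (k r : ℕ) (n : Fin k → Fin p → ℂ → ℂ) (e : Fin r → Fin p → ℂ → ℂ)
      (f : Fin r → Fin q → ℂ → ℂ) (a : Fin r → ℂ → ℂ), k + r = p ∧
      (∀ i j, AnalyticAt ℂ (n i j) z₀) ∧ (∀ i j, AnalyticAt ℂ (e i j) z₀) ∧
      (∀ i j, AnalyticAt ℂ (f i j) z₀) ∧ (∀ i, AnalyticAt ℂ (a i) z₀) ∧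
      LinearIndependent ℂ (Sum.elim (fun i j => n i j z₀) fun i j => e i j z₀) ∧
      LinearIndependent ℂ (fun i j => f i j z₀) ∧
      (∀ i l, ∀ᶠ z in 𝓝 z₀, ∑ j, G l j z * n i j z = 0) ∧
      (∀ i l, ∀ᶠ z in 𝓝 z₀, ∑ j, G l j z * e i j z = a i z * f i l z) ∧
      ∀ i, ∀ᶠ z in 𝓝[≠] z₀, a i z ≠ 0 := by
  let M : Matrix (Fin q) (Fin p) (AnalyticGerm z₀) :=
    Matrix.of fun i j => AnalyticGerm.mk (G i j) (hG i j)
  have hsurj : Function.Surjective (AnalyticGerm.value : AnalyticGerm z₀ →+* ℂ) := fun w =>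
    ⟨AnalyticGerm.mk (fun _ => w) analyticAt_const, AnalyticGerm.value_mk _ _⟩
  obtain ⟨k, r, b, b', f, a, h0, h1, ha⟩ := exists_basis_smith M.mulVecLin
  have key : ∀ (v : Fin p → AnalyticGerm z₀) (l : Fin q), ∀ᶠ z in 𝓝 z₀,
      (M.mulVec v l).rep z = ∑ j, G l j z * (v j).rep z := by
    intro v l
    have h2 : ∀ᶠ z in 𝓝 z₀, ∀ j, (M l j * v j).rep z = (M l j).rep z * (v j).rep z :=
      Filter.eventually_all.2 fun j => AnalyticGerm.rep_mul _ _
    have h3 : ∀ᶠ z in 𝓝 z₀, ∀ j, (M l j).rep z = G l j z :=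
      Filter.eventually_all.2 fun j => AnalyticGerm.rep_mk _ (hG l j)
    filter_upwards [AnalyticGerm.rep_sum Finset.univ fun j => M l j * v j, h2, h3] with z h4 h5 h6
    refine Eq.trans h4 (Finset.sum_congr rfl fun j _ => ?_)
    rw [h5, h6]
  refine ⟨k, r, fun i j => (b (Sum.inl i) j).rep, fun i j => (b (Sum.inr i) j).rep,
    fun i j => (b' (f i) j).rep, fun i => (a i).rep, ?_, fun i j => AnalyticGerm.analyticAt_rep _,
    fun i j => AnalyticGerm.analyticAt_rep _, fun i j => AnalyticGerm.analyticAt_rep _,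
    fun i => AnalyticGerm.analyticAt_rep _, ?_, ?_, ?_, ?_,
    fun i => AnalyticGerm.eventually_ne_zero (ha i)⟩
  · have := Module.finrank_eq_card_basis b
    simpa using this.symm
  · have h2 := linearIndependent_map_basis b AnalyticGerm.value hsurj
    convert h2 using 1
    ext (i | i) j <;> rfl
  · exact (linearIndependent_map_basis b' AnalyticGerm.value hsurj).comp f f.injective
  · intro i l
    have h2 := congrFun (h0 i) l
    filter_upwards [key (b (Sum.inl i)) l, AnalyticGerm.rep_zero (z₀ := z₀)] with z h3 h4
    rw [← h3]
    refine Eq.trans (congrFun (congrArg AnalyticGerm.rep h2) z) h4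
  · intro i l
    have h2 := congrFun (h1 i) l
    filter_upwards [key (b (Sum.inr i)) l, AnalyticGerm.rep_mul (a i) (b' (f i) l)] with z h3 h4
    rw [← h3]
    exact Eq.trans (congrFun (congrArg AnalyticGerm.rep h2) z) h4

end Germs

/-! ### Adapted local frames of a twisted bundle map -/

section SmithFrames

variable {X : Type*} [TopologicalSpace X] [ChartedSpace ℂ X]
variable {F₁ : Type*} [NormedAddCommGroup F₁] [NormedSpace ℂ F₁]
  {V : X → Type*} [∀ x, AddCommGroup (V x)] [∀ x, Module ℂ (V x)]
  [∀ x, TopologicalSpace (V x)] [TopologicalSpace (TotalSpace F₁ V)] [FiberBundle F₁ V]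
variable {F₂ : Type*} [NormedAddCommGroup F₂] [NormedSpace ℂ F₂]
  {W : X → Type*} [∀ x, AddCommGroup (W x)] [∀ x, Module ℂ (W x)]
  [∀ x, TopologicalSpace (W x)] [TopologicalSpace (TotalSpace F₂ W)] [FiberBundle F₂ W]
variable {F₃ : Type*} [NormedAddCommGroup F₃] [NormedSpace ℂ F₃]
  {L : X → Type*} [∀ x, AddCommGroup (L x)] [∀ x, Module ℂ (L x)]
  [∀ x, TopologicalSpace (L x)] [TopologicalSpace (TotalSpace F₃ L)] [FiberBundle F₃ L]

variable (F₁ F₂ F₃) in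
/-- Local holomorphic frames `(n, e)` of `V` and `l` of `L`, and a part `f` of a local holomorphic
frame of `W`, in which the bundle map `φ : V → W ⊗ L` is diagonal, with coefficients `a` that do not
vanish outside of `x`. -/
structure IsSmithFrame (φ : ∀ x, V x →ₗ[ℂ] W x ⊗[ℂ] L x) (x : X) {k r : ℕ} (U : Set X)
    (n : Fin k → ∀ x, V x) (e : Fin r → ∀ x, V x) (f : Fin r → ∀ x, W x) (l : ∀ x, L x)
    (a : Fin r → X → ℂ) : Prop where
  isOpen : IsOpen U
  mem : x ∈ U
  holomorphic_ker : ∀ i, IsHolomorphicOn F₁ U (n i)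
  holomorphic_compl : ∀ i, IsHolomorphicOn F₁ U (e i)
  holomorphic_image : ∀ i, IsHolomorphicOn F₂ U (f i)
  holomorphic_line : IsHolomorphicOn F₃ U l
  holomorphic_coeff : ∀ i, ContMDiffAt 𝓘(ℂ) 𝓘(ℂ) ω (a i) x
  linearIndependent : ∀ y ∈ U,
    LinearIndependent ℂ (Sum.elim (fun i => n i y) fun i => e i y)
  linearIndependent_image : ∀ y ∈ U, LinearIndependent ℂ fun i => f i y
  line_ne_zero : ∀ y ∈ U, l y ≠ 0
  map_ker : ∀ y ∈ U, ∀ i, φ y (n i y) = 0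
  map_compl : ∀ y ∈ U, ∀ i, φ y (e i y) = a i y • (f i y ⊗ₜ[ℂ] l y)
  coeff_ne_zero : ∀ y ∈ U, y ≠ x → ∀ i, a i y ≠ 0

variable [IsManifold 𝓘(ℂ) ω X]
variable [VectorBundle ℂ F₁ V] [ContMDiffVectorBundle ω F₁ V 𝓘(ℂ)]

theorem isHolomorphicOn_symm (e : Trivialization F₁ (TotalSpace.proj : TotalSpace F₁ V → X))
    [MemTrivializationAtlas e] {U : Set X} (hU : IsOpen U) (hUe : U ⊆ e.baseSet) {u : X → F₁}
    (hu : ∀ y ∈ U, ContMDiffAt 𝓘(ℂ) 𝓘(ℂ, F₁) ω u y) :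
    IsHolomorphicOn F₁ U fun y => e.symmₗ ℂ y (u y) := by
  refine (e.contMDiffOn_section_iff hU hUe).2 fun y hy => ?_
  refine ((hu y hy).congr_of_eventuallyEq ?_).contMDiffWithinAt
  filter_upwards [hU.mem_nhds hy] with z hz
  have h := e.linearMapAt_symmₗ (R := ℂ) (hUe hz) (u z)
  rwa [Trivialization.coe_linearMapAt_of_mem _ (hUe hz)] at h

end SmithFrames

section SmithFramesExist

variable {X : Type*} [TopologicalSpace X] [ChartedSpace ℂ X] [IsManifold 𝓘(ℂ) ω X]
variable {p q : ℕ}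
  {V : X → Type*} [∀ x, AddCommGroup (V x)] [∀ x, Module ℂ (V x)]
  [∀ x, TopologicalSpace (V x)] [TopologicalSpace (TotalSpace (Fin p → ℂ) V)]
  [FiberBundle (Fin p → ℂ) V] [VectorBundle ℂ (Fin p → ℂ) V]
  [ContMDiffVectorBundle ω (Fin p → ℂ) V 𝓘(ℂ)]
  {W : X → Type*} [∀ x, AddCommGroup (W x)] [∀ x, Module ℂ (W x)]
  [∀ x, TopologicalSpace (W x)] [TopologicalSpace (TotalSpace (Fin q → ℂ) W)]
  [FiberBundle (Fin q → ℂ) W] [VectorBundle ℂ (Fin q → ℂ) W]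
  [ContMDiffVectorBundle ω (Fin q → ℂ) W 𝓘(ℂ)]
  {L : X → Type*} [∀ x, AddCommGroup (L x)] [∀ x, Module ℂ (L x)]
  [∀ x, TopologicalSpace (L x)] [TopologicalSpace (TotalSpace ℂ L)]
  [FiberBundle ℂ L] [VectorBundle ℂ ℂ L] [ContMDiffVectorBundle ω ℂ L 𝓘(ℂ)]

/-- In local trivializations `φ` is a matrix of holomorphic functions, to which the analytic Smith
form applies. Finitely many conditions then hold near `x`, all of them on one small enough `U`. -/
theorem exists_isSmithFrame {φ : ∀ x, V x →ₗ[ℂ] W x ⊗[ℂ] L x}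
    (hφ : IsHolomorphicTwistedMap (Fin p → ℂ) (Fin q → ℂ) ℂ φ) (x : X) :
    ∃ (k r : ℕ), k + r = p ∧ ∃ (U : Set X) (n : Fin k → ∀ x, V x) (e : Fin r → ∀ x, V x)
      (f : Fin r → ∀ x, W x) (l : ∀ x, L x) (a : Fin r → X → ℂ),
      IsSmithFrame (Fin p → ℂ) (Fin q → ℂ) ℂ φ x U n e f l a := by
  set eV := trivializationAt (Fin p → ℂ) V x with heV
  set eW := trivializationAt (Fin q → ℂ) W x with heW
  set eL := trivializationAt ℂ L x with heL
  set U₀ : Set X := eV.baseSet ∩ (eW.baseSet ∩ eL.baseSet) with hU₀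
  have hU₀o : IsOpen U₀ := eV.open_baseSet.inter (eW.open_baseSet.inter eL.open_baseSet)
  have hxU₀ : x ∈ U₀ := ⟨FiberBundle.mem_baseSet_trivializationAt' x,
    FiberBundle.mem_baseSet_trivializationAt' x, FiberBundle.mem_baseSet_trivializationAt' x⟩
  have hVinj : ∀ y ∈ U₀, Function.Injective (eV.symmₗ ℂ y) := fun y hy u v huv => by
    rw [← eV.linearMapAt_symmₗ (R := ℂ) hy.1 u, huv, eV.linearMapAt_symmₗ (R := ℂ) hy.1 v]
  have hWinj : ∀ y ∈ U₀, Function.Injective (eW.symmₗ ℂ y) := fun y hy u v huv => by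
    rw [← eW.linearMapAt_symmₗ (R := ℂ) hy.2.1 u, huv, eW.linearMapAt_symmₗ (R := ℂ) hy.2.1 v]
  set l : ∀ y, L y := fun y => eL.symmₗ ℂ y 1 with hl
  have hl0 : ∀ y ∈ U₀, l y ≠ 0 := fun y hy h0 => by
    have h1 := eL.linearMapAt_symmₗ (R := ℂ) hy.2.2 1
    rw [hl] at h0
    simp only at h0
    rw [h0, map_zero] at h1
    exact zero_ne_one h1
  have hlh : IsHolomorphicOn ℂ U₀ l :=
    isHolomorphicOn_symm eL hU₀o (fun y hy => hy.2.2) fun y _ => contMDiffAt_const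
  have hvh : ∀ j : Fin p, IsHolomorphicOn (Fin p → ℂ) U₀
      fun y => eV.symmₗ ℂ y (Pi.single j 1) := fun j =>
    isHolomorphicOn_symm eV hU₀o (fun y hy => hy.1) fun y _ => contMDiffAt_const
  choose t ht htl using fun j : Fin p => hφ U₀ _ l hU₀o (hvh j) hlh hl0
  set z₀ := chartAt ℂ x x with hz₀
  set G : Fin q → Fin p → ℂ → ℂ := fun i j z =>
    (eW ⟨(chartAt ℂ x).symm z, t j ((chartAt ℂ x).symm z)⟩).2 i with hG
  have hGan : ∀ i j, AnalyticAt ℂ (G i j) z₀ := by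
    intro i j
    have h1 := (ht j).contMDiffAt_trivialization hU₀o hxU₀
    have h2 := analyticAt_comp_chart_symm h1 (mem_chart_source ℂ x)
    exact (analyticAt_pi_iff.1 h2) i
  obtain ⟨k, r, n, e, f, a, hkr, hn, he, hf, ha, hli, hlif, hmn, hme, ha0⟩ :=
    exists_analytic_smith G hGan
  have hsrc : ∀ᶠ y in 𝓝 x, y ∈ (chartAt ℂ x).source :=
    (chartAt ℂ x).open_source.mem_nhds (mem_chart_source ℂ x)
  have hch : Filter.Tendsto (chartAt ℂ x) (𝓝 x) (𝓝 z₀) :=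
    (chartAt ℂ x).continuousAt (mem_chart_source ℂ x)
  have hpi : ∀ {m : ℕ} {g : Fin m → ℂ → ℂ}, (∀ j, AnalyticAt ℂ (g j) z₀) →
      ∀ᶠ y in 𝓝 x, ContMDiffAt 𝓘(ℂ) 𝓘(ℂ, Fin m → ℂ) ω (fun y j => g j (chartAt ℂ x y)) y := by
    intro m g hg
    refine eventually_contMDiffAt_omega ?_
    exact contMDiffAt_comp_chart (f := fun z j => g j z) (analyticAt_pi_iff.2 hg)
      (mem_chart_source ℂ x)
  have hliz : ∀ᶠ z in 𝓝 z₀,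
      LinearIndependent ℂ (Sum.elim (fun i j => n i j z) fun i j => e i j z) := by
    have h1 : ContinuousAt (fun z => (Sum.elim (fun i j => n i j z) fun i j => e i j z :
        Fin k ⊕ Fin r → Fin p → ℂ)) z₀ := by
      refine continuousAt_pi.2 fun i => continuousAt_pi.2 fun j => ?_
      rcases i with i | i
      · exact (hn i j).continuousAt
      · exact (he i j).continuousAt
    exact h1.eventually (isOpen_setOfPred_linearIndependent.mem_nhds hli)
  have hlifz : ∀ᶠ z in 𝓝 z₀, LinearIndependent ℂ (fun i j => f i j z) := by
    have h1 : ContinuousAt (fun z => ((fun i j => f i j z) : Fin r → Fin q → ℂ)) z₀ :=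
      continuousAt_pi.2 fun i => continuousAt_pi.2 fun j => (hf i j).continuousAt
    exact h1.eventually (isOpen_setOfPred_linearIndependent.mem_nhds hlif)
  have ha0' : ∀ᶠ z in 𝓝 z₀, z ≠ z₀ → ∀ i, a i z ≠ 0 :=
    eventually_nhdsWithin_iff.1 (Filter.eventually_all.2 ha0)
  have hall := (hch.eventually hliz).and ((hch.eventually hlifz).and ((hch.eventually ha0').and
    ((hch.eventually (Filter.eventually_all.2 fun i => Filter.eventually_all.2 (hmn i))).and
    ((hch.eventually (Filter.eventually_all.2 fun i => Filter.eventually_all.2 (hme i))).and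
    ((Filter.eventually_all.2 fun i => hpi (hn i)).and
    ((Filter.eventually_all.2 fun i => hpi (he i)).and
    ((Filter.eventually_all.2 fun i => hpi (hf i)).and
    (hsrc.and (hU₀o.mem_nhds hxU₀)))))))))
  obtain ⟨U, hU, hUo, hxU⟩ := eventually_nhds_iff.1 hall
  have hUU₀ : U ⊆ U₀ := fun y hy => (hU y hy).2.2.2.2.2.2.2.2.2
  have happly : ∀ y ∈ U, ∀ v : Fin p → ℂ, φ y (eV.symmₗ ℂ y v) =
      eW.symmₗ ℂ y (fun i => ∑ j, G i j (chartAt ℂ x y) * v j) ⊗ₜ[ℂ] l y := by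
    intro y hy v
    have h1 : v = ∑ j, v j • (Pi.single j 1 : Fin p → ℂ) := by
      ext i
      simp [Pi.single_apply]
    have h2 : ∀ j, t j y = eW.symmₗ ℂ y (fun i => G i j (chartAt ℂ x y)) := by
      intro j
      have h3 := eW.symmₗ_linearMapAt (R := ℂ) (hUU₀ hy).2.1 (t j y)
      rw [Trivialization.coe_linearMapAt_of_mem _ (hUU₀ hy).2.1] at h3
      -- The fibre containing `t j y'` depends on `y'`, so the equality of base points is used by
      -- substitution.
      have h5 : ∀ y', y' = y → (eW ⟨y', t j y'⟩).2 = (eW ⟨y, t j y⟩).2 := by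
        rintro _ rfl
        rfl
      rw [← h3]
      exact congrArg _ (h5 _ ((chartAt ℂ x).left_inv (hU y hy).2.2.2.2.2.2.2.2.1)).symm
    have h4 : (fun i => ∑ j, G i j (chartAt ℂ x y) * v j) =
        ∑ j, v j • fun i => G i j (chartAt ℂ x y) := by
      ext i
      simp [mul_comm]
    rw [h4]
    conv_lhs => rw [h1]
    simp only [map_sum, map_smul, TensorProduct.sum_tmul]
    refine Finset.sum_congr rfl fun j _ => ?_
    rw [htl j y (hUU₀ hy), ← h2, TensorProduct.smul_tmul']
  refine ⟨k, r, hkr, U, fun i y => eV.symmₗ ℂ y fun j => n i j (chartAt ℂ x y),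
    fun i y => eV.symmₗ ℂ y fun j => e i j (chartAt ℂ x y),
    fun i y => eW.symmₗ ℂ y fun j => f i j (chartAt ℂ x y), l,
    fun i y => a i (chartAt ℂ x y), ?_⟩
  refine
    { isOpen := hUo
      mem := hxU
      holomorphic_ker := fun i => isHolomorphicOn_symm eV hUo (fun y hy => (hUU₀ hy).1)
        fun y hy => (hU y hy).2.2.2.2.2.1 i
      holomorphic_compl := fun i => isHolomorphicOn_symm eV hUo (fun y hy => (hUU₀ hy).1)
        fun y hy => (hU y hy).2.2.2.2.2.2.1 i
      holomorphic_image := fun i => isHolomorphicOn_symm eW hUo (fun y hy => (hUU₀ hy).2.1)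
        fun y hy => (hU y hy).2.2.2.2.2.2.2.1 i
      holomorphic_line := hlh.mono hUU₀
      holomorphic_coeff := fun i => contMDiffAt_comp_chart (ha i) (mem_chart_source ℂ x)
      linearIndependent := fun y hy => ?_
      linearIndependent_image := fun y hy => ?_
      line_ne_zero := fun y hy => hl0 y (hUU₀ hy)
      map_ker := fun y hy i => ?_
      map_compl := fun y hy i => ?_
      coeff_ne_zero := fun y hy hyx i => (hU y hy).2.2.1 (fun h => hyx ?_) i }
  · have h1 := (hU y hy).1.map' (eV.symmₗ ℂ y) (LinearMap.ker_eq_bot.2 (hVinj y (hUU₀ hy)))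
    rwa [Sum.comp_elim] at h1
  · exact (hU y hy).2.1.map' (eW.symmₗ ℂ y) (LinearMap.ker_eq_bot.2 (hWinj y (hUU₀ hy)))
  · rw [happly y hy]
    have h1 : (fun l => ∑ j, G l j (chartAt ℂ x y) * n i j (chartAt ℂ x y)) = 0 :=
      funext fun l => (hU y hy).2.2.2.1 i l
    rw [h1, map_zero, TensorProduct.zero_tmul]
  · rw [happly y hy]
    have h1 : (fun l => ∑ j, G l j (chartAt ℂ x y) * e i j (chartAt ℂ x y)) =
        a i (chartAt ℂ x y) • fun l => f i l (chartAt ℂ x y) :=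
      funext fun l => (hU y hy).2.2.2.2.1 i l
    rw [h1, map_smul, TensorProduct.smul_tmul']
  · exact (chartAt ℂ x).injOn (hU y hy).2.2.2.2.2.2.2.2.1 (mem_chart_source ℂ x) h

end SmithFramesExist

/-! ### Saturated kernel and image of a twisted bundle map -/

section TensorLine

variable {M L : Type*} [AddCommGroup M] [Module ℂ M] [AddCommGroup L] [Module ℂ L]

theorem tmul_left_injective {l : L} (hl : l ≠ 0) :
    Function.Injective fun w : M => w ⊗ₜ[ℂ] l := by
  obtain ⟨g, hg⟩ := Projective.exists_dual_eq_one ℂ hl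
  intro w w' h
  have h1 := congrArg ((TensorProduct.rid ℂ M) ∘ (g.lTensor M)) h
  simpa [hg] using h1

end TensorLine

/-! ### Constant rank, and agreement of the local kernels and images. -/

section ConstantRank

variable {X : Type*} [TopologicalSpace X] [ChartedSpace ℂ X]

theorem neBot_nhdsNE (x : X) : (𝓝[≠] x).NeBot := by
  rw [Filter.neBot_iff, Ne, ← isOpen_singleton_iff_punctured_nhds]
  intro h
  have h1 := (chartAt ℂ x).isOpen_image_of_subset_source h
    (singleton_subset_iff.2 (mem_chart_source ℂ x))
  rw [image_singleton] at h1
  exact not_isOpen_singleton _ h1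

variable {p q : ℕ}
  {V : X → Type*} [∀ x, AddCommGroup (V x)] [∀ x, Module ℂ (V x)]
  [∀ x, TopologicalSpace (V x)] [TopologicalSpace (TotalSpace (Fin p → ℂ) V)]
  [FiberBundle (Fin p → ℂ) V] [VectorBundle ℂ (Fin p → ℂ) V]
  {W : X → Type*} [∀ x, AddCommGroup (W x)] [∀ x, Module ℂ (W x)]
  [∀ x, TopologicalSpace (W x)] [TopologicalSpace (TotalSpace (Fin q → ℂ) W)]
  [FiberBundle (Fin q → ℂ) W] [VectorBundle ℂ (Fin q → ℂ) W]
  {L : X → Type*} [∀ x, AddCommGroup (L x)] [∀ x, Module ℂ (L x)]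
  [∀ x, TopologicalSpace (L x)] [TopologicalSpace (TotalSpace ℂ L)]
  [FiberBundle ℂ L] [VectorBundle ℂ ℂ L]

theorem finrank_fiber {F : Type*} [NormedAddCommGroup F] [NormedSpace ℂ F]
    {V : X → Type*} [∀ x, AddCommGroup (V x)] [∀ x, Module ℂ (V x)]
    [∀ x, TopologicalSpace (V x)] [TopologicalSpace (TotalSpace F V)]
    [FiberBundle F V] [VectorBundle ℂ F V] (x : X) : finrank ℂ (V x) = finrank ℂ F :=
  ((trivializationAt F V x).linearEquivAt ℂ x
    (FiberBundle.mem_baseSet_trivializationAt' x)).finrank_eq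

theorem finiteDimensional_fiber (F : Type*) [NormedAddCommGroup F] [NormedSpace ℂ F]
    [FiniteDimensional ℂ F]
    {V : X → Type*} [∀ x, AddCommGroup (V x)] [∀ x, Module ℂ (V x)]
    [∀ x, TopologicalSpace (V x)] [TopologicalSpace (TotalSpace F V)]
    [FiberBundle F V] [VectorBundle ℂ F V] (x : X) : FiniteDimensional ℂ (V x) :=
  ((trivializationAt F V x).linearEquivAt ℂ x
    (FiberBundle.mem_baseSet_trivializationAt' x)).symm.finiteDimensional

namespace IsSmithFrame

variable {φ : ∀ x, V x →ₗ[ℂ] W x ⊗[ℂ] L x} {x : X} {k r : ℕ} {U : Set X}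
  {n : Fin k → ∀ x, V x} {e : Fin r → ∀ x, V x} {f : Fin r → ∀ x, W x} {l : ∀ x, L x}
  {a : Fin r → X → ℂ}

theorem span_eq_top (h : IsSmithFrame (Fin p → ℂ) (Fin q → ℂ) ℂ φ x U n e f l a)
    (hkr : k + r = p) {y : X} (hy : y ∈ U) :
    Submodule.span ℂ (range (Sum.elim (fun i => n i y) fun i => e i y)) = ⊤ := by
  have := finiteDimensional_fiber (Fin p → ℂ) (V := V) y
  refine (h.linearIndependent y hy).span_eq_top_of_card_eq_finrank' ?_
  rw [finrank_fiber (F := Fin p → ℂ)]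
  simp [hkr]

theorem exists_eq_sum (h : IsSmithFrame (Fin p → ℂ) (Fin q → ℂ) ℂ φ x U n e f l a)
    (hkr : k + r = p) {y : X} (hy : y ∈ U) (v : V y) :
    ∃ (c : Fin k → ℂ) (d : Fin r → ℂ), v = ∑ i, c i • n i y + ∑ i, d i • e i y := by
  have h1 : v ∈ Submodule.span ℂ (range (Sum.elim (fun i => n i y) fun i => e i y)) := by
    rw [h.span_eq_top hkr hy]
    trivial
  obtain ⟨c, rfl⟩ := (Submodule.mem_span_range_iff_exists_fun ℂ).1 h1
  exact ⟨fun i => c (Sum.inl i), fun i => c (Sum.inr i), by simp [Fintype.sum_sum_type]⟩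

theorem map_sum (h : IsSmithFrame (Fin p → ℂ) (Fin q → ℂ) ℂ φ x U n e f l a)
    {y : X} (hy : y ∈ U) (c : Fin k → ℂ) (d : Fin r → ℂ) :
    φ y (∑ i, c i • n i y + ∑ i, d i • e i y) = (∑ i, (d i * a i y) • f i y) ⊗ₜ[ℂ] l y := by
  simp only [map_add, _root_.map_sum, map_smul, h.map_ker y hy, h.map_compl y hy, smul_zero,
    Finset.sum_const_zero, zero_add, TensorProduct.sum_tmul, smul_smul]
  rfl

theorem span_le_ker (h : IsSmithFrame (Fin p → ℂ) (Fin q → ℂ) ℂ φ x U n e f l a)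
    {y : X} (hy : y ∈ U) : Submodule.span ℂ (range fun i => n i y) ≤ LinearMap.ker (φ y) := by
  rw [Submodule.span_le]
  rintro _ ⟨i, rfl⟩
  exact h.map_ker y hy i

/-- Away from the centre the coefficients `a` are invertible, so the vectors `e` contribute nothing
to the kernel. At `x` the kernel may be larger than the span. -/
theorem span_eq_ker (h : IsSmithFrame (Fin p → ℂ) (Fin q → ℂ) ℂ φ x U n e f l a)
    (hkr : k + r = p) {y : X} (hy : y ∈ U) (hyx : y ≠ x) :
    Submodule.span ℂ (range fun i => n i y) = LinearMap.ker (φ y) := by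
  refine le_antisymm (h.span_le_ker hy) fun v hv => ?_
  obtain ⟨c, d, rfl⟩ := h.exists_eq_sum hkr hy v
  rw [LinearMap.mem_ker, h.map_sum hy] at hv
  have h1 : ∑ i, (d i * a i y) • f i y = 0 :=
    tmul_left_injective (h.line_ne_zero y hy) (by simpa using hv)
  have h2 := Fintype.linearIndependent_iff.1 (h.linearIndependent_image y hy) _ h1
  have h3 : ∀ i, d i = 0 := fun i =>
    (mul_eq_zero.1 (h2 i)).resolve_right (h.coeff_ne_zero y hy hyx i)
  simp only [h3, zero_smul, Finset.sum_const_zero, add_zero]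
  exact Submodule.sum_mem _ fun i _ => Submodule.smul_mem _ _ (Submodule.subset_span ⟨i, rfl⟩)

theorem exists_map_eq (h : IsSmithFrame (Fin p → ℂ) (Fin q → ℂ) ℂ φ x U n e f l a)
    (hkr : k + r = p) {y : X} (hy : y ∈ U) (v : V y) :
    ∃ w ∈ Submodule.span ℂ (range fun i => f i y), φ y v = w ⊗ₜ[ℂ] l y := by
  obtain ⟨c, d, rfl⟩ := h.exists_eq_sum hkr hy v
  exact ⟨_, Submodule.sum_mem _ fun i _ => Submodule.smul_mem _ _
    (Submodule.subset_span ⟨i, rfl⟩), h.map_sum hy c d⟩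

theorem exists_eq_smul (h : IsSmithFrame (Fin p → ℂ) (Fin q → ℂ) ℂ φ x U n e f l a)
    {y : X} (hy : y ∈ U) (l' : L y) : ∃ c : ℂ, l' = c • l y := by
  have h1 : finrank ℂ (L y) = 1 := by rw [finrank_fiber (F := ℂ), finrank_self]
  obtain ⟨c, hc⟩ := (finrank_eq_one_iff_of_nonzero' _ (h.line_ne_zero y hy)).1 h1 l'
  exact ⟨c, hc.symm⟩

theorem finrank_span_ker (h : IsSmithFrame (Fin p → ℂ) (Fin q → ℂ) ℂ φ x U n e f l a)
    {y : X} (hy : y ∈ U) : finrank ℂ (Submodule.span ℂ (range fun i => n i y)) = k := by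
  have h1 : LinearIndependent ℂ fun i => n i y :=
    (h.linearIndependent y hy).comp Sum.inl Sum.inl_injective
  simpa using finrank_span_eq_card h1

theorem finrank_span_image (h : IsSmithFrame (Fin p → ℂ) (Fin q → ℂ) ℂ φ x U n e f l a)
    {y : X} (hy : y ∈ U) : finrank ℂ (Submodule.span ℂ (range fun i => f i y)) = r := by
  simpa using finrank_span_eq_card (h.linearIndependent_image y hy)

/-- Near `y` there is a point different from both centres `x` and `y`; there each of the two spans
is the kernel of `φ`. -/
theorem rank_eq [T1Space X] (h : IsSmithFrame (Fin p → ℂ) (Fin q → ℂ) ℂ φ x U n e f l a)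
    (hkr : k + r = p) {y : X} (hy : y ∈ U) {k' r' : ℕ} {U' : Set X}
    {n' : Fin k' → ∀ x, V x} {e' : Fin r' → ∀ x, V x} {f' : Fin r' → ∀ x, W x} {l' : ∀ x, L x}
    {a' : Fin r' → X → ℂ} (h' : IsSmithFrame (Fin p → ℂ) (Fin q → ℂ) ℂ φ y U' n' e' f' l' a')
    (hkr' : k' + r' = p) : k = k' := by
  have hx : ∀ᶠ z in 𝓝[≠] y, z ≠ x := by
    by_cases hxy : y = x
    · subst hxy
      exact eventually_mem_nhdsWithin
    · exact eventually_nhdsWithin_of_eventually_nhds (isOpen_ne.mem_nhds hxy)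
  have := neBot_nhdsNE y
  obtain ⟨z, hzx, hzU, hzU', hzy⟩ := (hx.and ((eventually_nhdsWithin_of_eventually_nhds
    (h.isOpen.mem_nhds hy)).and ((eventually_nhdsWithin_of_eventually_nhds
    (h'.isOpen.mem_nhds h'.mem)).and eventually_mem_nhdsWithin))).exists
  rw [← h.finrank_span_ker hzU, ← h'.finrank_span_ker hzU', h.span_eq_ker hkr hzU hzx,
    h'.span_eq_ker hkr' hzU' hzy]

/-- Off the first centre the first span is the whole kernel, so it contains the second, and the
dimensions agree. -/
theorem span_ker_eq (h : IsSmithFrame (Fin p → ℂ) (Fin q → ℂ) ℂ φ x U n e f l a)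
    (hkr : k + r = p) {y : X} (hy : y ∈ U) (hyx : y ≠ x) {U' : Set X}
    {n' : Fin k → ∀ x, V x} {e' : Fin r → ∀ x, V x} {f' : Fin r → ∀ x, W x} {l' : ∀ x, L x}
    {a' : Fin r → X → ℂ} (h' : IsSmithFrame (Fin p → ℂ) (Fin q → ℂ) ℂ φ y U' n' e' f' l' a') :
    Submodule.span ℂ (range fun i => n i y) = Submodule.span ℂ (range fun i => n' i y) := by
  have := finiteDimensional_fiber (Fin p → ℂ) (V := V) y
  refine (Submodule.eq_of_le_of_finrank_eq ?_ ?_).symm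
  · rw [h.span_eq_ker hkr hy hyx]
    exact h'.span_le_ker h'.mem
  · rw [h.finrank_span_ker hy, h'.finrank_span_ker h'.mem]

/-- Off the first centre, `f i ⊗ l` is a multiple of `φ (e i)`, which by the second frame lies in
`span f' ⊗ l'`. Equality follows by dimension. -/
theorem span_image_eq (h : IsSmithFrame (Fin p → ℂ) (Fin q → ℂ) ℂ φ x U n e f l a)
    (hkr : k + r = p) {y : X} (hy : y ∈ U) (hyx : y ≠ x) {U' : Set X}
    {n' : Fin k → ∀ x, V x} {e' : Fin r → ∀ x, V x} {f' : Fin r → ∀ x, W x} {l' : ∀ x, L x}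
    {a' : Fin r → X → ℂ} (h' : IsSmithFrame (Fin p → ℂ) (Fin q → ℂ) ℂ φ y U' n' e' f' l' a') :
    Submodule.span ℂ (range fun i => f i y) = Submodule.span ℂ (range fun i => f' i y) := by
  have := finiteDimensional_fiber (Fin q → ℂ) (V := W) y
  refine Submodule.eq_of_le_of_finrank_eq ?_ ?_
  · rw [Submodule.span_le]
    rintro _ ⟨i, rfl⟩
    obtain ⟨w, hw, hw'⟩ := h'.exists_map_eq hkr h'.mem (e i y)
    obtain ⟨c, hc⟩ := h.exists_eq_smul hy (l' y)
    have ha := h.coeff_ne_zero y hy hyx i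
    have h1 : f i y = (a i y)⁻¹ • c • w := by
      apply tmul_left_injective (h.line_ne_zero y hy)
      have h2 := h.map_compl y hy i
      rw [hw', hc, TensorProduct.tmul_smul] at h2
      simp only [← TensorProduct.smul_tmul']
      rw [h2, smul_smul, inv_mul_cancel₀ ha, one_smul]
    simp only [SetLike.mem_coe]
    rw [h1]
    exact Submodule.smul_mem _ _ (Submodule.smul_mem _ _ hw)
  · rw [h.finrank_span_image hy, h'.finrank_span_image h'.mem]

end IsSmithFrame

variable [ConnectedSpace X] [T1Space X] [IsManifold 𝓘(ℂ) ω X]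
  [ContMDiffVectorBundle ω (Fin p → ℂ) V 𝓘(ℂ)] [ContMDiffVectorBundle ω (Fin q → ℂ) W 𝓘(ℂ)]
  [ContMDiffVectorBundle ω ℂ L 𝓘(ℂ)]

/-- The local rank is locally constant, so it is constant on the connected space `X`. -/
theorem exists_isSmithFrame_of_rank {φ : ∀ x, V x →ₗ[ℂ] W x ⊗[ℂ] L x}
    (hφ : IsHolomorphicTwistedMap (Fin p → ℂ) (Fin q → ℂ) ℂ φ) :
    ∃ (k r : ℕ), k + r = p ∧ ∀ x, ∃ (U : Set X) (n : Fin k → ∀ x, V x) (e : Fin r → ∀ x, V x)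
      (f : Fin r → ∀ x, W x) (l : ∀ x, L x) (a : Fin r → X → ℂ),
      IsSmithFrame (Fin p → ℂ) (Fin q → ℂ) ℂ φ x U n e f l a := by
  choose k r hkr U n e f l a h using exists_isSmithFrame hφ
  have hk : IsLocallyConstant k := (IsLocallyConstant.iff_exists_open k).2 fun x =>
    ⟨U x, (h x).isOpen, (h x).mem, fun y hy => ((h x).rank_eq (hkr x) hy (h y) (hkr y)).symm⟩
  obtain ⟨x₀⟩ := (inferInstance : Nonempty X)
  refine ⟨k x₀, r x₀, hkr x₀, fun x => ?_⟩
  have h1 : k x = k x₀ := hk.apply_eq_of_preconnectedSpace x x₀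
  have h2 : r x = r x₀ := by
    have := hkr x
    have := hkr x₀
    omega
  rw [← h1, ← h2]
  exact ⟨U x, n x, e x, f x, l x, a x, h x⟩

/-- The saturated kernel `N` and image `I ⊗ L` of a bundle map `V → W ⊗ L`, together with adapted
local frames. -/
theorem exists_saturated_ker_image {φ : ∀ x, V x →ₗ[ℂ] W x ⊗[ℂ] L x}
    (hφ : IsHolomorphicTwistedMap (Fin p → ℂ) (Fin q → ℂ) ℂ φ) :
    ∃ (k r : ℕ), k + r = p ∧ ∃ (N : ∀ x, Submodule ℂ (V x)) (I : ∀ x, Submodule ℂ (W x)), ∀ x,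
      ∃ (U : Set X) (n : Fin k → ∀ x, V x) (e : Fin r → ∀ x, V x)
      (f : Fin r → ∀ x, W x) (l : ∀ x, L x) (a : Fin r → X → ℂ),
      IsSmithFrame (Fin p → ℂ) (Fin q → ℂ) ℂ φ x U n e f l a ∧
      (∀ y ∈ U, Submodule.span ℂ (range fun i => n i y) = N y) ∧
      (∀ y ∈ U, Submodule.span ℂ (range fun i => f i y) = I y) := by
  obtain ⟨k, r, hkr, H⟩ := exists_isSmithFrame_of_rank hφ
  choose U n e f l a h using H
  refine ⟨k, r, hkr, fun x => Submodule.span ℂ (range fun i => n x i x),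
    fun x => Submodule.span ℂ (range fun i => f x i x), fun x =>
    ⟨U x, n x, e x, f x, l x, a x, h x, fun y hy => ?_, fun y hy => ?_⟩⟩
  · by_cases hyx : y = x
    · rw [hyx]
    · exact (h x).span_ker_eq hkr hy hyx (h y)
  · by_cases hyx : y = x
    · rw [hyx]
    · exact (h x).span_image_eq hkr hy hyx (h y)

end ConstantRank

/-! ### The degree inequality for the saturated kernel and image -/

section AdaptedNorm

variable {M : Type*} [AddCommGroup M] [Module ℂ M] {M' : Type*} [AddCommGroup M'] [Module ℂ M']
  {L : Type*} [AddCommGroup L] [Module ℂ L] {k r : ℕ}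

/-- The squared norm of the determinant of the map `M / span n → span f ⊗ L` which is diagonal, with
coefficients `a`, in the frames `e` and `f ⊗ l`. -/
def adaptedNormSq (B : M →ₗ⋆[ℂ] M →ₗ[ℂ] ℂ) (B' : M' →ₗ⋆[ℂ] M' →ₗ[ℂ] ℂ) (C : L →ₗ⋆[ℂ] L →ₗ[ℂ] ℂ)
    (n : Fin k → M) (e : Fin r → M) (f : Fin r → M') (l : L) (a : Fin r → ℂ) : ℝ :=
  ‖∏ i, a i‖ ^ 2 *
    (gramDet B n * gramDet B' f * gramDet C (fun _ : Fin 1 => l) ^ r / gramDet B (Sum.elim n e))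

/-- The change of frame of `M` is block triangular, with diagonal blocks `A` on the kernel and `c`
on the quotient. Comparing the diagonal forms of `φ` gives `diag(a) c = u g diag(a')`. By its
determinant, the factors acquired by the Gram determinants and by `∏ a` cancel. -/
theorem adaptedNormSq_eq {B : M →ₗ⋆[ℂ] M →ₗ[ℂ] ℂ} {B' : M' →ₗ⋆[ℂ] M' →ₗ[ℂ] ℂ}
    {C : L →ₗ⋆[ℂ] L →ₗ[ℂ] ℂ} {φ : M →ₗ[ℂ] M' ⊗[ℂ] L}
    {n n' : Fin k → M} {e e' : Fin r → M} {f f' : Fin r → M'} {l l' : L} {a a' : Fin r → ℂ}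
    (hn : ∀ i, n' i ∈ Submodule.span ℂ (range n))
    (he : ∀ i, e' i ∈ Submodule.span ℂ (range (Sum.elim n e)))
    (hf : ∀ i, f' i ∈ Submodule.span ℂ (range f)) {u : ℂ} (hl : l' = u • l) (hl0 : l ≠ 0)
    (hli : LinearIndependent ℂ (Sum.elim n' e')) (hlif : LinearIndependent ℂ f)
    (hφn : ∀ i, φ (n i) = 0) (hφe : ∀ i, φ (e i) = a i • (f i ⊗ₜ[ℂ] l))
    (hφe' : ∀ i, φ (e' i) = a' i • (f' i ⊗ₜ[ℂ] l')) :
    adaptedNormSq B B' C n' e' f' l' a' = adaptedNormSq B B' C n e f l a := by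
  obtain ⟨A, hA⟩ := exists_matrix_of_mem_span hn
  obtain ⟨D, hD⟩ := exists_matrix_of_mem_span he
  obtain ⟨g, hg⟩ := exists_matrix_of_mem_span hf
  set b := D.toRows₁ with hb
  set c := D.toRows₂ with hc
  have hD' : ∀ j, e' j = ∑ i, b i j • n i + ∑ i, c i j • e i := fun j => by
    rw [hD, Fintype.sum_sum_type]
    rfl
  have hT : ∀ j, Sum.elim n' e' j = ∑ i, (Matrix.fromBlocks A b 0 c) i j • Sum.elim n e i := by
    rintro (j | j)
    · simp [Fintype.sum_sum_type, hA]
    · simp [Fintype.sum_sum_type, hD']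
  have hdet : (Matrix.fromBlocks A b 0 c).det = A.det * c.det := Matrix.det_fromBlocks_zero₂₁ _ _ _
  have hne := det_ne_zero_of_linearIndependent hT hli
  rw [hdet] at hne
  have hA0 : ‖A.det‖ ≠ 0 := norm_ne_zero_iff.2 (left_ne_zero_of_mul hne)
  have hc0 : ‖c.det‖ ≠ 0 := norm_ne_zero_iff.2 (right_ne_zero_of_mul hne)
  have hcoef : ∀ i j, a i * c i j = u * g i j * a' j := by
    intro i j
    have h1 : φ (e' j) = (∑ i, (a i * c i j) • f i) ⊗ₜ[ℂ] l := by
      rw [hD']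
      simp only [map_add, map_sum, map_smul, hφn, hφe, smul_zero, Finset.sum_const_zero, zero_add,
        TensorProduct.sum_tmul, smul_smul]
      exact Finset.sum_congr rfl fun i _ => by rw [TensorProduct.smul_tmul', mul_comm]
    have h2 : φ (e' j) = (∑ i, (u * g i j * a' j) • f i) ⊗ₜ[ℂ] l := by
      rw [hφe', hl, hg, TensorProduct.tmul_smul, smul_smul, TensorProduct.smul_tmul',
        Finset.smul_sum]
      congr 1
      exact Finset.sum_congr rfl fun i _ => by
        rw [smul_smul]
        congr 1
        ring
    have h3 := tmul_left_injective hl0 (h1.symm.trans h2)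
    have h4 : ∑ i, (a i * c i j - u * g i j * a' j) • f i = 0 := by
      simp only [sub_smul, Finset.sum_sub_distrib]
      exact sub_eq_zero.2 h3
    exact sub_eq_zero.1 (Fintype.linearIndependent_iff.1 hlif _ h4 i)
  have hmat : Matrix.diagonal a * c = (u • g) * Matrix.diagonal a' := by
    ext i j
    rw [Matrix.diagonal_mul, Matrix.mul_diagonal]
    exact hcoef i j
  have hprod : (∏ i, a i) * c.det = u ^ r * g.det * ∏ i, a' i := by
    have := congrArg Matrix.det hmat
    simpa [Matrix.det_smul, mul_assoc] using this
  have hl1 : gramDet C (fun _ : Fin 1 => l') = ‖u‖ ^ 2 * gramDet C (fun _ : Fin 1 => l) := by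
    rw [gramDet_change C (A := Matrix.of fun _ _ : Fin 1 => u) (v := fun _ : Fin 1 => l)
      fun j => by simp [hl]]
    simp
  rw [adaptedNormSq, adaptedNormSq, gramDet_change B hA, gramDet_change B' hg, gramDet_change B hT,
    hl1, hdet]
  have h5 := congrArg (fun z : ℂ => ‖z‖ ^ 2) hprod
  simp only [norm_mul, norm_pow, mul_pow] at h5
  simp only [norm_mul, mul_pow]
  -- No positivity of `B` is assumed; if this determinant vanishes, both sides are `0` by the
  -- convention for division by zero.
  by_cases h0 : gramDet B (Sum.elim n e) = 0
  · simp [h0]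
  field_simp
  rw [← pow_mul] at h5 ⊢
  rw [mul_comm r 2] at h5
  linear_combination (-(gramDet B n * gramDet B' f * gramDet C (fun _ : Fin 1 => l) ^ r)) * h5

end AdaptedNorm

section DegreeInequality

variable {X : Type*} [TopologicalSpace X] [ChartedSpace ℂ X] [IsManifold 𝓘(ℂ) ω X]
variable {p q : ℕ}
  {V : X → Type*} [∀ x, AddCommGroup (V x)] [∀ x, Module ℂ (V x)]
  [∀ x, TopologicalSpace (V x)] [TopologicalSpace (TotalSpace (Fin p → ℂ) V)]
  [FiberBundle (Fin p → ℂ) V] [VectorBundle ℂ (Fin p → ℂ) V]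
  {W : X → Type*} [∀ x, AddCommGroup (W x)] [∀ x, Module ℂ (W x)]
  [∀ x, TopologicalSpace (W x)] [TopologicalSpace (TotalSpace (Fin q → ℂ) W)]
  [FiberBundle (Fin q → ℂ) W] [VectorBundle ℂ (Fin q → ℂ) W]
  {L : X → Type*} [∀ x, AddCommGroup (L x)] [∀ x, Module ℂ (L x)]
  [∀ x, TopologicalSpace (L x)] [TopologicalSpace (TotalSpace ℂ L)]
  [FiberBundle ℂ L] [VectorBundle ℂ ℂ L]

namespace IsSmithFrame

variable {φ : ∀ x, V x →ₗ[ℂ] W x ⊗[ℂ] L x} {x : X} {k r : ℕ} {U : Set X}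
  {n : Fin k → ∀ x, V x} {e : Fin r → ∀ x, V x} {f : Fin r → ∀ x, W x} {l : ∀ x, L x}
  {a : Fin r → X → ℂ}

theorem isHolomorphicFrameOn_ker (h : IsSmithFrame (Fin p → ℂ) (Fin q → ℂ) ℂ φ x U n e f l a)
    {N : ∀ x, Submodule ℂ (V x)} (hN : ∀ y ∈ U, Submodule.span ℂ (range fun i => n i y) = N y) :
    IsHolomorphicFrameOn (Fin p → ℂ) N U n where
  isOpen := h.isOpen
  holomorphic := h.holomorphic_ker
  linearIndependent y hy := (h.linearIndependent y hy).comp Sum.inl Sum.inl_injective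
  span_eq := hN

theorem isHolomorphicFrameOn_image (h : IsSmithFrame (Fin p → ℂ) (Fin q → ℂ) ℂ φ x U n e f l a)
    {I : ∀ x, Submodule ℂ (W x)} (hI : ∀ y ∈ U, Submodule.span ℂ (range fun i => f i y) = I y) :
    IsHolomorphicFrameOn (Fin q → ℂ) I U f where
  isOpen := h.isOpen
  holomorphic := h.holomorphic_image
  linearIndependent := h.linearIndependent_image
  span_eq := hI

theorem isHolomorphicFrameOn_line (h : IsSmithFrame (Fin p → ℂ) (Fin q → ℂ) ℂ φ x U n e f l a) :
    IsHolomorphicFrameOn ℂ (fun x => (⊤ : Submodule ℂ (L x))) U fun _ : Fin 1 => l where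
  isOpen := h.isOpen
  holomorphic _ := h.holomorphic_line
  linearIndependent y hy := LinearIndependent.of_subsingleton 0 (h.line_ne_zero y hy)
  span_eq y hy := by
    rw [eq_top_iff]
    intro l' _
    obtain ⟨c, rfl⟩ := h.exists_eq_smul hy l'
    exact Submodule.smul_mem _ _ (Submodule.subset_span ⟨0, rfl⟩)

theorem isHolomorphicFrameOn_top (h : IsSmithFrame (Fin p → ℂ) (Fin q → ℂ) ℂ φ x U n e f l a)
    (hkr : k + r = p) (E : Fin p ≃ Fin k ⊕ Fin r) :
    IsHolomorphicFrameOn (Fin p → ℂ) (fun x => (⊤ : Submodule ℂ (V x))) U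
      fun i y => Sum.elim (fun i => n i y) (fun i => e i y) (E i) where
  isOpen := h.isOpen
  holomorphic i := by
    rcases E i with j | j
    · exact h.holomorphic_ker j
    · exact h.holomorphic_compl j
  linearIndependent y hy := (h.linearIndependent y hy).comp E E.injective
  span_eq y hy := by
    have := E.surjective.range_comp (Sum.elim (fun i => n i y) fun i => e i y)
    rw [← h.span_eq_top hkr hy, ← this]
    rfl

/-- Here `Φ` is the squared norm of the determinant of `V / N → I ⊗ L`, a section of `det N ⊗ det I
⊗ Lʳ ⊗ (det V)⁻¹`. The four curvature terms are those of these factors, and the holomorphic function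
is `∏ a`. -/
theorem isLocalNormSq (h : IsSmithFrame (Fin p → ℂ) (Fin q → ℂ) ℂ φ x U n e f l a)
    (hkr : k + r = p) {N : ∀ x, Submodule ℂ (V x)}
    (hN : ∀ y ∈ U, Submodule.span ℂ (range fun i => n i y) = N y)
    {I : ∀ x, Submodule ℂ (W x)} (hI : ∀ y ∈ U, Submodule.span ℂ (range fun i => f i y) = I y)
    (hV : HermitianMetric (Fin p → ℂ) V) (hW : HermitianMetric (Fin q → ℂ) W)
    (hL : HermitianMetric ℂ L) {Φ : X → ℝ}
    (hΦ : ∀ y ∈ U, Φ y = adaptedNormSq (hV.form y) (hW.form y) (hL.form y) (fun i => n i y)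
      (fun i => e i y) (fun i => f i y) (l y) fun i => a i y) :
    ∃ b ψ, IsLocalNormSq Φ (fun c y => curvature hV N k c y + (curvature hW I r c y +
      (r * curvature hL (fun x => (⊤ : Submodule ℂ (L x))) 1 c y +
        (-1) * curvature hV (fun x => (⊤ : Submodule ℂ (V x))) p c y))) b ψ x ∧
      ∀ᶠ y in 𝓝[≠] x, b y ≠ 0 := by
  set E : Fin p ≃ Fin k ⊕ Fin r := (finCongr hkr.symm).trans finSumFinEquiv.symm
  have h1 := h.isHolomorphicFrameOn_ker hN
  have h2 := h.isHolomorphicFrameOn_image hI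
  have h3 := h.isHolomorphicFrameOn_line
  have h4 := h.isHolomorphicFrameOn_top hkr E
  refine ⟨fun y => ∏ i, a i y, _, ⟨contMDiffAt_finsetProd fun i _ => h.holomorphic_coeff i,
    (h1.isPotentialAt_logGram hV h.mem).add ((h2.isPotentialAt_logGram hW h.mem).add
      (((h3.isPotentialAt_logGram hL h.mem).const_mul r).add
        ((h4.isPotentialAt_logGram hV h.mem).const_mul (-1)))), ?_⟩, ?_⟩
  · filter_upwards [h.isOpen.mem_nhds h.mem] with y hy
    rw [hΦ y hy, adaptedNormSq]
    simp only [HermitianMetric.logGram_eq]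
    have g1 := hV.gramDet_pos (h1.linearIndependent y hy)
    have g2 := hW.gramDet_pos (h2.linearIndependent y hy)
    have g3 := hL.gramDet_pos (h3.linearIndependent y hy)
    have g4 := hV.gramDet_pos (h.linearIndependent y hy)
    rw [gramDet_reindex (hV.form y) (Sum.elim (fun i => n i y) fun i => e i y) E, neg_one_mul,
      Real.exp_add, Real.exp_add, Real.exp_add, Real.exp_neg, Real.exp_nat_mul, Real.exp_log g1,
      Real.exp_log g2, Real.exp_log g3, Real.exp_log g4]
    ring
  · filter_upwards [eventually_nhdsWithin_of_eventually_nhds (h.isOpen.mem_nhds h.mem),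
      eventually_mem_nhdsWithin] with y hy hyx
    exact Finset.prod_ne_zero_iff.2 fun i _ => h.coeff_ne_zero y hy hyx i

end IsSmithFrame

variable [T2Space X] [CompactSpace X]
  [ContMDiffVectorBundle ω (Fin p → ℂ) V 𝓘(ℂ)] [ContMDiffVectorBundle ω (Fin q → ℂ) W 𝓘(ℂ)]
  [ContMDiffVectorBundle ω ℂ L 𝓘(ℂ)]

/-- The determinant of `V / N → I ⊗ L` has a globally defined squared norm, and
`ChartPartition.integral_nonpos` bounds the integral of the combined curvature. -/
theorem degree_le_of_isSmithFrame {φ : ∀ x, V x →ₗ[ℂ] W x ⊗[ℂ] L x} {k r : ℕ} (hkr : k + r = p)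
    {N : ∀ x, Submodule ℂ (V x)} {I : ∀ x, Submodule ℂ (W x)}
    (H : ∀ x, ∃ (U : Set X) (n : Fin k → ∀ x, V x) (e : Fin r → ∀ x, V x)
      (f : Fin r → ∀ x, W x) (l : ∀ x, L x) (a : Fin r → X → ℂ),
      IsSmithFrame (Fin p → ℂ) (Fin q → ℂ) ℂ φ x U n e f l a ∧
      (∀ y ∈ U, Submodule.span ℂ (range fun i => n i y) = N y) ∧
      (∀ y ∈ U, Submodule.span ℂ (range fun i => f i y) = I y)) :
    degree (Fin p → ℂ) (fun x => (⊤ : Submodule ℂ (V x))) p ≤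
      degree (Fin p → ℂ) N k + degree (Fin q → ℂ) I r +
        r * degree ℂ (fun x => (⊤ : Submodule ℂ (L x))) 1 := by
  choose U n e f l a h hN hI using H
  obtain ⟨hV⟩ := nonempty_hermitianMetric (Fin p → ℂ) V
  obtain ⟨hW⟩ := nonempty_hermitianMetric (Fin q → ℂ) W
  obtain ⟨hL⟩ := nonempty_hermitianMetric ℂ L
  obtain ⟨P⟩ := nonempty_chartPartition X
  have sN : IsHolomorphicSubbundle (Fin p → ℂ) N k := fun x =>
    ⟨U x, n x, (h x).mem, (h x).isHolomorphicFrameOn_ker (hN x)⟩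
  have sI : IsHolomorphicSubbundle (Fin q → ℂ) I r := fun x =>
    ⟨U x, f x, (h x).mem, (h x).isHolomorphicFrameOn_image (hI x)⟩
  have sL : IsHolomorphicSubbundle ℂ (fun x => (⊤ : Submodule ℂ (L x))) 1 := fun x =>
    ⟨U x, fun _ => l x, (h x).mem, (h x).isHolomorphicFrameOn_line⟩
  have sV : IsHolomorphicSubbundle (Fin p → ℂ) (fun x => (⊤ : Submodule ℂ (V x))) p := fun x =>
    ⟨U x, _, (h x).mem, (h x).isHolomorphicFrameOn_top hkr
      ((finCongr hkr.symm).trans finSumFinEquiv.symm)⟩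
  -- The global function takes at `y` the value computed in the frame centred at `y`; in every other
  -- frame around `y` the value is the same.
  have hΦ : ∀ x, ∀ y ∈ U x,
      adaptedNormSq (hV.form y) (hW.form y) (hL.form y) (fun i => n y i y)
        (fun i => e y i y) (fun i => f y i y) (l y y) (fun i => a y i y) =
      adaptedNormSq (hV.form y) (hW.form y) (hL.form y) (fun i => n x i y)
        (fun i => e x i y) (fun i => f x i y) (l x y) fun i => a x i y := by
    intro x y hy
    obtain ⟨u, hu⟩ := (h x).exists_eq_smul hy (l y y)
    refine adaptedNormSq_eq (φ := φ y) (fun i => ?_) (fun i => ?_) (fun i => ?_) hu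
      ((h x).line_ne_zero y hy) ((h y).linearIndependent y (h y).mem)
      ((h x).linearIndependent_image y hy) ((h x).map_ker y hy) ((h x).map_compl y hy)
      ((h y).map_compl y (h y).mem)
    · rw [hN x y hy, ← hN y y (h y).mem]
      exact Submodule.subset_span ⟨i, rfl⟩
    · rw [(h x).span_eq_top hkr hy]
      trivial
    · rw [hI x y hy, ← hI y y (h y).mem]
      exact Submodule.subset_span ⟨i, rfl⟩
  have key := P.integral_nonpos fun x =>
    (h x).isLocalNormSq hkr (hN x) (hI x) hV hW hL (hΦ x)
  have dN := isDensity_curvature sN hV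
  have dI := isDensity_curvature sI hW
  have dL := isDensity_curvature sL hL
  have dV := isDensity_curvature sV hV
  have cL : ∀ c, ContinuousOn (fun y => r * curvature hL (fun x => (⊤ : Submodule ℂ (L x))) 1 c y)
    (chartAt ℂ c).source := fun c => continuousOn_const.mul (dL.continuousOn c)
  have cV : ∀ c, ContinuousOn (fun y => (-1) *
    curvature hV (fun x => (⊤ : Submodule ℂ (V x))) p c y) (chartAt ℂ c).source :=
    fun c => continuousOn_const.mul (dV.continuousOn c)
  have cLV : ∀ c, ContinuousOn (fun y =>
    r * curvature hL (fun x => (⊤ : Submodule ℂ (L x))) 1 c y +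
      (-1) * curvature hV (fun x => (⊤ : Submodule ℂ (V x))) p c y) (chartAt ℂ c).source :=
    fun c => (cL c).add (cV c)
  have cILV : ∀ c, ContinuousOn (fun y => curvature hW I r c y +
    (r * curvature hL (fun x => (⊤ : Submodule ℂ (L x))) 1 c y +
      (-1) * curvature hV (fun x => (⊤ : Submodule ℂ (V x))) p c y)) (chartAt ℂ c).source :=
    fun c => (dI.continuousOn c).add (cLV c)
  rw [P.integral_add dN.continuousOn cILV, P.integral_add dI.continuousOn cLV,
    P.integral_add cL cV,
    P.integral_const_mul, P.integral_const_mul] at key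
  rw [degree_eq_integral sN hV P, degree_eq_integral sI hW P, degree_eq_integral sL hL P,
    degree_eq_integral sV hV P]
  have hpi : 0 ≤ 1 / (4 * Real.pi) := by positivity
  nlinarith [mul_nonneg hpi (sub_nonneg.2 key)]

end DegreeInequality

/-! ### The bounds on the parameter -/

theorem alphaSlope_mul (α : ℝ) {p q : ℕ} (h : 0 < p + q) (a b : ℝ) :
    alphaSlope α p q a b * (p + q) = a + b + α * p := by
  have h1 : (p : ℝ) + q ≠ 0 := by exact_mod_cast h.ne'
  rw [alphaSlope]
  field_simp

/-- The two rank fractions add up to `1`, so weighting the other summand by `-α` shifts every slope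
by the same constant. -/
theorem alphaSlope_swap (α : ℝ) {p q : ℕ} (h : 0 < p + q) (a b : ℝ) :
    alphaSlope (-α) q p b a = alphaSlope α p q a b - α := by
  have h1 : (p : ℝ) + q ≠ 0 := by exact_mod_cast h.ne'
  have h2 : (q : ℝ) + p ≠ 0 := by rwa [add_comm]
  rw [alphaSlope, alphaSlope]
  field_simp
  ring

theorem neg_alphaMax_swap (p q : ℕ) (δ d : ℝ) : -alphaMax q p (-δ) d = alphaMin p q δ d := by
  rw [alphaMax, alphaMin, abs_sub_comm (p : ℝ) q, max_comm (q : ℝ) p]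
  by_cases h : -δ < d
  · rw [if_pos h, if_pos (by linarith)]
    ring
  · rw [if_neg h, if_neg (by linarith)]
    ring

/-- With `m` and `M` the minimum and maximum of `p, q`, the hypothesis reads `(2mM - r(m + M))(α +
δ) ≤ r(m + M)(d - δ)`, and the left factor is positive as `r ≤ m < M`. If `δ ≥ d`, the right side is
non-positive. If `δ < d`, the bound on `α + δ` is weakest for `r = m`, where it is `(m + M)(d - δ) /
(M - m)`. -/
theorem le_alphaMax_of_mul_le {p q r : ℕ} (hp : 0 < p) (hq : 0 < q) (hpq : p ≠ q) (hrp : r ≤ p)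
    (hrq : r ≤ q) {α δ d : ℝ} (h : 2 * p * q * (α + δ) ≤ r * (α + d) * (p + q)) :
    α ≤ alphaMax p q δ d := by
  have hp' : (0 : ℝ) < p := by exact_mod_cast hp
  have hq' : (0 : ℝ) < q := by exact_mod_cast hq
  have hrp' : (r : ℝ) ≤ p := by exact_mod_cast hrp
  have hrq' : (r : ℝ) ≤ q := by exact_mod_cast hrq
  have hr' : (0 : ℝ) ≤ r := Nat.cast_nonneg r
  obtain ⟨m, M, hm, hmM, hrm, hsum, hprod, hmax, habs⟩ : ∃ m M : ℝ, 0 < m ∧ m < M ∧ r ≤ m ∧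
      (p : ℝ) + q = m + M ∧ (p : ℝ) * q = m * M ∧ max (p : ℝ) q = M ∧ |(q : ℝ) - p| = M - m := by
    rcases lt_or_gt_of_ne hpq with hlt | hlt
    · have hlt' : (p : ℝ) < q := by exact_mod_cast hlt
      exact ⟨p, q, hp', hlt', hrp', rfl, rfl, max_eq_right hlt'.le, abs_of_pos (by linarith)⟩
    · have hlt' : (q : ℝ) < p := by exact_mod_cast hlt
      exact ⟨q, p, hq', hlt', hrq', add_comm _ _, mul_comm _ _, max_eq_left hlt'.le, by
        rw [abs_of_neg (by linarith)]
        ring⟩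
  have h1 : (2 * (m * M) - r * (m + M)) * (α + δ) ≤ r * (m + M) * (d - δ) := by
    rw [mul_assoc 2, hprod, hsum] at h
    linarith
  have hpos : 0 < 2 * (m * M) - r * (m + M) := by nlinarith
  have hMm : 0 < M - m := sub_pos.2 hmM
  rw [alphaMax, hmax, habs, hsum]
  split_ifs with hδ
  · have h2 : (α + δ) * (M - m) ≤ (m + M) * (d - δ) := by
      by_contra! h3
      have h4 := mul_lt_mul_of_pos_left h3 hpos
      have h5 := mul_le_mul_of_nonneg_right h1 hMm.le
      -- The factor `2M(m - r)` is the difference `(2mM - r(m + M)) - r(M - m)`, which compares the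
      -- rank `r` with the extreme case `r = m`.
      have h6 : 0 ≤ (m + M) * (d - δ) * (2 * M * (m - r)) := by
        have : 0 ≤ d - δ := by linarith
        have : 0 ≤ m - r := by linarith
        have : 0 < M := by linarith
        positivity
      nlinarith
    have h3 : -(2 * M / (M - m)) * δ + (m + M) / (M - m) * d =
        ((m + M) * (d - δ)) / (M - m) - δ := by
      field_simp
      ring
    rw [h3, le_sub_iff_add_le, le_div_iff₀ hMm]
    exact h2
  · by_contra! h2
    have h3 : 0 < (2 * (m * M) - r * (m + M)) * (α + δ) := mul_pos hpos (by linarith)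
    have h4 : 0 ≤ r * (m + M) * (δ - d) := by
      have : 0 ≤ δ - d := by linarith
      have : 0 < M := by linarith
      positivity
    linarith

/-! ### Rank of a holomorphic subbundle. -/

section Subbundles

variable {X : Type*} [TopologicalSpace X] [ChartedSpace ℂ X]
  {F : Type*} [NormedAddCommGroup F] [NormedSpace ℂ F]
  {V : X → Type*} [∀ x, AddCommGroup (V x)] [∀ x, Module ℂ (V x)]
  [∀ x, TopologicalSpace (V x)] [TopologicalSpace (TotalSpace F V)] [FiberBundle F V]

theorem isHolomorphicSubbundle_bot :
    IsHolomorphicSubbundle F (fun x => (⊥ : Submodule ℂ (V x))) 0 := fun x =>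
  ⟨univ, fun i => i.elim0, mem_univ x, isOpen_univ, fun i => i.elim0,
    fun _ _ => linearIndependent_empty_type, fun x _ => by simp⟩

theorem IsHolomorphicSubbundle.finrank_eq {S : ∀ x, Submodule ℂ (V x)} {k : ℕ}
    (h : IsHolomorphicSubbundle F S k) (x : X) : finrank ℂ (S x) = k := by
  obtain ⟨U, s, hx, hs⟩ := h x
  rw [← hs.span_eq x hx]
  simpa using finrank_span_eq_card (hs.linearIndependent x hx)

theorem IsHolomorphicSubbundle.eq_bot {S : ∀ x, Submodule ℂ (V x)}
    (h : IsHolomorphicSubbundle F S 0) (x : X) : S x = ⊥ := by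
  obtain ⟨U, s, hx, hs⟩ := h x
  rw [← hs.span_eq x hx]
  simp

end Subbundles

/-! ### Semistability and the two bounds. -/

section Bounds

variable {X : Type*} [TopologicalSpace X] [T2Space X] [CompactSpace X] [ConnectedSpace X]
  [ChartedSpace ℂ X] [IsManifold 𝓘(ℂ) ω X]
  {p q : ℕ}
  {V : X → Type*} [∀ x, AddCommGroup (V x)] [∀ x, Module ℂ (V x)]
  [∀ x, TopologicalSpace (V x)] [TopologicalSpace (TotalSpace (Fin p → ℂ) V)]
  [FiberBundle (Fin p → ℂ) V] [VectorBundle ℂ (Fin p → ℂ) V]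
  [ContMDiffVectorBundle ω (Fin p → ℂ) V 𝓘(ℂ)]
  {W : X → Type*} [∀ x, AddCommGroup (W x)] [∀ x, Module ℂ (W x)]
  [∀ x, TopologicalSpace (W x)] [TopologicalSpace (TotalSpace (Fin q → ℂ) W)]
  [FiberBundle (Fin q → ℂ) W] [VectorBundle ℂ (Fin q → ℂ) W]
  [ContMDiffVectorBundle ω (Fin q → ℂ) W 𝓘(ℂ)]
  {L : X → Type*} [∀ x, AddCommGroup (L x)] [∀ x, Module ℂ (L x)]
  [∀ x, TopologicalSpace (L x)] [TopologicalSpace (TotalSpace ℂ L)]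
  [FiberBundle ℂ L] [VectorBundle ℂ ℂ L] [ContMDiffVectorBundle ω ℂ L 𝓘(ℂ)]

theorem isHolomorphicSubbundle_top :
    IsHolomorphicSubbundle (Fin p → ℂ) (fun x => (⊤ : Submodule ℂ (V x))) p := fun x => by
  set e := trivializationAt (Fin p → ℂ) V x
  refine ⟨e.baseSet, fun i y => e.symmₗ ℂ y (Pi.single i 1),
    FiberBundle.mem_baseSet_trivializationAt' x, e.open_baseSet,
    fun i => isHolomorphicOn_symm e e.open_baseSet subset_rfl fun y _ => contMDiffAt_const,
    fun y hy => ?_, fun y hy => ?_⟩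
  all_goals
    have h1 : ∀ i, e.symmₗ ℂ y (Pi.single i 1) =
        ((Pi.basisFun ℂ (Fin p)).map (e.linearEquivAt ℂ y hy).symm) i := fun i => by
      rw [Basis.map_apply, Pi.basisFun_apply]
      exact e.symmₗ_apply (hb := hy) _
    simp only [h1]
  · exact Basis.linearIndependent _
  · exact Basis.span_eq _

namespace TwistedHiggsBundle

theorem le_alphaMax (hp : 0 < p) (hq : 0 < q) (hpq : p ≠ q)
    (E : TwistedHiggsBundle (Fin p → ℂ) V (Fin q → ℂ) W ℂ L) {α : ℝ} (hE : E.IsSemistable α) :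
    α ≤ alphaMax p q (bundleDegree (Fin p → ℂ) V / p - bundleDegree (Fin q → ℂ) W / q)
      (bundleDegree ℂ L) := by
  obtain ⟨k, r, hkr, N, I, H⟩ := exists_saturated_ker_image E.holomorphic_γ
  have hdeg := degree_le_of_isSmithFrame hkr H
  choose U n e f l a h hN hI using H
  have sN : IsHolomorphicSubbundle (Fin p → ℂ) N k := fun x =>
    ⟨U x, n x, (h x).mem, (h x).isHolomorphicFrameOn_ker (hN x)⟩
  have sI : IsHolomorphicSubbundle (Fin q → ℂ) I r := fun x =>
    ⟨U x, f x, (h x).mem, (h x).isHolomorphicFrameOn_image (hI x)⟩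
  obtain ⟨x₀⟩ := (inferInstance : Nonempty X)
  have hV₀ : finrank ℂ (V x₀) = p := by rw [finrank_fiber (F := Fin p → ℂ), finrank_fin_fun]
  have hW₀ : finrank ℂ (W x₀) = q := by rw [finrank_fiber (F := Fin q → ℂ), finrank_fin_fun]
  have := finiteDimensional_fiber (Fin q → ℂ) (V := W) x₀
  have hrq : r ≤ q := by
    rw [← hW₀, ← sI.finrank_eq x₀]
    exact Submodule.finrank_le _
  -- On the fibres `N` lies in the kernel of `γ`, also at the points where the kernel jumps.
  have subN : E.IsSubobject N k (fun x => ⊥) 0 :=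
    { left := sN
      right := isHolomorphicSubbundle_bot
      map_β := fun x w hw => by
        rw [(Submodule.mem_bot ℂ).1 hw, map_zero]
        exact Submodule.zero_mem _
      map_γ := fun x v hv => by
        rw [← hN x x (h x).mem] at hv
        rw [(h x).span_le_ker (h x).mem hv]
        exact Submodule.zero_mem _ }
  have subI : E.IsSubobject (fun x => ⊤) p I r :=
    { left := isHolomorphicSubbundle_top
      right := sI
      map_β := fun x w _ => by
        have h1 : Function.Surjective ((⊤ : Submodule ℂ (V x)).subtype.rTensor (L x)) :=
          LinearMap.rTensor_surjective _ fun v => ⟨⟨v, trivial⟩, rfl⟩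
        exact h1 _
      map_γ := fun x v _ => by
        obtain ⟨w, hw, hvw⟩ := (h x).exists_map_eq hkr (h x).mem v
        rw [hI x x (h x).mem] at hw
        exact ⟨⟨w, hw⟩ ⊗ₜ l x x, hvw.symm⟩ }
  rw [bundleDegree, bundleDegree, bundleDegree, finrank_fin_fun, finrank_fin_fun, finrank_self]
  have hE' := hE
  rw [IsSemistable, bundleDegree, bundleDegree, finrank_fin_fun, finrank_fin_fun] at hE'
  set dV := degree (Fin p → ℂ) (fun x => (⊤ : Submodule ℂ (V x))) p
  set dW := degree (Fin q → ℂ) (fun x => (⊤ : Submodule ℂ (W x))) q with hdW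
  set dL := degree ℂ (fun x => (⊤ : Submodule ℂ (L x))) 1
  set m := alphaSlope α p q dV dW
  have hm : m * (p + q) = dV + dW + α * p := alphaSlope_mul α (by omega) dV dW
  have ineqN : degree (Fin p → ℂ) N k + α * k ≤ m * k := by
    -- For `k = 0` the pair `(N, 0)` is zero and not tested by semistability, but then both sides
    -- vanish.
    rcases Nat.eq_zero_or_pos k with rfl | hk
    · simp [degree_zero]
    have h1 := hE' N k _ 0 subN (fun h0 => hk.ne' ?_) (fun h0 => hq.ne' ?_)
    · have h2 := alphaSlope_mul α (p := k) (q := 0) (by omega) (degree (Fin p → ℂ) N k)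
        (degree (Fin q → ℂ) (fun x => (⊥ : Submodule ℂ (W x))) 0)
      rw [degree_zero] at h1 h2
      simp only [Nat.cast_zero, add_zero] at h2
      rw [← h2]
      exact mul_le_mul_of_nonneg_right h1 (Nat.cast_nonneg k)
    · rw [← sN.finrank_eq x₀, (h0 x₀).1, finrank_bot]
    · rw [← hW₀, ← finrank_top, ← (h0 x₀).2, finrank_bot]
  have ineqI : dV + degree (Fin q → ℂ) I r + α * p ≤ m * (p + r) := by
    -- If `I = W`, the pair `(V, I)` is all of `E` and is not tested; equality then holds by `hm`.
    by_cases hIt : ∀ x, I x = ⊤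
    · have h1 : r = q := by
        rw [← sI.finrank_eq x₀, hIt x₀, finrank_top, hW₀]
      have h2 : I = fun x => ⊤ := funext hIt
      subst h1
      rw [hm, h2]
    have h1 := hE' _ p I r subI (fun h0 => hp.ne' ?_) (fun h0 => hIt fun x => (h0 x).2)
    · rw [← alphaSlope_mul α (by omega)]
      exact mul_le_mul_of_nonneg_right h1 (by positivity)
    · rw [← hV₀, ← finrank_top, (h0 x₀).1, finrank_bot]
  refine le_alphaMax_of_mul_le hp hq hpq (by omega) hrq (r := r) ?_
  have hp' : (p : ℝ) ≠ 0 := by exact_mod_cast hp.ne'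
  have hq' : (q : ℝ) ≠ 0 := by exact_mod_cast hq.ne'
  have hk' : (k : ℝ) = p - r := by
    rw [← hkr]
    push_cast
    ring
  -- The sum of `ineqN`, `ineqI` and `hdeg`: the degrees of `N` and `I` cancel, while `k + p = 2p -
  -- r` and `k + p + r = 2p`.
  have h1 : 2 * dV - r * dL + α * (2 * p - r) ≤ m * (2 * p) := by
    rw [hk'] at ineqN
    linarith
  have h2 : 2 * (p : ℝ) * q * (α + (dV / p - dW / q)) =
      2 * p * q * α + 2 * (q * dV - p * dW) := by
    field_simp
  rw [h2]
  -- Multiplication by `p + q` clears the denominator of the slope `m`.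
  have h3 := mul_le_mul_of_nonneg_right h1 (by positivity : (0 : ℝ) ≤ p + q)
  have h4 : m * (2 * p) * (p + q) = 2 * p * (dV + dW + α * p) := by
    rw [← hm]
    ring
  rw [h4] at h3
  linarith

/-- The Higgs bundle `(W, V, γ, β)`. -/
def swap (E : TwistedHiggsBundle (Fin p → ℂ) V (Fin q → ℂ) W ℂ L) :
    TwistedHiggsBundle (Fin q → ℂ) W (Fin p → ℂ) V ℂ L where
  β := E.γ
  γ := E.β
  holomorphic_β := E.holomorphic_γ
  holomorphic_γ := E.holomorphic_β

theorem IsSemistable.swap (hp : 0 < p) {E : TwistedHiggsBundle (Fin p → ℂ) V (Fin q → ℂ) W ℂ L}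
    {α : ℝ} (hE : E.IsSemistable α) : E.swap.IsSemistable (-α) := by
  intro W' q' V' p' hsub hbot htop
  have h1 := hE V' p' W' q' ⟨hsub.right, hsub.left, hsub.map_γ, hsub.map_β⟩
    (fun h => hbot fun x => (h x).symm) fun h => htop fun x => (h x).symm
  -- The slope shift requires positive total rank; a subobject of ranks `0, 0` is `(0, 0)`, which is
  -- excluded.
  have hpos : 0 < p' + q' := by
    by_contra h0
    obtain ⟨rfl, rfl⟩ : p' = 0 ∧ q' = 0 := by omega
    exact hbot fun x => ⟨hsub.left.eq_bot x, hsub.right.eq_bot x⟩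
  rw [alphaSlope_swap α hpos, alphaSlope_swap α (by rw [finrank_fin_fun]; omega)]
  linarith

theorem alphaMin_le (hp : 0 < p) (hq : 0 < q) (hpq : p ≠ q)
    (E : TwistedHiggsBundle (Fin p → ℂ) V (Fin q → ℂ) W ℂ L) {α : ℝ} (hE : E.IsSemistable α) :
    alphaMin p q (bundleDegree (Fin p → ℂ) V / p - bundleDegree (Fin q → ℂ) W / q)
      (bundleDegree ℂ L) ≤ α := by
  have h1 := E.swap.le_alphaMax hq hp hpq.symm (hE.swap hp)
  rw [← neg_alphaMax_swap, neg_sub]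
  linarith

end TwistedHiggsBundle

end Bounds

end TwistedHiggs

end

open TwistedHiggs in
/-- `X` is a compact Riemann surface, `V`, `W` are holomorphic vector bundles of ranks `p`, `q` and
`L` is a holomorphic line bundle on `X`. -/
theorem proposition3p7
    {X : Type*} [TopologicalSpace X] [T2Space X] [CompactSpace X] [ConnectedSpace X]
    [ChartedSpace ℂ X] [IsManifold 𝓘(ℂ) ω X]
    {p q : ℕ} (hp : 0 < p) (hq : 0 < q) (hpq : p ≠ q)
    {V : X → Type*} [∀ x, AddCommGroup (V x)] [∀ x, Module ℂ (V x)]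
    [∀ x, TopologicalSpace (V x)] [TopologicalSpace (TotalSpace (Fin p → ℂ) V)]
    [FiberBundle (Fin p → ℂ) V] [VectorBundle ℂ (Fin p → ℂ) V]
    [ContMDiffVectorBundle ω (Fin p → ℂ) V 𝓘(ℂ)]
    {W : X → Type*} [∀ x, AddCommGroup (W x)] [∀ x, Module ℂ (W x)]
    [∀ x, TopologicalSpace (W x)] [TopologicalSpace (TotalSpace (Fin q → ℂ) W)]
    [FiberBundle (Fin q → ℂ) W] [VectorBundle ℂ (Fin q → ℂ) W]
    [ContMDiffVectorBundle ω (Fin q → ℂ) W 𝓘(ℂ)]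
    {L : X → Type*} [∀ x, AddCommGroup (L x)] [∀ x, Module ℂ (L x)]
    [∀ x, TopologicalSpace (L x)] [TopologicalSpace (TotalSpace ℂ L)]
    [FiberBundle ℂ L] [VectorBundle ℂ ℂ L] [ContMDiffVectorBundle ω ℂ L 𝓘(ℂ)]
    (E : TwistedHiggsBundle (Fin p → ℂ) V (Fin q → ℂ) W ℂ L)
    (α : ℝ) (hE : E.IsSemistable α) :
    alphaMin p q (bundleDegree (Fin p → ℂ) V / p - bundleDegree (Fin q → ℂ) W / q)
        (bundleDegree ℂ L) ≤ α ∧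
      α ≤ alphaMax p q (bundleDegree (Fin p → ℂ) V / p - bundleDegree (Fin q → ℂ) W / q)
        (bundleDegree ℂ L) :=
  ⟨E.alphaMin_le hp hq hpq hE, E.le_alphaMax hp hq hpq hE⟩
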